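/- The $k$-core $G^{(k)}$ of a finite graph $G$ is its (unique) maximal subgraph of minimum degree at least $k$ (possibly empty), and $\mathcal{G}(n,m)$ denotes the uniform distribution over graphs on $n$ labelled vertices with exactly $m$ edges. Fix an integer $k\ge 15$. Let $m$ be an integer with $\frac16(7k-1)n\le m\le n\log n$ ($\log$ being the natural logarithm), let $H\sim\mathcal{G}(n,m)$, and let $G$ be the graph obtained from $H$ by adding a uniformly random set of $\lfloor n/8\rfloor$ new edges, i.e. of pairs of distinct vertices not adjacent in $H$. Then \[ \Pr\left(H^{(k)}\text{ is Hamiltonian, and } G^{(k)}\text{ is connected but not Hamiltonian}\right)=o(n^{-3}) \] as $n\to\infty$, uniformly in $m$: for every $\varepsilon>0$ there is $N=N(k,\varepsilon)$ such that for all $n\ge N$ and all integers $m$ with $\frac16(7k-1)n\le m\le n\log n$ this probability is at most $\varepsilon n^{-3}$. -/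

import Mathlib

open MeasureTheory ProbabilityTheory

namespace KCore

/-- A subgraph (on finitely many vertices) has minimum degree at least `k`: each of its vertices
has at least `k` neighbours inside it. The subgraph without vertices qualifies. -/
def MinDegreeGE {V : Type*} {G : SimpleGraph V} (k : ℕ) (S : G.Subgraph) : Prop :=
  ∀ v ∈ S.verts, k ≤ (S.neighborSet v).ncard

/-- The `k`-core of a graph `G`: the largest subgraph of `G` of minimum degree at least `k`
(see `kCore_isGreatest`). It may have no vertices. -/
def kCore {V : Type*} (G : SimpleGraph V) (k : ℕ) : G.Subgraph :=
  sSup {S : G.Subgraph | MinDegreeGE k S}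

theorem kCore_isGreatest {V : Type*} [Finite V] (G : SimpleGraph V) (k : ℕ) :
    IsGreatest {S : G.Subgraph | MinDegreeGE k S} (kCore G k) := by
  refine ⟨?_, fun S hS => le_sSup hS⟩
  intro v hv
  simp only [kCore, SimpleGraph.Subgraph.verts_sSup, Set.mem_iUnion] at hv
  obtain ⟨S, hS, hvS⟩ := hv
  refine (hS v hvS).trans (Set.ncard_le_ncard ?_ (Set.toFinite _))
  intro w hw
  exact (le_sSup hS : S ≤ kCore G k).2 hw

open Classical in
/-- A subgraph, as a graph on its own vertex set, has a Hamilton cycle (the one-vertex graph counts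
as Hamiltonian, the graph without vertices does not). -/
noncomputable def IsHamiltonianSubgraph {V : Type*} [Finite V] {G : SimpleGraph V}
    (S : G.Subgraph) : Prop :=
  letI : Fintype S.verts := Fintype.ofFinite S.verts
  S.coe.IsHamiltonian

/-- The law `𝒢(n,m)`: uniform among the graphs on `n` labelled vertices with exactly `m` edges. -/
noncomputable def gnm (n m : ℕ) : Measure (SimpleGraph (Fin n)) :=
  uniformOn {H | H.edgeSet.ncard = m}

/-- The law of the graph obtained from `H` by adding a uniformly random set of `r` new edges, that
is, a uniformly random `r`-element set of pairs of distinct vertices not adjacent in `H`. -/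
noncomputable def addUniformEdges {n : ℕ} (H : SimpleGraph (Fin n)) (r : ℕ) :
    Measure (SimpleGraph (Fin n)) :=
  uniformOn {G | ∃ F ⊆ Hᶜ.edgeSet, F.ncard = r ∧ G = H ⊔ SimpleGraph.fromEdgeSet F}

/-- The joint law of `(H, G)`, where `H ∼ 𝒢(n,m)` and, given `H`, the graph `G` is `H` plus
`r` uniformly random new edges. -/
noncomputable def sprinkle (n m r : ℕ) : Measure (SimpleGraph (Fin n) × SimpleGraph (Fin n)) :=
  (gnm n m).bind fun H => (addUniformEdges H r).map fun G => (H, G)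

/-- Every set of graphs on finitely many vertices is measurable. -/
instance instDiscreteMeasurableSpaceSimpleGraph {V : Type*} [Finite V] :
    DiscreteMeasurableSpace (SimpleGraph V) := by
  have : MeasurableSingletonClass (SimpleGraph V) := by
    refine ⟨fun G => ?_⟩
    have h := SimpleGraph.measurable_edgeSet (V := V) (measurableSet_singleton G.edgeSet)
    have e : (SimpleGraph.edgeSet ⁻¹' {G.edgeSet} : Set (SimpleGraph V)) = {G} := by
      ext G'
      simp
    rwa [e] at h
  infer_instance

theorem ncard_edgeSet_add_compl {n : ℕ} (H : SimpleGraph (Fin n)) :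
    H.edgeSet.ncard + Hᶜ.edgeSet.ncard = n.choose 2 := by
  classical
  have hd : Disjoint H.edgeSet Hᶜ.edgeSet := SimpleGraph.disjoint_edgeSet.2 disjoint_compl_right
  rw [← Set.ncard_union_eq hd (Set.toFinite _) (Set.toFinite _), ← SimpleGraph.edgeSet_sup,
    sup_compl_eq_top, ← SimpleGraph.coe_edgeFinset, Set.ncard_coe_finset,
    SimpleGraph.card_edgeFinset_top_eq_card_choose_two, Fintype.card_fin]

theorem isProbabilityMeasure_gnm {n m : ℕ} (h : m ≤ n.choose 2) :
    IsProbabilityMeasure (gnm n m) := by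
  refine isProbabilityMeasure_uniformOn' (Set.toFinite _) ?_ (MeasurableSet.of_discrete)
  have h' : m ≤ (⊤ : SimpleGraph (Fin n)).edgeSet.ncard := by
    have := ncard_edgeSet_add_compl (⊤ : SimpleGraph (Fin n))
    simp only [compl_top, SimpleGraph.edgeSet_bot, Set.ncard_empty] at this
    omega
  obtain ⟨F, hF, hc⟩ := Set.exists_subset_card_eq h'
  refine ⟨SimpleGraph.fromEdgeSet F, ?_⟩
  have e : F \ Sym2.diagSet = F := by
    ext e
    simp only [Set.mem_sdiff, Sym2.mem_diagSet, and_iff_left_iff_imp]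
    exact fun he => SimpleGraph.not_isDiag_of_mem_edgeSet _ (hF he)
  simpa [SimpleGraph.edgeSet_fromEdgeSet, e] using hc

theorem isProbabilityMeasure_addUniformEdges {n r : ℕ} (H : SimpleGraph (Fin n))
    (h : H.edgeSet.ncard + r ≤ n.choose 2) : IsProbabilityMeasure (addUniformEdges H r) := by
  refine isProbabilityMeasure_uniformOn' (Set.toFinite _) ?_ (MeasurableSet.of_discrete)
  have h' : r ≤ Hᶜ.edgeSet.ncard := by
    have := ncard_edgeSet_add_compl H
    omega
  obtain ⟨F, hF, hc⟩ := Set.exists_subset_card_eq h'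
  exact ⟨_, F, hF, hc, rfl⟩

/-- Whenever the complete graph has room for `m + r` edges, `sprinkle n m r` is a probability
measure. -/
theorem isProbabilityMeasure_sprinkle {n m r : ℕ} (h : m + r ≤ n.choose 2) :
    IsProbabilityMeasure (sprinkle n m r) := by
  have hg : IsProbabilityMeasure (gnm n m) := isProbabilityMeasure_gnm (by omega)
  refine ⟨?_⟩
  rw [sprinkle, Measure.bind_apply MeasurableSet.univ (measurable_of_finite _).aemeasurable]
  have key : ∀ᵐ H ∂(gnm n m),
      ((addUniformEdges H r).map fun G => (H, G)) Set.univ = 1 := by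
    have hs : ∀ᵐ H ∂(gnm n m), H ∈ {H : SimpleGraph (Fin n) | H.edgeSet.ncard = m} :=
      ae_cond_mem MeasurableSet.of_discrete
    filter_upwards [hs] with H hH
    have hH' : H.edgeSet.ncard = m := hH
    have := isProbabilityMeasure_addUniformEdges (r := r) H (by omega)
    rw [Measure.map_apply (measurable_of_finite _) MeasurableSet.univ]
    simp
  rw [lintegral_congr_ae key]
  simp

end KCore

/-!
Condition on `H` and split the new edges into those inside the old core `A = coreSet H k` and those
with an end outside of `A`. The latter, exposed first, already determine the vertex set `K ⊇ A` of
the core of `G`, because edges inside `A` cannot enlarge a core that contains `A`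
(`coreSet_eq_of_adj`). The remaining new edges are then uniformly random pairs inside `A`, and the
question is only whether they turn the graph on `K` into a Hamiltonian one.

The Hamilton cycle of the old core is a cycle that misses at most `s₀` vertices, where `s₀` is of
order `n / c ^ 2` for the average degree `c = 2 * m / n`, and at most `n / 900`. So `s₀` increases
of the circumference suffice. As long as the graph on `K` is not Hamiltonian, Pósa rotations
(`ncard_outerNeighbors_rotationEnds_le`) provide at least about `n ^ 2 / 80` boosters with both ends
in `A`, i.e. pairs whose addition increases the circumference
(`sq_le_two_mul_ncard_boosters_cycle`). The expected value of `(1 / 2) ^ circumference`, taken over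
the outcomes that are not yet Hamiltonian, therefore shrinks by a constant factor with each new
edge. After `n / 8` edges it is smaller than `(1 / 2) ^ n` by an exponential factor, although it
started at no more than `(1 / 2) ^ (n - s₀)` (`card_filter_losesHamiltonicity_fiber_le`).

Rotations need that sets of at most `n / 6` vertices expand by more than a factor of two. For sets
larger than `s₀` this follows from `SpreadsOut`, a property of `H` alone; for smaller ones from
`LocallySparse`, a property of `G`, since a small set of vertices of degree at least `15` without
many neighbours would be too dense (`two_mul_ncard_lt_outerNeighbors`). These two properties and the
bound `s₀` on the number of vertices outside of the core hold with high probability by union bounds.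
All exceptional probabilities are superpolynomially small, except for that of a dense set of `3 * s`
vertices with `s ≤ (log n) ^ 2`, which is `O((log n) ^ 2 / n ^ 4)`.

All averages over uniformly random sets of a given size are estimated by one lemma,
`sum_powersetCard_le`: if a random new element multiplies a weight by at most `β` on average, then
`t` elements multiply it by at most `β ^ t`.
-/

namespace KCore

open SimpleGraph

/-! ### Paths and cycles as lists, and rotations -/

/-- A path of `D`, recorded as the list of its vertices; the empty list counts as a path. -/
structure IsPathList {V : Type*} (D : SimpleGraph V) (l : List V) : Prop where
  chain : l.IsChain D.Adj
  nodup : l.Nodup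

/-- `v` comes right after `u` in the list `l`. -/
def Follows {V : Type*} (l : List V) (u v : V) : Prop :=
  ∃ i : ℕ, l[i]? = some u ∧ l[i + 1]? = some v

/-- `u` and `v` are neighbours on the list `l`. -/
def Consecutive {V : Type*} (l : List V) (u v : V) : Prop :=
  Follows l u v ∨ Follows l v u

/-- A rotation of a path whose moving end is the first entry `x`: if `x` is adjacent to a later
entry `y`, the part of the path in front of `y` is reversed. -/
inductive Rotates {V : Type*} (D : SimpleGraph V) : List V → List V → Prop
  | mk (x y : V) (A B : List V) (h : D.Adj x y) :
      Rotates D ((x :: A) ++ y :: B) ((x :: A).reverse ++ y :: B)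

section Lists

variable {V : Type*} {D : SimpleGraph V}

theorem follows_append {l₁ l₂ : List V} {u v : V} (h : Follows (l₁ ++ l₂) u v) :
    Follows l₁ u v ∨ Follows l₂ u v ∨ (l₁.getLast? = some u ∧ l₂.head? = some v) := by
  obtain ⟨i, h1, h2⟩ := h
  rcases lt_trichotomy (i + 1) l₁.length with hi | hi | hi
  · left
    exact ⟨i, by grind, by grind⟩
  · right; right
    refine ⟨by grind, ?_⟩
    rw [List.getElem?_append_right (by omega)] at h2
    rw [← h2, List.head?_eq_getElem?]; congr 1; omega
  · right; left
    refine ⟨i - l₁.length, by grind, ?_⟩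
    rw [List.getElem?_append_right (by omega)] at h2
    rw [← h2]; congr 1; omega

theorem Follows.append_left {l₁ l₂ : List V} {u v : V} (h : Follows l₁ u v) :
    Follows (l₁ ++ l₂) u v := by
  obtain ⟨i, h1, h2⟩ := h
  exact ⟨i, by grind, by grind⟩

theorem Follows.append_right {l₁ l₂ : List V} {u v : V} (h : Follows l₂ u v) :
    Follows (l₁ ++ l₂) u v := by
  obtain ⟨i, h1, h2⟩ := h
  refine ⟨l₁.length + i, by grind, ?_⟩
  rw [List.getElem?_append_right (by omega), ← h2]
  congr 1; omega

theorem follows_append_of_ends {l₁ l₂ : List V} {u v : V} (h1 : l₁.getLast? = some u)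
    (h2 : l₂.head? = some v) : Follows (l₁ ++ l₂) u v := by
  have h0 : 0 < l₁.length := by grind
  refine ⟨l₁.length - 1, by grind, ?_⟩
  rw [List.getElem?_append_right (by omega), ← h2, List.head?_eq_getElem?]
  congr 1; omega

theorem follows_reverse {l : List V} {u v : V} (h : Follows l.reverse u v) : Follows l v u := by
  obtain ⟨i, h1, h2⟩ := h
  have hi : i + 1 < l.length := by
    have := (List.getElem?_eq_some_iff.1 h2).1
    simpa using this
  rw [List.getElem?_reverse (by omega)] at h1 h2
  refine ⟨l.length - 1 - (i + 1), h2, ?_⟩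
  rw [← h1]; congr 1; omega

theorem Consecutive.append_left {l₁ l₂ : List V} {u v : V} (h : Consecutive l₁ u v) :
    Consecutive (l₁ ++ l₂) u v :=
  h.imp Follows.append_left Follows.append_left

theorem Consecutive.append_right {l₁ l₂ : List V} {u v : V} (h : Consecutive l₂ u v) :
    Consecutive (l₁ ++ l₂) u v :=
  h.imp Follows.append_right Follows.append_right

theorem consecutive_append {l₁ l₂ : List V} {u v : V} (h : Consecutive (l₁ ++ l₂) u v) :
    Consecutive l₁ u v ∨ Consecutive l₂ u v ∨ (l₁.getLast? = some u ∧ l₂.head? = some v) ∨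
      (l₁.getLast? = some v ∧ l₂.head? = some u) := by
  rcases h with h | h <;> rcases follows_append h with h | h | h <;> simp [Consecutive, h]

theorem consecutive_reverse {l : List V} {u v : V} (h : Consecutive l.reverse u v) :
    Consecutive l u v :=
  h.elim (fun h => Or.inr (follows_reverse h)) (fun h => Or.inl (follows_reverse h))

theorem Follows.unique_right {l : List V} (hl : l.Nodup) {u v w : V} (h : Follows l u v)
    (h' : Follows l u w) : v = w := by
  obtain ⟨i, h1, h2⟩ := h
  obtain ⟨j, h3, h4⟩ := h'
  have : i = j := (List.getElem?_inj (by grind) hl).1 (h1.trans h3.symm)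
  subst this
  exact Option.some.inj (h2.symm.trans h4)

theorem Follows.unique_left {l : List V} (hl : l.Nodup) {u v w : V} (h : Follows l v u)
    (h' : Follows l w u) : v = w := by
  obtain ⟨i, h1, h2⟩ := h
  obtain ⟨j, h3, h4⟩ := h'
  have : i + 1 = j + 1 := (List.getElem?_inj (by grind) hl).1 (h2.trans h4.symm)
  obtain rfl : i = j := by omega
  exact Option.some.inj (h1.symm.trans h3)

theorem IsPathList.rotate {l l' : List V} (hl : IsPathList D l) (h : Rotates D l l') :
    IsPathList D l' := by
  obtain ⟨x, y, A, B, hxy⟩ := h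
  have h1 := List.isChain_append.1 hl.chain
  refine ⟨List.isChain_append.2 ⟨?_, h1.2.1, ?_⟩, ?_⟩
  · rw [List.isChain_reverse]
    exact h1.1.imp fun a b h => h.symm
  · intro a ha b hb
    simp at ha hb
    subst ha hb
    exact hxy
  · exact (((List.reverse_perm (x :: A)).append_right _).nodup_iff).2 hl.nodup

theorem Rotates.perm {l l' : List V} (h : Rotates D l l') : l'.Perm l := by
  obtain ⟨x, y, A, B, hxy⟩ := h
  exact (List.reverse_perm (x :: A)).append_right _

theorem Rotates.getLast?_eq {l l' : List V} (h : Rotates D l l') : l'.getLast? = l.getLast? := by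
  obtain ⟨x, y, A, B, hxy⟩ := h
  rw [List.getLast?_append, List.getLast?_append]
  simp [List.getLast?_cons]

/-- The ends that the moving end of `P` can be brought to by rotations. -/
def rotationEnds (D : SimpleGraph V) (P : List V) : Set V :=
  {x | ∃ Q, Relation.ReflTransGen (Rotates D) P Q ∧ Q.head? = some x}

/-- A vertex that, like its neighbours on `P`, is not the end of a path obtained from `P` by
rotations keeps its neighbours on the path under every rotation: an edge is broken only next to a
new end. -/
theorem consecutive_of_rotations {P Q : List V} (hQ : Relation.ReflTransGen (Rotates D) P Q)
    {y : V} (hy : y ∉ rotationEnds D P)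
    (hy' : ∀ z, Consecutive P y z → z ∉ rotationEnds D P) {z : V} (hz : Consecutive Q y z) :
    Consecutive P y z := by
  induction hQ generalizing z with
  | refl => exact hz
  | @tail Q Q' hPQ hrot ih =>
    obtain ⟨x, y₀, A, B, hxy⟩ := hrot
    have hxR : x ∈ rotationEnds D P := ⟨_, hPQ, by simp⟩
    rcases consecutive_append hz with h | h | h | h
    · exact ih (consecutive_reverse h).append_left
    · exact ih h.append_right
    · -- the new edge would leave `y` as the moving end
      simp at h
      exact absurd (h.1 ▸ hxR) hy
    · simp at h
      obtain ⟨h1, h2⟩ := h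
      subst h1 h2
      obtain ⟨z₀, hz₀⟩ : ∃ z₀, (x :: A).getLast? = some z₀ := by
        simp [List.getLast?_cons]
      have hz₀R : z₀ ∈ rotationEnds D P :=
        ⟨_, hPQ.tail (Rotates.mk x y₀ A B hxy), by
          rw [List.head?_append, List.head?_reverse, hz₀]; rfl⟩
      exact absurd hz₀R (hy' z₀ (ih (Or.inr (follows_append_of_ends hz₀ (by simp)))))

theorem IsPathList.of_rotations {P Q : List V} (hP : IsPathList D P)
    (h : Relation.ReflTransGen (Rotates D) P Q) :
    IsPathList D Q ∧ Q.Perm P ∧ Q.getLast? = P.getLast? := by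
  induction h with
  | refl => exact ⟨hP, .refl _, rfl⟩
  | tail _ hr ih => exact ⟨ih.1.rotate hr, hr.perm.trans ih.2.1, hr.getLast?_eq.trans ih.2.2⟩

/-- If `P` is a longest path, each neighbour of a vertex in `rotationEnds D P` lies in that set or
next to it on `P`. -/
theorem exists_consecutive_of_adj_rotationEnds {P : List V} (hP : IsPathList D P)
    (hmax : ∀ l, IsPathList D l → l.length ≤ P.length) {x y : V} (hx : x ∈ rotationEnds D P)
    (hxy : D.Adj x y) (hy : y ∉ rotationEnds D P) :
    ∃ z ∈ rotationEnds D P, Consecutive P y z := by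
  by_contra! hcon
  have hy' : ∀ z, Consecutive P y z → z ∉ rotationEnds D P := fun z h h' => hcon z h' h
  obtain ⟨Q, hPQ, hQx⟩ := hx
  obtain ⟨hQ, hperm, -⟩ := hP.of_rotations hPQ
  obtain ⟨T, rfl⟩ : ∃ T, Q = x :: T := by
    cases Q with
    | nil => simp at hQx
    | cons a T => simp at hQx; exact ⟨T, by rw [hQx]⟩
  have hyQ : y ∈ x :: T := by
    by_contra hyQ
    have := hmax (y :: x :: T) ⟨List.isChain_cons_cons.2 ⟨hxy.symm, hQ.chain⟩,
      List.nodup_cons.2 ⟨hyQ, hQ.nodup⟩⟩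
    have := hperm.length_eq
    simp at *
    omega
  have hyT : y ∈ T := by
    rcases List.mem_cons.1 hyQ with h | h
    · exact absurd h hxy.ne'
    · exact h
  obtain ⟨A, B, rfl⟩ := List.append_of_mem hyT
  obtain ⟨z, hz⟩ : ∃ z, (x :: A).getLast? = some z := by simp [List.getLast?_cons]
  have hzR : z ∈ rotationEnds D P :=
    ⟨_, hPQ.tail (Rotates.mk x y A B hxy), by
      rw [List.head?_append, List.head?_reverse, hz]; rfl⟩
  have hcons : Consecutive ((x :: A) ++ y :: B) y z :=
    Or.inr (follows_append_of_ends hz (by simp))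
  exact hcon z hzR (consecutive_of_rotations hPQ hy hy' hcons)

/-- The neighbours of a set `S` outside of `S`. -/
def outerNeighbors (D : SimpleGraph V) (S : Set V) : Set V :=
  {y | y ∉ S ∧ ∃ x ∈ S, D.Adj x y}

/-- Pósa's lemma: the ends obtained from a longest path by rotations do not expand. -/
theorem ncard_outerNeighbors_rotationEnds_le [Finite V] {P : List V} (hP : IsPathList D P)
    (hmax : ∀ l, IsPathList D l → l.length ≤ P.length) :
    (outerNeighbors D (rotationEnds D P)).ncard ≤ 2 * (rotationEnds D P).ncard := by
  classical
  set R := rotationEnds D P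
  let f : V → V := fun x => if h : ∃ y, Follows P x y then h.choose else x
  let g : V → V := fun x => if h : ∃ y, Follows P y x then h.choose else x
  have hsub : outerNeighbors D R ⊆ f '' R ∪ g '' R := by
    rintro y ⟨hy, x, hx, hxy⟩
    obtain ⟨z, hz, h | h⟩ := exists_consecutive_of_adj_rotationEnds hP hmax hx hxy hy
    · right
      refine ⟨z, hz, ?_⟩
      have he : ∃ y, Follows P y z := ⟨y, h⟩
      simp only [g, dif_pos he]
      exact he.choose_spec.unique_left hP.nodup h
    · left
      refine ⟨z, hz, ?_⟩
      have he : ∃ y, Follows P z y := ⟨y, h⟩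
      simp only [f, dif_pos he]
      exact he.choose_spec.unique_right hP.nodup h
  calc (outerNeighbors D R).ncard ≤ (f '' R ∪ g '' R).ncard :=
        Set.ncard_le_ncard hsub (Set.toFinite _)
    _ ≤ (f '' R).ncard + (g '' R).ncard := Set.ncard_union_le _ _
    _ ≤ R.ncard + R.ncard :=
        add_le_add (Set.ncard_image_le (Set.toFinite _)) (Set.ncard_image_le (Set.toFinite _))
    _ = 2 * R.ncard := by ring

/-- A cycle of `D`, recorded as the list of its vertices from an arbitrary start: a path with at
least three vertices whose ends are adjacent. -/
structure IsCycleList (D : SimpleGraph V) (l : List V) : Prop extends IsPathList D l where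
  three_le : 3 ≤ l.length
  closed : ∃ u v, l.head? = some u ∧ l.getLast? = some v ∧ D.Adj v u

/-- The circumference of `D`: the length of a longest cycle, and `0` for a forest. -/
noncomputable def circumference (D : SimpleGraph V) : ℕ :=
  sSup {p | ∃ l, IsCycleList D l ∧ l.length = p}

theorem IsPathList.length_le [Finite V] {l : List V} (h : IsPathList D l) :
    l.length ≤ Nat.card V := by
  classical
  have := Fintype.ofFinite V
  rw [Nat.card_eq_fintype_card]
  exact h.nodup.length_le_card

theorem bddAbove_cycle_lengths [Finite V] (D : SimpleGraph V) :
    BddAbove {p | ∃ l, IsCycleList D l ∧ l.length = p} := by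
  refine ⟨Nat.card V, ?_⟩
  rintro _ ⟨l, hl, rfl⟩
  exact hl.toIsPathList.length_le

theorem IsCycleList.length_le_circumference [Finite V] {l : List V} (hl : IsCycleList D l) :
    l.length ≤ circumference D :=
  le_csSup (bddAbove_cycle_lengths D) ⟨l, hl, rfl⟩

theorem exists_cycle_of_circumference_pos [Finite V] (h : 0 < circumference D) :
    ∃ l, IsCycleList D l ∧ l.length = circumference D := by
  have hne : {p | ∃ l, IsCycleList D l ∧ l.length = p}.Nonempty := by
    by_contra hne
    rw [Set.not_nonempty_iff_eq_empty] at hne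
    rw [circumference, hne] at h
    simp at h
  exact Nat.sSup_mem hne (bddAbove_cycle_lengths D)

theorem IsPathList.mono {D' : SimpleGraph V} (h : D ≤ D') {l : List V} (hl : IsPathList D l) :
    IsPathList D' l :=
  ⟨hl.chain.imp fun _ _ => @h _ _, hl.nodup⟩

theorem IsCycleList.mono {D' : SimpleGraph V} (h : D ≤ D') {l : List V} (hl : IsCycleList D l) :
    IsCycleList D' l := by
  obtain ⟨u, v, h1, h2, h3⟩ := hl.closed
  exact ⟨hl.toIsPathList.mono h, hl.three_le, u, v, h1, h2, h h3⟩

theorem circumference_mono [Finite V] {D' : SimpleGraph V} (h : D ≤ D') :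
    circumference D ≤ circumference D' := by
  rcases Nat.eq_zero_or_pos (circumference D) with h0 | h0
  · omega
  · obtain ⟨l, hl, hlen⟩ := exists_cycle_of_circumference_pos h0
    exact hlen ▸ (hl.mono h).length_le_circumference

/-- A cycle with a vertex adjacent to a vertex off the cycle opens up to a longer path. -/
theorem IsCycleList.exists_longer_path {l : List V} (hl : IsCycleList D l) {u w : V} (hu : u ∈ l)
    (hw : w ∉ l) (huw : D.Adj u w) : ∃ l', IsPathList D l' ∧ l'.length = l.length + 1 := by
  obtain ⟨a, b, ha, hb, hab⟩ := hl.closed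
  obtain ⟨A, B, rfl⟩ := List.append_of_mem hu
  refine ⟨w :: ((u :: B) ++ A), ⟨?_, ?_⟩, by simp; omega⟩
  · rw [List.cons_append, List.isChain_cons_cons]
    refine ⟨huw.symm, ?_⟩
    rw [← List.cons_append]
    have hc := List.isChain_append.1 hl.chain
    refine List.isChain_append.2 ⟨hc.2.1, hc.1, ?_⟩
    intro x hx y hy
    rw [List.getLast?_append] at hb
    rw [Option.mem_def] at hx hy
    rw [hx] at hb
    rw [List.head?_append, hy] at ha
    simp at ha hb
    subst ha hb
    exact hab
  · rw [List.nodup_cons]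
    refine ⟨?_, (List.perm_append_comm.nodup_iff).1 hl.nodup⟩
    intro h
    apply hw
    simp at h ⊢
    tauto

/-- Adding an edge between the ends of a longest path creates a cycle through that path. -/
theorem IsPathList.length_le_circumference_of_adj [Finite V] {D' : SimpleGraph V} {l : List V}
    (hl : IsPathList D l) (h3 : 3 ≤ l.length) (hD : D ≤ D') {u v : V} (hu : l.head? = some u)
    (hv : l.getLast? = some v) (h : D'.Adj v u) : l.length ≤ circumference D' :=
  IsCycleList.length_le_circumference ⟨hl.mono hD, h3, u, v, hu, hv, h⟩

theorem IsPathList.reverse {l : List V} (hl : IsPathList D l) : IsPathList D l.reverse :=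
  ⟨by rw [List.isChain_reverse]; exact hl.chain.imp fun a b h => h.symm,
    List.nodup_reverse.2 hl.nodup⟩

theorem exists_longest_path [Finite V] (D : SimpleGraph V) :
    ∃ P, IsPathList D P ∧ ∀ l, IsPathList D l → l.length ≤ P.length := by
  have hb : BddAbove {p | ∃ l, IsPathList D l ∧ l.length = p} := by
    refine ⟨Nat.card V, ?_⟩
    rintro _ ⟨l, hl, rfl⟩
    exact hl.length_le
  have hne : {p | ∃ l, IsPathList D l ∧ l.length = p}.Nonempty :=
    ⟨0, [], ⟨List.isChain_nil, List.nodup_nil⟩, rfl⟩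
  obtain ⟨P, hP, hlen⟩ := Nat.sSup_mem hne hb
  exact ⟨P, hP, fun l hl => hlen ▸ le_csSup hb ⟨l, hl, rfl⟩⟩

end Lists

/-! ### Boosters -/

section Boosters

variable {V : Type*} {D : SimpleGraph V}

theorem exists_adj_of_mem_chain {l : List V} (h : l.IsChain D.Adj) (h2 : 2 ≤ l.length) {v : V}
    (hv : v ∈ l) : ∃ w, D.Adj v w := by
  obtain ⟨A, B, rfl⟩ := List.append_of_mem hv
  rcases B with _ | ⟨b, B⟩
  · rcases A.eq_nil_or_concat with rfl | ⟨A, a, rfl⟩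
    · simp at h2
    · have h' : List.IsChain D.Adj (A ++ a :: v :: []) := by simpa using h
      exact ⟨a, ((List.isChain_append_cons_cons.1 h').2.1).symm⟩
  · exact ⟨b, (List.isChain_append_cons_cons.1 h).2.1⟩

/-- The pairs of vertices of `K`, not adjacent in `D`, whose addition to `D` increases the
circumference. -/
def boosters (D : SimpleGraph V) (K : Set V) : Set (Sym2 V) :=
  {e | ∃ x ∈ K, ∃ y ∈ K, e = s(x, y) ∧ x ≠ y ∧ ¬ D.Adj x y ∧
    ∀ D', D ≤ D' → D'.Adj x y → circumference D < circumference D'}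

/-- In a connected graph a longest cycle that misses a vertex is shorter than a longest path. -/
theorem circumference_lt_of_longest_path [Finite V] {K : Set V}
    (hDK : ∀ u v, D.Adj u v → u ∈ K)
    (hconn : ∀ S ⊆ K, S.Nonempty → S ≠ K → ∃ u ∈ S, ∃ w, w ∉ S ∧ D.Adj u w)
    (hpos : 0 < circumference D) (hlt : circumference D < K.ncard) {P : List V}
    (hmax : ∀ l, IsPathList D l → l.length ≤ P.length) : circumference D < P.length := by
  classical
  obtain ⟨l, hl, hlen⟩ := exists_cycle_of_circumference_pos hpos
  have h3 := hl.three_le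
  have hcard : {v | v ∈ l}.ncard = l.length := by
    rw [← List.toFinset_card_of_nodup hl.nodup, ← Set.ncard_coe_finset]
    congr 1; ext; simp
  obtain ⟨u, hu, w, hw, huw⟩ := hconn {v | v ∈ l}
    (fun v hv => by
      obtain ⟨w, hw⟩ := exists_adj_of_mem_chain hl.chain (by omega) hv
      exact hDK _ _ hw)
    (by
      obtain ⟨u, v, h1, h2, h3⟩ := hl.closed
      exact ⟨u, List.mem_of_mem_head? h1⟩)
    (by
      intro h
      rw [h] at hcard
      omega)
  obtain ⟨l', hl', hlen'⟩ := hl.exists_longer_path hu hw huw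
  have := hmax l' hl'
  omega

/-- Pósa's lemma, in the contrapositive: if sets of at most `a` vertices expand, the moving end of a
longest path can be brought to more than `a` vertices. -/
theorem lt_ncard_rotationEnds [Finite V] {K : Set V} (hDK : ∀ u v, D.Adj u v → u ∈ K) {a : ℕ}
    (hexp : ∀ S ⊆ K, S.Nonempty → S.ncard ≤ a → 2 * S.ncard < (outerNeighbors D S).ncard)
    {P : List V} (hP : IsPathList D P) (hmax : ∀ l, IsPathList D l → l.length ≤ P.length)
    (h2 : 2 ≤ P.length) : a < (rotationEnds D P).ncard := by
  by_contra! hle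
  have hsub : rotationEnds D P ⊆ K := by
    rintro x ⟨Q, hPQ, hx⟩
    obtain ⟨hQ, hperm, -⟩ := hP.of_rotations hPQ
    have := hperm.length_eq
    obtain ⟨w, hw⟩ := exists_adj_of_mem_chain hQ.chain (by omega) (List.mem_of_mem_head? hx)
    exact hDK _ _ hw
  have hne : (rotationEnds D P).Nonempty := by
    cases P with
    | nil => simp at h2
    | cons x T => exact ⟨x, _, .refl, rfl⟩
  have h1 := hexp _ hsub hne hle
  have h2 := ncard_outerNeighbors_rotationEnds_le hP hmax
  omega

/-- A connected graph on `K` in which sets of at most `a` vertices expand by more than a factor of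
two, and which has a cycle but no Hamilton cycle, has at least `a ^ 2 / 2` boosters. -/
theorem sq_le_two_mul_ncard_boosters [Finite V] {K : Set V}
    (hDK : ∀ u v, D.Adj u v → u ∈ K)
    (hconn : ∀ S ⊆ K, S.Nonempty → S ≠ K → ∃ u ∈ S, ∃ w, w ∉ S ∧ D.Adj u w)
    {a : ℕ}
    (hexp : ∀ S ⊆ K, S.Nonempty → S.ncard ≤ a → 2 * S.ncard < (outerNeighbors D S).ncard)
    (hpos : 0 < circumference D) (hlt : circumference D < K.ncard) :
    a ^ 2 ≤ 2 * (boosters D K).ncard := by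
  classical
  have := Fintype.ofFinite V
  obtain ⟨P, hP, hmax⟩ := exists_longest_path D
  have hcP := circumference_lt_of_longest_path hDK hconn hpos hlt hmax
  have h3 : 3 ≤ circumference D := by
    obtain ⟨l, hl, hlen⟩ := exists_cycle_of_circumference_pos hpos
    exact hlen ▸ hl.three_le
  -- for each end `x` of a rotated path, the ends `y` of the paths that keep `x` as the fixed end
  have key : ∀ x ∈ rotationEnds D P, ∃ T : Finset V, a < T.card ∧ ∀ y ∈ T,
      ∃ Q, IsPathList D Q ∧ Q.length = P.length ∧ Q.head? = some y ∧ Q.getLast? = some x := by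
    rintro x ⟨Q, hPQ, hx⟩
    obtain ⟨hQ, hperm, -⟩ := hP.of_rotations hPQ
    have hlen := hperm.length_eq
    have hlen' : Q.reverse.length = P.length := by simpa using hlen
    refine ⟨(rotationEnds D Q.reverse).toFinset, ?_, ?_⟩
    · rw [← Set.ncard_eq_toFinset_card']
      exact lt_ncard_rotationEnds hDK hexp hQ.reverse (fun l hl => hlen' ▸ hmax l hl) (by omega)
    · intro y hy
      rw [Set.mem_toFinset] at hy
      obtain ⟨Q', hQQ', hy⟩ := hy
      obtain ⟨hQ', hperm', hlast⟩ := hQ.reverse.of_rotations hQQ'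
      refine ⟨Q', hQ', hperm'.length_eq.trans hlen', hy, ?_⟩
      rw [hlast, List.getLast?_reverse, hx]
  have hR := lt_ncard_rotationEnds hDK hexp hP hmax (by omega)
  choose! T hT hTQ using key
  let R := (rotationEnds D P).toFinset
  have hRc : a < R.card := by rwa [← Set.ncard_eq_toFinset_card']
  -- the two ends of a longest path are a booster; each pair of ends is counted at most twice
  let pairs : Finset (Σ _ : V, V) := R.sigma T
  have hpairs : a * a ≤ pairs.card := by
    rw [Finset.card_sigma]
    calc a * a ≤ R.card * a := Nat.mul_le_mul_right _ hRc.le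
      _ = ∑ _x ∈ R, a := by simp
      _ ≤ ∑ x ∈ R, (T x).card := Finset.sum_le_sum fun x hx =>
          (hT x (by simpa [R] using hx)).le
  have himg : ((pairs.image fun p => s(p.1, p.2) : Finset (Sym2 V)) : Set (Sym2 V)) ⊆
      boosters D K := by
    intro e he
    simp only [Finset.coe_image, Set.mem_image, Finset.mem_coe] at he
    obtain ⟨⟨x, y⟩, hxy, rfl⟩ := he
    obtain ⟨hx, hy⟩ := Finset.mem_sigma.1 hxy
    obtain ⟨Q, hQ, hlen, hhead, hlast⟩ := hTQ x (by simpa [R] using hx) y hy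
    have hmem : ∀ v ∈ Q, v ∈ K := fun v hv => by
      obtain ⟨w, hw⟩ := exists_adj_of_mem_chain hQ.chain (by omega) hv
      exact hDK _ _ hw
    have hboost : ∀ D', D ≤ D' → D'.Adj x y → circumference D < circumference D' := by
      intro D' hD hadj
      have := hQ.length_le_circumference_of_adj (by omega) hD hhead hlast hadj
      omega
    refine ⟨x, hmem x (List.mem_of_mem_getLast? hlast), y, hmem y (List.mem_of_mem_head? hhead),
      rfl, ?_, fun h => lt_irrefl _ (hboost D le_rfl h), hboost⟩
    rintro rfl
    rw [List.head?_eq_getElem?] at hhead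
    rw [List.getLast?_eq_getElem?] at hlast
    have := (List.getElem?_inj (by omega) hQ.nodup).1 (hhead.trans hlast.symm)
    omega
  have hfib := Finset.card_le_mul_card_image (f := fun p : (Σ _ : V, V) => s(p.1, p.2)) pairs 2 (by
    intro e _
    induction e with
    | _ x y =>
      refine (Finset.card_le_card (t := {⟨x, y⟩, ⟨y, x⟩}) ?_).trans Finset.card_le_two
      rintro ⟨u, v⟩ h
      simp only [Finset.mem_filter, Sym2.eq_iff] at h
      simp only [Finset.mem_insert, Finset.mem_singleton, Sigma.mk.injEq, heq_eq_eq]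
      exact h.2)
  have hle := Set.ncard_le_ncard himg (Set.toFinite _)
  rw [Set.ncard_coe_finset] at hle
  calc a ^ 2 = a * a := sq a
    _ ≤ pairs.card := hpairs
    _ ≤ 2 * _ := hfib
    _ ≤ _ := Nat.mul_le_mul_left _ hle

end Boosters

/-! ### The vertex set of the core -/

section Core

variable {V : Type*}

/-- The graph on all of `V` whose edges are the edges of `G` inside `K`. -/
def edgesWithin (G : SimpleGraph V) (K : Set V) : SimpleGraph V where
  Adj u v := G.Adj u v ∧ u ∈ K ∧ v ∈ K
  symm := ⟨fun _ _ h => ⟨h.1.symm, h.2.2, h.2.1⟩⟩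
  loopless := ⟨fun _ h => h.1.ne rfl⟩

theorem edgesWithin_mono {G G' : SimpleGraph V} {K K' : Set V} (hG : G ≤ G') (hK : K ⊆ K') :
    edgesWithin G K ≤ edgesWithin G' K' :=
  fun _ _ h => ⟨hG h.1, hK h.2.1, hK h.2.2⟩

/-- The vertex set of the `k`-core. -/
def coreSet (G : SimpleGraph V) (k : ℕ) : Set V := (kCore G k).verts

variable [Finite V]

/-- Each vertex set in which every vertex has `k` neighbours is part of the `k`-core. -/
theorem subset_coreSet {G : SimpleGraph V} {k : ℕ} {S : Set V}
    (h : ∀ v ∈ S, k ≤ (G.neighborSet v ∩ S).ncard) : S ⊆ coreSet G k := by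
  have hS : MinDegreeGE k ((⊤ : G.Subgraph).induce S) := by
    intro v hv
    refine (h v hv).trans (Set.ncard_le_ncard ?_ (Set.toFinite _))
    intro w hw
    exact ⟨hv, hw.2, hw.1⟩
  exact ((kCore_isGreatest G k).2 hS).1

theorem le_ncard_neighborSet_inter_coreSet (G : SimpleGraph V) (k : ℕ) {v : V}
    (hv : v ∈ coreSet G k) : k ≤ (G.neighborSet v ∩ coreSet G k).ncard := by
  refine ((kCore_isGreatest G k).1 v hv).trans (Set.ncard_le_ncard ?_ (Set.toFinite _))
  intro w hw
  exact ⟨(kCore G k).adj_sub hw, (kCore G k).edge_vert (Subgraph.Adj.symm hw)⟩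

/-- The core is an induced subgraph. -/
theorem spanningCoe_kCore (G : SimpleGraph V) (k : ℕ) :
    (kCore G k).spanningCoe = edgesWithin G (coreSet G k) := by
  ext u v
  refine ⟨fun h => ⟨(kCore G k).adj_sub h, (kCore G k).edge_vert h,
    (kCore G k).edge_vert (Subgraph.Adj.symm h)⟩, fun h => ?_⟩
  have hS : MinDegreeGE k ((⊤ : G.Subgraph).induce (coreSet G k)) := by
    intro v hv
    refine (le_ncard_neighborSet_inter_coreSet G k hv).trans
      (Set.ncard_le_ncard ?_ (Set.toFinite _))
    intro w hw
    exact ⟨hv, hw.2, hw.1⟩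
  exact ((kCore_isGreatest G k).2 hS).2 ⟨h.2.1, h.2.2, h.1⟩

theorem coreSet_mono {G G' : SimpleGraph V} (h : G ≤ G') (k : ℕ) : coreSet G k ⊆ coreSet G' k :=
  subset_coreSet fun _ hv => (le_ncard_neighborSet_inter_coreSet G k hv).trans
    (Set.ncard_le_ncard (fun _ hw => ⟨h hw.1, hw.2⟩) (Set.toFinite _))

/-- New edges between vertices of the core do not change the vertex set of the core. -/
theorem coreSet_eq_of_adj {G G' : SimpleGraph V} {k : ℕ} (h : G ≤ G')
    (hnew : ∀ u v, G'.Adj u v → G.Adj u v ∨ (u ∈ coreSet G k ∧ v ∈ coreSet G k)) :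
    coreSet G' k = coreSet G k := by
  refine Set.Subset.antisymm (subset_coreSet fun v hv => ?_) (coreSet_mono h k)
  by_cases hvG : v ∈ coreSet G k
  · exact (le_ncard_neighborSet_inter_coreSet G k hvG).trans
      (Set.ncard_le_ncard (fun _ hw => ⟨hw.1, coreSet_mono h k hw.2⟩) (Set.toFinite _))
  · refine (le_ncard_neighborSet_inter_coreSet G' k hv).trans
      (Set.ncard_le_ncard (fun w hw => ⟨?_, hw.2⟩) (Set.toFinite _))
    rcases hnew v w hw.1 with h1 | h1
    · exact h1
    · exact absurd h1.1 hvG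

/-- Peeling: outside of the core one can remove one vertex after the other, each incident with
fewer than `k` of the remaining edges. -/
theorem exists_set_few_edges (G : SimpleGraph V) {k : ℕ} (hk : 1 ≤ k) (s : ℕ)
    (hs : s ≤ (coreSet G k)ᶜ.ncard) :
    ∃ B : Set V, B.ncard = s ∧ B ⊆ (coreSet G k)ᶜ ∧
      {e | e ∈ G.edgeSet ∧ ∃ v ∈ B, v ∈ e}.ncard ≤ (k - 1) * s := by
  classical
  induction s with
  | zero => exact ⟨∅, by simp⟩
  | succ s ih =>
    obtain ⟨B, hBs, hBc, hBe⟩ := ih (by omega)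
    have hne : ¬ Bᶜ ⊆ coreSet G k := by
      intro hsub
      have : (coreSet G k)ᶜ ⊆ B := by
        intro v hv
        by_contra hvB
        exact hv (hsub hvB)
      have := Set.ncard_le_ncard this (Set.toFinite _)
      omega
    have hex : ∃ v ∈ Bᶜ, (G.neighborSet v ∩ Bᶜ).ncard < k := by
      by_contra! hcon
      exact hne (subset_coreSet hcon)
    obtain ⟨v, hvB, hvk⟩ := hex
    refine ⟨insert v B, ?_, ?_, ?_⟩
    · rw [Set.ncard_insert_of_notMem hvB (Set.toFinite _), hBs]
    · rintro w (rfl | hw)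
      · intro hw
        refine absurd (le_ncard_neighborSet_inter_coreSet G k hw) (not_le.2 (lt_of_le_of_lt ?_ hvk))
        exact Set.ncard_le_ncard (fun u hu => ⟨hu.1, fun huB => hBc huB hu.2⟩) (Set.toFinite _)
      · exact hBc hw
    · have hsub : {e | e ∈ G.edgeSet ∧ ∃ u ∈ insert v B, u ∈ e} ⊆
          {e | e ∈ G.edgeSet ∧ ∃ u ∈ B, u ∈ e} ∪ (fun w => s(v, w)) '' (G.neighborSet v ∩ Bᶜ) := by
        rintro e ⟨he, u, hu, hue⟩
        by_cases hB : ∃ u ∈ B, u ∈ e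
        · exact Or.inl ⟨he, hB⟩
        · right
          have huv : u = v := by
            rcases hu with h | h
            · exact h
            · exact absurd ⟨u, h, hue⟩ hB
          subst huv
          obtain ⟨w, rfl⟩ := hue
          refine ⟨w, ⟨he, fun hw => hB ⟨w, hw, by simp⟩⟩, rfl⟩
      calc _ ≤ _ := Set.ncard_le_ncard hsub (Set.toFinite _)
        _ ≤ _ := Set.ncard_union_le _ _
        _ ≤ (k - 1) * s + (k - 1) :=
          add_le_add hBe ((Set.ncard_image_le (Set.toFinite _)).trans (by omega))
        _ = (k - 1) * (s + 1) := by ring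

end Core

/-! ### Hamilton cycles of subgraphs as lists -/

section Hamilton

variable {V : Type*} [Finite V] {G : SimpleGraph V}

/-- A Hamilton cycle of a subgraph with at least three vertices, as a list. -/
theorem exists_cycleList_of_isHamiltonianSubgraph {S : G.Subgraph} (h : IsHamiltonianSubgraph S)
    (h3 : 3 ≤ S.verts.ncard) :
    ∃ l, IsCycleList S.spanningCoe l ∧ l.length = S.verts.ncard ∧ ∀ v, v ∈ l ↔ v ∈ S.verts := by
  classical
  let _ : Fintype S.verts := Fintype.ofFinite S.verts
  have hcard : Fintype.card S.verts = S.verts.ncard := by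
    rw [Set.ncard_def, Set.encard, ENat.card_eq_coe_fintype_card, ENat.toNat_natCast]
  obtain ⟨a, p, hp⟩ : ∃ a, ∃ p : S.coe.Walk a a, p.IsHamiltonianCycle := by
    refine h ?_
    omega
  have hlen := hp.length_eq
  refine ⟨p.support.tail.map Subtype.val, ⟨⟨?_, ?_⟩, ?_, ?_⟩, ?_, ?_⟩
  · refine (List.isChain_map _).2 ?_
    exact p.isChain_adj_support.tail.imp fun u v huv => huv
  · exact hp.isCycle.support_nodup.map Subtype.val_injective
  · simp; omega
  · have hnil : ¬ p.Nil := hp.isCycle.not_nil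
    refine ⟨p.snd, a, ?_, ?_, ?_⟩
    · cases p with
      | nil => exact absurd Walk.Nil.nil hnil
      | cons h q =>
        rw [Walk.snd_cons, Walk.support_cons, List.tail_cons, ← q.cons_tail_support]
        rfl
    · cases p with
      | nil => exact absurd Walk.Nil.nil hnil
      | cons h q =>
        rw [List.getLast?_map, Walk.support_cons, List.tail_cons,
          List.getLast?_eq_some_getLast q.support_ne_nil, Walk.getLast_support]
        rfl
    · exact p.adj_snd hnil
  · simp; omega
  · intro v
    constructor
    · intro hv
      obtain ⟨w, -, rfl⟩ := List.mem_map.1 hv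
      exact w.2
    · intro hv
      refine List.mem_map.2 ⟨⟨v, hv⟩, ?_, rfl⟩
      rw [← Walk.support_tail_of_not_nil _ hp.isCycle.not_nil]
      exact hp.isHamiltonian_tail.mem_support _

/-- A cycle through all vertices of a subgraph makes it Hamiltonian. -/
theorem isHamiltonianSubgraph_of_cycleList {S : G.Subgraph} {l : List V}
    (hl : IsCycleList S.spanningCoe l) (hlen : l.length = S.verts.ncard) :
    IsHamiltonianSubgraph S := by
  classical
  let _ : Fintype S.verts := Fintype.ofFinite S.verts
  have hcard : Fintype.card S.verts = S.verts.ncard := by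
    rw [Set.ncard_def, Set.encard, ENat.card_eq_coe_fintype_card, ENat.toNat_natCast]
  have h3 := hl.three_le
  have hmem : ∀ v ∈ l, v ∈ S.verts := fun v hv => by
    obtain ⟨w, hw⟩ := exists_adj_of_mem_chain hl.chain (by omega) hv
    exact S.edge_vert hw
  lift l to List S.verts using hmem
  obtain ⟨u, v, hu, hv, huv⟩ := hl.closed
  have hne : l ≠ [] := by
    rintro rfl
    simp at h3
  have hchain : l.IsChain S.coe.Adj := ((List.isChain_map _).1 hl.chain).imp fun u v huv => huv
  have hu' : (l.head hne : V) = u := by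
    rw [List.head?_map, List.head?_eq_some_head hne] at hu
    simpa using hu
  have hv' : (l.getLast hne : V) = v := by
    rw [List.getLast?_map, List.getLast?_eq_some_getLast hne] at hv
    simpa using hv
  have hadj : S.coe.Adj (l.getLast hne) (l.head hne) := by
    rw [Subgraph.coe_adj, hu', hv']
    exact huv
  intro _
  let p := Walk.ofSupport l hne hchain
  have hp : p.IsPath := Walk.IsPath.mk' (by
    rw [Walk.support_ofSupport]
    exact hl.nodup.of_map _)
  have hpl : p.length = l.length - 1 := Walk.length_ofSupport hne hchain
  simp only [List.length_map] at h3 hlen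
  refine ⟨_, Walk.cons hadj p, ?_⟩
  rw [Walk.isHamiltonianCycle_iff_isCycle_and_length_eq]
  refine ⟨(Walk.cons_isCycle_iff _ _).2 ⟨hp, fun hmem => ?_⟩, ?_⟩
  · have := hp.length_eq_one_of_mem_edges (by rwa [Sym2.eq_swap])
    omega
  · rw [Walk.length_cons, hcard]
    omega

end Hamilton

/-! ### Expansion, and boosters inside the old core -/

section Expansion

variable {V : Type*}

/-- Every set of `3 * s` vertices with `1 ≤ s ≤ s₀` spans fewer than `15 * s / 2` edges. -/
def LocallySparse (G : SimpleGraph V) (s₀ : ℕ) : Prop :=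
  ∀ s, 1 ≤ s → s ≤ s₀ → ∀ T : Finset V, T.card = 3 * s →
    2 * {e | e ∈ G.edgeSet ∧ ∀ v ∈ e, v ∈ T}.ncard < 15 * s

/-- For `s₀ < s ≤ a`, the vertices of an `s`-set have neighbours outside of each set of `4 * s`
vertices that contains it. -/
def SpreadsOut (G : SimpleGraph V) (s₀ a : ℕ) : Prop :=
  ∀ S Z : Finset V, s₀ < S.card → S.card ≤ a → S ⊆ Z → Z.card = 4 * S.card →
    ∃ u ∈ S, ∃ w, w ∉ Z ∧ G.Adj u w

theorem LocallySparse.mono [Finite V] {G G' : SimpleGraph V} {s₀ : ℕ} (hG : G' ≤ G)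
    (h : LocallySparse G s₀) : LocallySparse G' s₀ := by
  intro s h1 h2 T hT
  refine lt_of_le_of_lt (Nat.mul_le_mul_left 2 (Set.ncard_le_ncard ?_ (Set.toFinite _)))
    (h s h1 h2 T hT)
  exact fun e he => ⟨edgeSet_mono hG he.1, he.2⟩

/-- Degrees of at least `15` from `S` into `T ⊇ S` give at least `15 * |S| / 2` edges inside
`T`. -/
theorem mul_card_le_two_mul_ncard_edges [Finite V] {Γ : SimpleGraph V} {S T : Finset V}
    (hST : S ⊆ T) (hdeg : ∀ v ∈ S, 15 ≤ (Γ.neighborSet v ∩ T).ncard) :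
    15 * S.card ≤ 2 * {e | e ∈ Γ.edgeSet ∧ ∀ v ∈ e, v ∈ T}.ncard := by
  classical
  have := Fintype.ofFinite V
  let N : V → Finset V := fun v => T.filter fun w => Γ.Adj v w
  have hN : ∀ v ∈ S, 15 ≤ (N v).card := by
    intro v hv
    refine (hdeg v hv).trans (le_of_eq ?_)
    rw [← Set.ncard_coe_finset]
    congr 1
    ext w
    simp [N, and_comm]
  let pairs : Finset (Σ _ : V, V) := S.sigma N
  have hpairs : 15 * S.card ≤ pairs.card := by
    rw [Finset.card_sigma, mul_comm, ← smul_eq_mul]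
    exact Finset.card_nsmul_le_sum _ _ _ hN
  have hfib := Finset.card_le_mul_card_image (f := fun p : (Σ _ : V, V) => s(p.1, p.2)) pairs 2 (by
    intro e _
    induction e with
    | _ x y =>
      refine (Finset.card_le_card (t := {⟨x, y⟩, ⟨y, x⟩}) ?_).trans Finset.card_le_two
      rintro ⟨u, v⟩ h
      simp only [Finset.mem_filter, Sym2.eq_iff] at h
      simp only [Finset.mem_insert, Finset.mem_singleton, Sigma.mk.injEq, heq_eq_eq]
      exact h.2)
  refine hpairs.trans (hfib.trans (Nat.mul_le_mul_left 2 ?_))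
  rw [← Set.ncard_coe_finset]
  refine Set.ncard_le_ncard ?_ (Set.toFinite _)
  intro e he
  simp only [Finset.coe_image, Set.mem_image, Finset.mem_coe] at he
  obtain ⟨⟨x, y⟩, hxy, rfl⟩ := he
  obtain ⟨hx, hy⟩ := Finset.mem_sigma.1 hxy
  obtain ⟨hyT, hadj⟩ := Finset.mem_filter.1 hy
  refine ⟨hadj, fun v hv => ?_⟩
  rcases Sym2.mem_iff.1 hv with rfl | rfl
  · exact hST hx
  · exact hyT

/-- Between a graph that spreads out and one that is locally sparse, a graph of minimum degree `15`
on almost all vertices expands. -/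
theorem two_mul_ncard_lt_outerNeighbors [Finite V] {H Γ : SimpleGraph V} {s₀ a : ℕ}
    (hH : SpreadsOut H s₀ a) (hG : LocallySparse Γ s₀) (hle : H ≤ Γ)
    (ha : 4 * a ≤ Nat.card V) {K : Set V} (hK : Kᶜ.ncard ≤ s₀)
    (hdeg : ∀ v ∈ K, 15 ≤ (Γ.neighborSet v ∩ K).ncard) {S : Set V} (hSK : S ⊆ K)
    (hS : S.Nonempty) (hSa : S.ncard ≤ a) :
    2 * S.ncard < (outerNeighbors (edgesWithin Γ K) S).ncard := by
  classical
  have := Fintype.ofFinite V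
  rw [Nat.card_eq_fintype_card] at ha
  by_contra! hcon
  set O := outerNeighbors (edgesWithin Γ K) S
  have hpos : 0 < S.ncard := (Set.ncard_pos (Set.toFinite _)).2 hS
  have hSc : S.toFinset.card = S.ncard := (Set.ncard_eq_toFinset_card' S).symm
  have hSO : (S ∪ O).ncard ≤ 3 * S.ncard := (Set.ncard_union_le _ _).trans (by omega)
  have hnb : ∀ v ∈ S, Γ.neighborSet v ∩ K ⊆ S ∪ O := by
    intro v hv w hw
    by_cases hwS : w ∈ S
    · exact Or.inl hwS
    · exact Or.inr ⟨hwS, v, hv, hw.1, hSK hv, hw.2⟩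
  rcases le_or_gt S.ncard s₀ with hs | hs
  · -- a small `S` that does not expand spans too many edges with its neighbours
    obtain ⟨T, hT, hTc⟩ := Finset.exists_superset_card_eq (s := (S ∪ O).toFinset)
      (n := 3 * S.ncard) (by rwa [← Set.ncard_eq_toFinset_card']) (by omega)
    have hT' : S ∪ O ⊆ T := fun v hv => hT (Set.mem_toFinset.2 hv)
    have h1 := mul_card_le_two_mul_ncard_edges (Γ := Γ) (S := S.toFinset) (T := T)
      (fun v hv => hT' (Or.inl (Set.mem_toFinset.1 hv))) (by
        intro v hv
        rw [Set.mem_toFinset] at hv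
        refine (hdeg v (hSK hv)).trans (Set.ncard_le_ncard ?_ (Set.toFinite _))
        exact fun w hw => ⟨hw.1, hT' (hnb v hv hw)⟩)
    have h2 := hG S.ncard hpos hs T hTc
    omega
  · -- a large `S` has a neighbour outside of any `4 * |S|` vertices containing `S`, its neighbours
    -- in `K`, and the complement of `K`
    have hSOK : (S ∪ O ∪ Kᶜ).ncard ≤ 4 * S.ncard := (Set.ncard_union_le _ _).trans (by omega)
    obtain ⟨Z, hZ, hZc⟩ := Finset.exists_superset_card_eq (s := (S ∪ O ∪ Kᶜ).toFinset)
      (n := 4 * S.ncard) (by rwa [← Set.ncard_eq_toFinset_card']) (by omega)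
    have hZ' : S ∪ O ∪ Kᶜ ⊆ Z := fun v hv => hZ (Set.mem_toFinset.2 hv)
    obtain ⟨u, hu, w, hw, huw⟩ := hH S.toFinset Z (by omega) (by omega)
      (fun v hv => hZ' (Or.inl (Or.inl (Set.mem_toFinset.1 hv)))) (by omega)
    rw [Set.mem_toFinset] at hu
    have hwK : w ∈ K := by
      by_contra hwK
      exact hw (hZ' (Or.inr hwK))
    exact hw (hZ' (Or.inl (hnb u hu ⟨hle huw, hwK⟩)))

/-- A path does not cross a cut without edges. -/
theorem forall_mem_iff_of_isChain {D : SimpleGraph V} {S : Set V}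
    (hS : ∀ u v, D.Adj u v → (u ∈ S ↔ v ∈ S)) {l : List V} (hl : l.IsChain D.Adj) {u v : V}
    (hu : u ∈ l) (hv : v ∈ l) : u ∈ S ↔ v ∈ S := by
  have hc : l.IsChain fun u v => (u ∈ S ↔ v ∈ S) := hl.imp fun a b h => hS a b h
  have : Trans (fun u v : V => (u ∈ S ↔ v ∈ S)) (fun u v : V => (u ∈ S ↔ v ∈ S))
      (fun u v : V => (u ∈ S ↔ v ∈ S)) := ⟨fun h1 h2 => h1.trans h2⟩
  have : Std.Symm fun u v : V => (u ∈ S ↔ v ∈ S) := ⟨fun _ _ h => h.symm⟩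
  exact List.Pairwise.forall_of_forall (R := fun u v : V => (u ∈ S ↔ v ∈ S)) (fun _ _ => Iff.rfl)
    hc.pairwise hu hv

/-- If a cycle through almost all vertices is given, the minimum degree is at least `15` and there
is no Hamilton cycle on `K`, there are many boosters that join vertices of that cycle. -/
theorem sq_le_two_mul_ncard_boosters_cycle [Finite V] {H Γ : SimpleGraph V} {s₀ a : ℕ}
    (hH : SpreadsOut H s₀ a) (hG : LocallySparse Γ s₀) (hle : H ≤ Γ)
    (ha : 4 * a ≤ Nat.card V) (hsa : s₀ ≤ a) {A K : Set V} (hAK : A ⊆ K) (hA : Aᶜ.ncard ≤ s₀)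
    (hdeg : ∀ v ∈ K, 15 ≤ (Γ.neighborSet v ∩ K).ncard)
    {l : List V} (hl : IsCycleList (edgesWithin H A) l) (hlA : ∀ v, v ∈ l ↔ v ∈ A)
    (hlt : circumference (edgesWithin Γ K) < K.ncard) :
    a ^ 2 ≤ 2 * ((boosters (edgesWithin Γ K) A).ncard + s₀ * Nat.card V) := by
  classical
  have := Fintype.ofFinite V
  have hKc : Kᶜ.ncard ≤ s₀ :=
    (Set.ncard_le_ncard (Set.compl_subset_compl.2 hAK) (Set.toFinite _)).trans hA
  have hexp : ∀ S ⊆ K, S.Nonempty → S.ncard ≤ a →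
      2 * S.ncard < (outerNeighbors (edgesWithin Γ K) S).ncard :=
    fun S hSK hS hSa => two_mul_ncard_lt_outerNeighbors hH hG hle ha hKc hdeg hSK hS hSa
  have hl' : IsCycleList (edgesWithin Γ K) l := hl.mono (edgesWithin_mono hle hAK)
  have hlen := hl'.length_le_circumference
  have h3 := hl.three_le
  have hconn : ∀ S ⊆ K, S.Nonempty → S ≠ K →
      ∃ u ∈ S, ∃ w, w ∉ S ∧ (edgesWithin Γ K).Adj u w := by
    intro S hSK hS hSK'
    by_contra! hcon
    have hiff : ∀ u v, (edgesWithin Γ K).Adj u v → (u ∈ S ↔ v ∈ S) := by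
      intro u v huv
      constructor
      · intro hu
        by_contra hv
        exact hcon u hu v hv huv
      · intro hv
        by_contra hu
        exact hcon v hv u hu huv.symm
    -- the side of the cut that the cycle avoids is small and does not expand
    have hside : ∀ T ⊆ K, T.Nonempty → (∀ v ∈ l, v ∉ T) →
        (∀ u v, (edgesWithin Γ K).Adj u v → (u ∈ T ↔ v ∈ T)) → False := by
      intro T hTK hT hlT hTiff
      have hTc : T.ncard ≤ a := by
        refine (Set.ncard_le_ncard (t := Aᶜ) ?_ (Set.toFinite _)).trans (hA.trans hsa)
        exact fun v hv hvA => hlT v ((hlA v).2 hvA) hv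
      have h1 := hexp T hTK hT hTc
      have h2 : outerNeighbors (edgesWithin Γ K) T = ∅ := by
        ext y
        simp only [outerNeighbors, Set.mem_ofPred_eq, Set.mem_empty_iff_false, iff_false]
        rintro ⟨hy, x, hx, hxy⟩
        exact hy ((hTiff x y hxy).1 hx)
      rw [h2] at h1
      simp at h1
    obtain ⟨u, hu⟩ : ∃ u, u ∈ l := List.exists_mem_of_length_pos (by omega)
    by_cases huS : u ∈ S
    · refine hside (K \ S) Set.sdiff_subset ?_ ?_ ?_
      · by_contra hne
        rw [Set.not_nonempty_iff_eq_empty, Set.sdiff_eq_empty] at hne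
        exact hSK' (Set.Subset.antisymm hSK hne)
      · intro v hv hvS
        exact hvS.2 ((forall_mem_iff_of_isChain hiff hl'.chain hu hv).1 huS)
      · intro u v huv
        have := hiff u v huv
        simp [huv.2.1, huv.2.2, this]
    · exact hside S hSK hS (fun v hv hvS =>
        huS ((forall_mem_iff_of_isChain hiff hl'.chain hu hv).2 hvS)) hiff
  have hsq := sq_le_two_mul_ncard_boosters (D := edgesWithin Γ K) (fun u v h => h.2.1) hconn
    hexp (by omega) hlt
  refine hsq.trans (Nat.mul_le_mul_left 2 ?_)
  -- few pairs of vertices have an end outside of `A`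
  have hsub : boosters (edgesWithin Γ K) K ⊆ boosters (edgesWithin Γ K) A ∪
      (fun p : V × V => s(p.1, p.2)) '' (Aᶜ ×ˢ Set.univ) := by
    rintro e ⟨x, hx, y, hy, rfl, hne, h1, h2⟩
    by_cases hxA : x ∈ A
    · by_cases hyA : y ∈ A
      · exact Or.inl ⟨x, hxA, y, hyA, rfl, hne, h1, h2⟩
      · exact Or.inr ⟨(y, x), ⟨hyA, trivial⟩, Sym2.eq_swap⟩
    · exact Or.inr ⟨(x, y), ⟨hxA, trivial⟩, rfl⟩
  refine (Set.ncard_le_ncard hsub (Set.toFinite _)).trans ((Set.ncard_union_le _ _).trans ?_)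
  refine Nat.add_le_add_left ((Set.ncard_image_le (Set.toFinite _)).trans ?_) _
  rw [Set.ncard_prod, Set.ncard_univ]
  exact Nat.mul_le_mul_right _ hA

end Expansion

/-! ### Averages over random sets -/

section Weights

variable {α : Type*} [DecidableEq α]

/-- Each `(t + 1)`-set arises from its `t`-subsets in `t + 1` ways. -/
theorem sum_powersetCard_sum_insert (U : Finset α) (w : Finset α → ℝ) (t : ℕ) :
    ∑ X ∈ U.powersetCard t, ∑ x ∈ U \ X, w (insert x X) =
      (t + 1) * ∑ Y ∈ U.powersetCard (t + 1), w Y := by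
  have h : (t + 1) * ∑ Y ∈ U.powersetCard (t + 1), w Y =
      ∑ Y ∈ U.powersetCard (t + 1), ∑ _x ∈ Y, w Y := by
    rw [Finset.mul_sum]
    refine Finset.sum_congr rfl fun Y hY => ?_
    rw [Finset.sum_const, (Finset.mem_powersetCard.1 hY).2]
    simp
  rw [h, Finset.sum_sigma', Finset.sum_sigma']
  refine Finset.sum_bij' (fun p _ => ⟨insert p.2 p.1, p.2⟩) (fun p _ => ⟨p.1.erase p.2, p.2⟩)
    ?_ ?_ ?_ ?_ ?_
  · rintro ⟨X, x⟩ h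
    simp only [Finset.mem_sigma, Finset.mem_powersetCard, Finset.mem_sdiff] at h ⊢
    refine ⟨⟨Finset.insert_subset h.2.1 h.1.1, ?_⟩, Finset.mem_insert_self _ _⟩
    rw [Finset.card_insert_of_notMem h.2.2, h.1.2]
  · rintro ⟨Y, x⟩ h
    simp only [Finset.mem_sigma, Finset.mem_powersetCard, Finset.mem_sdiff] at h ⊢
    refine ⟨⟨(Finset.erase_subset _ _).trans h.1.1, ?_⟩, h.1.1 h.2, Finset.notMem_erase _ _⟩
    rw [Finset.card_erase_of_mem h.2, h.1.2]
    rfl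
  · rintro ⟨X, x⟩ h
    simp only [Finset.mem_sigma, Finset.mem_sdiff] at h
    simp [Finset.erase_insert h.2.2]
  · rintro ⟨Y, x⟩ h
    simp only [Finset.mem_sigma] at h
    simp [Finset.insert_erase h.2]
  · rintro ⟨X, x⟩ _
    rfl

/-- If adding a uniformly random new element multiplies a weight by at most `β` on average, the
average weight of the `t`-subsets of `U` is at most `β ^ t` times that of the empty set. -/
theorem sum_powersetCard_le (U : Finset α) (w : Finset α → ℝ) {β : ℝ} (hβ : 0 ≤ β) (t : ℕ)
    (h : ∀ X ⊆ U, X.card < t →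
      ∑ x ∈ U \ X, w (insert x X) ≤ β * (U \ X).card * w X) :
    ∑ X ∈ U.powersetCard t, w X ≤ U.card.choose t * β ^ t * w ∅ := by
  induction t with
  | zero => simp
  | succ t ih =>
    have ih' := ih fun X hX hc => h X hX (by omega)
    have h1 := sum_powersetCard_sum_insert U w t
    have h2 : ∑ X ∈ U.powersetCard t, ∑ x ∈ U \ X, w (insert x X) ≤
        ∑ X ∈ U.powersetCard t, β * (U.card - t : ℕ) * w X := by
      refine Finset.sum_le_sum fun X hX => ?_
      obtain ⟨hXU, hXc⟩ := Finset.mem_powersetCard.1 hX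
      have := h X hXU (by omega)
      rwa [Finset.card_sdiff_of_subset hXU, hXc] at this
    rw [← Finset.mul_sum, h1] at h2
    have h3 : β * ((U.card - t : ℕ) : ℝ) * ∑ X ∈ U.powersetCard t, w X ≤
        β * ((U.card - t : ℕ) : ℝ) * (U.card.choose t * β ^ t * w ∅) :=
      mul_le_mul_of_nonneg_left ih' (by positivity)
    have h4 : ((U.card.choose (t + 1) : ℕ) : ℝ) * (t + 1) = U.card.choose t * (U.card - t : ℕ) := by
      exact_mod_cast Nat.choose_succ_right_eq U.card t
    have h5 : (0 : ℝ) < (t : ℝ) + 1 := by positivity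
    refine le_of_mul_le_mul_left ((h2.trans h3).trans (le_of_eq ?_)) h5
    calc _ = (U.card.choose t * (U.card - t : ℕ)) * (β ^ (t + 1) * w ∅) := by ring
      _ = _ := by rw [← h4]; ring

/-- A weight that never increases, and that each of at least `b` new elements multiplies by at most
`ρ`, decays by the factor `1 - (1 - ρ) * b / |U|` per random element. -/
theorem sum_powersetCard_le_of_decreasing (U : Finset α) (w : Finset α → ℝ) (hw : ∀ X, 0 ≤ w X)
    {ρ b : ℝ} (hρ0 : 0 ≤ ρ) (hρ : ρ ≤ 1) (hb : b ≤ U.card) (t : ℕ)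
    (hdec : ∀ X ⊆ U, ∀ x ∈ U \ X, w (insert x X) ≤ w X)
    (hgain : ∀ X ⊆ U, X.card < t → w X ≠ 0 → ∃ B ⊆ U \ X, b ≤ B.card ∧
      ∀ x ∈ B, w (insert x X) ≤ ρ * w X) :
    ∑ X ∈ U.powersetCard t, w X ≤ U.card.choose t * (1 - (1 - ρ) * b / U.card) ^ t * w ∅ := by
  rcases Nat.eq_zero_or_pos U.card with hU | hU
  · obtain rfl := Finset.card_eq_zero.1 hU
    rcases t with _ | t
    · simp
    · rw [Finset.powersetCard_eq_empty.2 (by simp)]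
      simp
  have hU' : (0 : ℝ) < U.card := by exact_mod_cast hU
  have hle : (1 - ρ) * b / U.card ≤ 1 := by
    rw [div_le_one hU']
    rcases le_or_gt b 0 with hb0 | hb0
    · nlinarith
    · nlinarith
  refine sum_powersetCard_le U w (by linarith) t fun X hX hXt => ?_
  by_cases hX0 : w X = 0
  · rw [hX0, mul_zero]
    refine Finset.sum_nonpos fun x hx => ?_
    rw [← hX0]
    exact hdec X hX x hx
  obtain ⟨B, hBX, hbB, hB⟩ := hgain X hX hXt hX0
  have hcard : ((U \ X).card : ℝ) = ((U \ X) \ B).card + B.card := by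
    exact_mod_cast (Finset.card_sdiff_add_card_eq_card hBX).symm
  have hwX := hw X
  rcases le_or_gt b 0 with hb0 | hb0
  · calc ∑ x ∈ U \ X, w (insert x X) ≤ ∑ x ∈ U \ X, w X := Finset.sum_le_sum (hdec X hX)
      _ = 1 * (U \ X).card * w X := by simp
      _ ≤ _ := by
        gcongr
        have : (1 - ρ) * b / U.card ≤ 0 :=
          div_nonpos_of_nonpos_of_nonneg (mul_nonpos_of_nonneg_of_nonpos (by linarith) hb0) hU'.le
        linarith
  calc ∑ x ∈ U \ X, w (insert x X)
      = ∑ x ∈ (U \ X) \ B, w (insert x X) + ∑ x ∈ B, w (insert x X) :=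
        (Finset.sum_sdiff hBX).symm
    _ ≤ ∑ x ∈ (U \ X) \ B, w X + ∑ x ∈ B, ρ * w X :=
        add_le_add (Finset.sum_le_sum fun x hx => hdec X hX x (Finset.mem_sdiff.1 hx).1)
          (Finset.sum_le_sum hB)
    _ = ((U \ X).card - (1 - ρ) * B.card) * w X := by
        rw [hcard]; simp; ring
    _ ≤ ((U \ X).card - (1 - ρ) * b) * w X := by
        gcongr
    _ ≤ (1 - (1 - ρ) * b / U.card) * (U \ X).card * w X := by
        gcongr
        have h1 : ((U \ X).card : ℝ) ≤ U.card := by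
          exact_mod_cast Finset.card_le_card Finset.sdiff_subset
        have h2 : (1 - ρ) * b / U.card * (U \ X).card ≤ (1 - ρ) * b := by
          rw [div_mul_eq_mul_div, div_le_iff₀ hU']
          exact mul_le_mul_of_nonneg_left h1 (mul_nonneg (by linarith) hb0.le)
        linarith

/-- Exponential moment of the number of elements of `P` among `t` random elements of `U` and the
given set `Y`. -/
theorem sum_powersetCard_pow_card_inter_le (U P Y : Finset α) {θ : ℝ} (hθ : 1 ≤ θ) {t : ℕ}
    (ht : t < U.card) :
    ∑ X ∈ U.powersetCard t, θ ^ ((Y ∪ X) ∩ P).card ≤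
      U.card.choose t * (1 + (θ - 1) * P.card / (U.card - t)) ^ t * θ ^ (Y ∩ P).card := by
  have ht' : (0 : ℝ) < (U.card : ℝ) - t := by
    have : (t : ℝ) < U.card := by exact_mod_cast ht
    linarith
  have hq : 0 ≤ (θ - 1) * P.card / (U.card - t) :=
    div_nonneg (mul_nonneg (by linarith) (by positivity)) ht'.le
  have := sum_powersetCard_le U (fun X => θ ^ ((Y ∪ X) ∩ P).card)
    (β := 1 + (θ - 1) * P.card / (U.card - t)) (by linarith) t ?_
  · simpa using this
  intro X hX hXt
  have hstep : ∀ x ∈ U \ X, θ ^ ((Y ∪ insert x X) ∩ P).card ≤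
      θ ^ ((Y ∪ X) ∩ P).card + if x ∈ P then (θ - 1) * θ ^ ((Y ∪ X) ∩ P).card else 0 := by
    intro x _
    split_ifs with hxP
    · have : ((Y ∪ insert x X) ∩ P).card ≤ ((Y ∪ X) ∩ P).card + 1 := by
        rw [Finset.union_insert, Finset.insert_inter_of_mem hxP]
        exact Finset.card_insert_le _ _
      calc θ ^ ((Y ∪ insert x X) ∩ P).card ≤ θ ^ (((Y ∪ X) ∩ P).card + 1) :=
            pow_le_pow_right₀ hθ this
        _ = _ := by ring
    · rw [Finset.union_insert, Finset.insert_inter_of_notMem hxP, add_zero]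
  have hw : 0 ≤ θ ^ ((Y ∪ X) ∩ P).card := by positivity
  have hcard : (U.card : ℝ) - t ≤ (U \ X).card := by
    rw [Finset.card_sdiff_of_subset hX, Nat.cast_sub (Finset.card_le_card hX)]
    have : (X.card : ℝ) ≤ t := by exact_mod_cast hXt.le
    linarith
  calc _ ≤ _ := Finset.sum_le_sum hstep
    _ = (U \ X).card * θ ^ ((Y ∪ X) ∩ P).card +
        ((U \ X).filter (· ∈ P)).card * ((θ - 1) * θ ^ ((Y ∪ X) ∩ P).card) := by
      rw [Finset.sum_add_distrib, ← Finset.sum_filter]; simp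
    _ ≤ (U \ X).card * θ ^ ((Y ∪ X) ∩ P).card +
        P.card * ((θ - 1) * θ ^ ((Y ∪ X) ∩ P).card) := by
      have : ((U \ X).filter (· ∈ P)).card ≤ P.card :=
        Finset.card_le_card fun x hx => (Finset.mem_filter.1 hx).2
      have h1 : 0 ≤ (θ - 1) * θ ^ ((Y ∪ X) ∩ P).card := mul_nonneg (by linarith) hw
      gcongr
    _ = ((U \ X).card + (θ - 1) * P.card) * θ ^ ((Y ∪ X) ∩ P).card := by ring
    _ ≤ _ := by
      gcongr
      have h1 : (θ - 1) * P.card = (θ - 1) * P.card / (U.card - t) * (U.card - t) := by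
        field_simp
      have h2 := mul_le_mul_of_nonneg_left hcard hq
      linarith

end Weights

/-! ### The joint law as a uniform choice of edge sets -/

section Sprinkling

/-- The average of `f X F` over the `m`-subsets `X` of `U` and the `r`-subsets `F` of `U \ X`. -/
noncomputable def pairAvg {α : Type*} [DecidableEq α] (U : Finset α) (m r : ℕ)
    (f : Finset α → Finset α → ℝ) : ℝ :=
  (∑ X ∈ U.powersetCard m, ∑ F ∈ (U \ X).powersetCard r, f X F) /
    (U.card.choose m * (U.card - m).choose r)

theorem lintegral_uniformOn_finset {Ω : Type*} [MeasurableSpace Ω] [MeasurableSingletonClass Ω]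
    (s : Finset Ω) (f : Ω → ENNReal) :
    ∫⁻ x, f x ∂(uniformOn (s : Set Ω)) = (∑ x ∈ s, f x) / s.card := by
  rw [uniformOn, ProbabilityTheory.cond, lintegral_smul_measure, lintegral_finset,
    Measure.count_apply_finset, ENNReal.div_eq_inv_mul]
  simp

open Classical in
/-- The edges of the complete graph on `n` vertices. -/
noncomputable def allEdges (n : ℕ) : Finset (Sym2 (Fin n)) := (⊤ : SimpleGraph (Fin n)).edgeFinset

theorem mem_allEdges {n : ℕ} {e : Sym2 (Fin n)} : e ∈ allEdges n ↔ ¬ e.IsDiag := by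
  simp [allEdges]

theorem card_allEdges (n : ℕ) : (allEdges n).card = n.choose 2 := by
  classical
  rw [allEdges]
  convert SimpleGraph.card_edgeFinset_top_eq_card_choose_two (V := Fin n)
  simp

/-- The graph with a given finite set of edges. -/
def graphOf {n : ℕ} (X : Finset (Sym2 (Fin n))) : SimpleGraph (Fin n) :=
  SimpleGraph.fromEdgeSet (X : Set (Sym2 (Fin n)))

theorem edgeSet_graphOf {n : ℕ} {X : Finset (Sym2 (Fin n))} (hX : X ⊆ allEdges n) :
    (graphOf X).edgeSet = X := by
  rw [graphOf, SimpleGraph.edgeSet_fromEdgeSet]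
  ext e
  simp only [Set.mem_sdiff, Finset.mem_coe, Sym2.mem_diagSet, and_iff_left_iff_imp]
  exact fun he => mem_allEdges.1 (hX he)

theorem graphOf_adj {n : ℕ} {X : Finset (Sym2 (Fin n))} (hX : X ⊆ allEdges n) {u v : Fin n} :
    (graphOf X).Adj u v ↔ s(u, v) ∈ X := by
  rw [← SimpleGraph.mem_edgeSet, edgeSet_graphOf hX, Finset.mem_coe]

theorem graphOf_mono {n : ℕ} {X Y : Finset (Sym2 (Fin n))} (h : X ⊆ Y) :
    graphOf X ≤ graphOf Y :=
  SimpleGraph.fromEdgeSet_mono (by exact_mod_cast h)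

theorem graphOf_injOn (n : ℕ) : Set.InjOn (graphOf (n := n)) {X | X ⊆ allEdges n} := by
  intro X hX Y hY h
  have := congrArg SimpleGraph.edgeSet h
  rw [edgeSet_graphOf hX, edgeSet_graphOf hY] at this
  exact_mod_cast this

theorem exists_graphOf_eq {n : ℕ} (H : SimpleGraph (Fin n)) :
    ∃ X ⊆ allEdges n, graphOf X = H := by
  classical
  refine ⟨H.edgeFinset, ?_, ?_⟩
  · intro e he
    rw [mem_allEdges]
    exact H.not_isDiag_of_mem_edgeSet (SimpleGraph.mem_edgeFinset.1 he)
  · simp [graphOf]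

open Classical in
theorem setOf_ncard_edgeSet_eq (n m : ℕ) :
    {H : SimpleGraph (Fin n) | H.edgeSet.ncard = m} =
      (((allEdges n).powersetCard m).image graphOf : Finset (SimpleGraph (Fin n))) := by
  ext H
  simp only [Set.mem_ofPred_eq, Finset.coe_image, Set.mem_image, Finset.mem_coe,
    Finset.mem_powersetCard]
  constructor
  · intro h
    obtain ⟨X, hX, rfl⟩ := exists_graphOf_eq H
    rw [edgeSet_graphOf hX, Set.ncard_coe_finset] at h
    exact ⟨X, ⟨hX, h⟩, rfl⟩
  · rintro ⟨X, ⟨hX, h⟩, rfl⟩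
    rw [edgeSet_graphOf hX, Set.ncard_coe_finset, h]

open Classical in
/-- The graphs that `addUniformEdges` chooses from, in terms of the edge set `X` of the first
graph. -/
theorem setOf_addEdges_eq {n r : ℕ} {X : Finset (Sym2 (Fin n))} (hX : X ⊆ allEdges n) :
    {G | ∃ F ⊆ (graphOf X)ᶜ.edgeSet, F.ncard = r ∧
        G = graphOf X ⊔ SimpleGraph.fromEdgeSet F} =
      (((allEdges n \ X).powersetCard r).image fun F => graphOf (X ∪ F) :
        Finset (SimpleGraph (Fin n))) := by
  have hc : (graphOf X)ᶜ.edgeSet = ((allEdges n \ X : Finset _) : Set (Sym2 (Fin n))) := by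
    ext e
    induction e with
    | _ u v =>
      rw [SimpleGraph.mem_edgeSet, SimpleGraph.compl_adj, graphOf_adj hX, Finset.mem_coe,
        Finset.mem_sdiff, mem_allEdges]
      simp
  ext G
  simp only [Set.mem_ofPred_eq, Finset.coe_image, Set.mem_image, Finset.mem_coe,
    Finset.mem_powersetCard, hc]
  constructor
  · rintro ⟨F, hF, hr, rfl⟩
    refine ⟨F.toFinset, ⟨?_, ?_⟩, ?_⟩
    · intro e he
      exact_mod_cast hF (Set.mem_toFinset.1 he)
    · rw [← Set.ncard_eq_toFinset_card', hr]
    · rw [graphOf, graphOf, Finset.coe_union, Set.coe_toFinset, SimpleGraph.fromEdgeSet_union]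
  · rintro ⟨F, ⟨hF, hr⟩, rfl⟩
    refine ⟨F, by exact_mod_cast hF, by rw [Set.ncard_coe_finset, hr], ?_⟩
    rw [graphOf, graphOf, Finset.coe_union, SimpleGraph.fromEdgeSet_union]

open Classical in
/-- The probability of an event under `sprinkle`, as a proportion of pairs of edge sets. -/
theorem sprinkle_real_eq_pairAvg {n m r : ℕ} (hmr : m + r ≤ n.choose 2)
    (E : Set (SimpleGraph (Fin n) × SimpleGraph (Fin n))) :
    (sprinkle n m r).real E = pairAvg (allEdges n) m r
      fun X F => if (graphOf X, graphOf (X ∪ F)) ∈ E then 1 else 0 := by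
  have hadd : ∀ X ∈ (allEdges n).powersetCard m,
      addUniformEdges (graphOf X) r {G | (graphOf X, G) ∈ E} =
        ((((allEdges n \ X).powersetCard r).filter
          fun F => (graphOf X, graphOf (X ∪ F)) ∈ E).card : ENNReal) /
          (((allEdges n).card - m).choose r : ℕ) := by
    intro X hX
    obtain ⟨hXU, hXm⟩ := Finset.mem_powersetCard.1 hX
    have hinj : Set.InjOn (fun F => graphOf (X ∪ F))
        ((allEdges n \ X).powersetCard r : Finset (Finset (Sym2 (Fin n)))) := by
      intro F hF F' hF' h
      have hF1 := (Finset.mem_powersetCard.1 (Finset.mem_coe.1 hF)).1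
      have hF2 := (Finset.mem_powersetCard.1 (Finset.mem_coe.1 hF')).1
      have hu : X ∪ F = X ∪ F' := graphOf_injOn n
        (Finset.union_subset hXU (hF1.trans Finset.sdiff_subset))
        (Finset.union_subset hXU (hF2.trans Finset.sdiff_subset)) h
      have h1 : Disjoint X F := Finset.disjoint_of_subset_right hF1 Finset.disjoint_sdiff
      have h2 : Disjoint X F' := Finset.disjoint_of_subset_right hF2 Finset.disjoint_sdiff
      rw [← Finset.union_sdiff_cancel_left h1, hu, Finset.union_sdiff_cancel_left h2]
    rw [addUniformEdges, setOf_addEdges_eq hXU, ← lintegral_indicator_one MeasurableSet.of_discrete,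
      lintegral_uniformOn_finset, Finset.sum_image hinj, Finset.card_image_of_injOn hinj,
      Finset.card_powersetCard, Finset.card_sdiff_of_subset hXU, hXm]
    congr 1
    rw [Finset.card_filter]
    push_cast
    refine Finset.sum_congr rfl fun F _ => ?_
    simp [Set.indicator]
  have hs : sprinkle n m r E =
      (∑ X ∈ (allEdges n).powersetCard m, ((((allEdges n \ X).powersetCard r).filter
          fun F => (graphOf X, graphOf (X ∪ F)) ∈ E).card : ENNReal) /
          (((allEdges n).card - m).choose r : ℕ)) / ((allEdges n).card.choose m : ℕ) := by
    have hinj : Set.InjOn (graphOf (n := n))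
        ((allEdges n).powersetCard m : Finset (Finset (Sym2 (Fin n)))) :=
      (graphOf_injOn n).mono fun X hX => (Finset.mem_powersetCard.1 (Finset.mem_coe.1 hX)).1
    rw [sprinkle,
      Measure.bind_apply MeasurableSet.of_discrete (measurable_of_finite _).aemeasurable, gnm,
      setOf_ncard_edgeSet_eq, lintegral_uniformOn_finset, Finset.sum_image hinj,
      Finset.card_image_of_injOn hinj, Finset.card_powersetCard]
    congr 1
    refine Finset.sum_congr rfl fun X hX => ?_
    rw [Measure.map_apply (measurable_of_finite _) MeasurableSet.of_discrete, ← hadd X hX]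
    rfl
  have hpos : ((allEdges n).card - m).choose r ≠ 0 := by
    rw [card_allEdges]
    exact (Nat.choose_pos (by omega)).ne'
  rw [Measure.real, hs, ENNReal.toReal_div, ENNReal.toReal_sum, pairAvg]
  · simp only [ENNReal.toReal_div, ENNReal.toReal_natCast]
    rw [← Finset.sum_div, div_div, mul_comm]
    congr 1
    refine Finset.sum_congr rfl fun X _ => ?_
    rw [Finset.card_filter]
    push_cast
    rfl
  · intro X _
    exact ENNReal.div_ne_top (ENNReal.natCast_ne_top _) (by exact_mod_cast hpos)

end Sprinkling

/-! ### Lower tails, and random subsets of a disjoint union -/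

section Counting

variable {α : Type*} [DecidableEq α]

/-- Lower tail: few `m`-subsets of `U` have at most `a` elements in `P`. The weight
`θ ^ |X ∩ P|` is at least `θ ^ a` on these sets. For `θ = 0` and `a = 0` they are the sets that
avoid `P`. -/
theorem pow_mul_card_filter_inter_le {U P : Finset α} (hP : P ⊆ U) {θ : ℝ} (hθ0 : 0 ≤ θ)
    (hθ : θ ≤ 1) (m a : ℕ) :
    θ ^ a * ((U.powersetCard m).filter fun X => (X ∩ P).card ≤ a).card ≤
      U.card.choose m * (1 - (1 - θ) * (P.card - a) / U.card) ^ m := by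
  let w : Finset α → ℝ := fun X => if (X ∩ P).card ≤ a then θ ^ (X ∩ P).card else 0
  have hw : ∀ X, 0 ≤ w X := fun X => by simp only [w]; split_ifs <;> positivity
  have hPU : (P.card : ℝ) ≤ U.card := by exact_mod_cast Finset.card_le_card hP
  have hins : ∀ X : Finset α, ∀ x ∉ X, (insert x X ∩ P).card =
      (X ∩ P).card + if x ∈ P then 1 else 0 := by
    intro X x hx
    split_ifs with hxP
    · rw [Finset.insert_inter_of_mem hxP, Finset.card_insert_of_notMem fun h =>
        hx (Finset.mem_inter.1 h).1]
    · rw [Finset.insert_inter_of_notMem hxP, add_zero]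
  have key := sum_powersetCard_le_of_decreasing U w hw hθ0 hθ (b := P.card - a) (by
      have : (0 : ℝ) ≤ a := by positivity
      linarith) m ?_ ?_
  · have h0 : w ∅ = 1 := by simp [w]
    rw [h0, mul_one] at key
    refine le_trans ?_ key
    rw [Finset.card_filter, Nat.cast_sum, Finset.mul_sum]
    refine Finset.sum_le_sum fun X _ => ?_
    simp only [w]
    split_ifs with h
    · simpa using pow_le_pow_of_le_one hθ0 hθ h
    · simp
  · intro X _ x hx
    have hxX := (Finset.mem_sdiff.1 hx).2
    simp only [w, hins X x hxX]
    by_cases h : (X ∩ P).card ≤ a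
    · rw [if_pos h]
      split_ifs <;>
        first | exact pow_le_pow_of_le_one hθ0 hθ (Nat.le_add_right _ _) | positivity
    · rw [if_neg h]
      split_ifs <;> first | omega | exact le_rfl
  · intro X hX _ hX0
    have hle : (X ∩ P).card ≤ a := by
      by_contra h
      exact hX0 (by simp [w, h])
    refine ⟨P \ X, Finset.sdiff_subset_sdiff hP le_rfl, ?_, ?_⟩
    · have h1 : (P \ X).card + (X ∩ P).card = P.card := by
        rw [Finset.inter_comm]; exact Finset.card_sdiff_add_card_inter P X
      have h2 : ((P \ X).card : ℝ) + (X ∩ P).card = P.card := by exact_mod_cast h1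
      have h3 : ((X ∩ P).card : ℝ) ≤ a := by exact_mod_cast hle
      linarith
    · intro x hx
      obtain ⟨hxP, hxX⟩ := Finset.mem_sdiff.1 hx
      simp only [w, hins X x hxX, if_pos hxP, if_pos hle]
      split_ifs
      · rw [pow_succ]; linarith [mul_comm θ (θ ^ (X ∩ P).card)]
      · positivity

/-- Splitting a random `r`-subset of a disjoint union. -/
theorem sum_powersetCard_union {O A : Finset α} (h : Disjoint O A) (r : ℕ) (f : Finset α → ℝ) :
    ∑ F ∈ (O ∪ A).powersetCard r, f F =
      ∑ T ∈ O.powerset.filter (fun T => T.card ≤ r),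
        ∑ Y ∈ A.powersetCard (r - T.card), f (T ∪ Y) := by
  rw [Finset.sum_sigma']
  refine Finset.sum_bij' (fun F _ => ⟨F ∩ O, F ∩ A⟩) (fun p _ => p.1 ∪ p.2) ?_ ?_ ?_ ?_ ?_
  · intro F hF
    obtain ⟨hFU, hFr⟩ := Finset.mem_powersetCard.1 hF
    have hdisj : Disjoint (F ∩ O) (F ∩ A) :=
      Finset.disjoint_of_subset_left Finset.inter_subset_right
        (Finset.disjoint_of_subset_right Finset.inter_subset_right h)
    have hu : F ∩ O ∪ F ∩ A = F := by
      rw [← Finset.inter_union_distrib_left, Finset.inter_eq_left.2 hFU]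
    have hc := Finset.card_union_of_disjoint hdisj
    rw [hu, hFr] at hc
    simp only [Finset.mem_sigma, Finset.mem_filter, Finset.mem_powerset, Finset.mem_powersetCard]
    exact ⟨⟨Finset.inter_subset_right, by omega⟩, Finset.inter_subset_right, by omega⟩
  · rintro ⟨T, Y⟩ hp
    simp only [Finset.mem_sigma, Finset.mem_filter, Finset.mem_powerset,
      Finset.mem_powersetCard] at hp ⊢
    obtain ⟨⟨hT, hTr⟩, hY, hYc⟩ := hp
    refine ⟨Finset.union_subset_union hT hY, ?_⟩
    rw [Finset.card_union_of_disjoint (Finset.disjoint_of_subset_left hT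
      (Finset.disjoint_of_subset_right hY h))]
    omega
  · intro F hF
    obtain ⟨hFU, hFr⟩ := Finset.mem_powersetCard.1 hF
    simp only
    rw [← Finset.inter_union_distrib_left, Finset.inter_eq_left.2 hFU]
  · rintro ⟨T, Y⟩ hp
    simp only [Finset.mem_sigma, Finset.mem_filter, Finset.mem_powerset,
      Finset.mem_powersetCard] at hp
    obtain ⟨⟨hT, hTr⟩, hY, hYc⟩ := hp
    have h1 : (T ∪ Y) ∩ O = T := by
      rw [Finset.union_inter_distrib_right, Finset.inter_eq_left.2 hT,
        Finset.disjoint_iff_inter_eq_empty.1 (Finset.disjoint_of_subset_left hY h.symm),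
        Finset.union_empty]
    have h2 : (T ∪ Y) ∩ A = Y := by
      rw [Finset.union_inter_distrib_right, Finset.inter_eq_left.2 hY,
        Finset.disjoint_iff_inter_eq_empty.1 (Finset.disjoint_of_subset_left hT h),
        Finset.empty_union]
    simp only [h1, h2]
  · intro F hF
    obtain ⟨hFU, hFr⟩ := Finset.mem_powersetCard.1 hF
    simp only
    rw [← Finset.inter_union_distrib_left, Finset.inter_eq_left.2 hFU]

end Counting

/-! ### Union bounds for the core and for spreading out -/

section GraphCounts

variable {n : ℕ}

open Classical in
/-- The pairs of vertices with an end in `S` and the other end not in `Z`. -/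
noncomputable def crossing (S Z : Finset (Fin n)) : Finset (Sym2 (Fin n)) :=
  (S ×ˢ Zᶜ).image fun p => s(p.1, p.2)

theorem crossing_subset {S Z : Finset (Fin n)} (h : S ⊆ Z) : crossing S Z ⊆ allEdges n := by
  classical
  intro e he
  obtain ⟨⟨u, w⟩, huw, rfl⟩ := Finset.mem_image.1 he
  obtain ⟨hu, hw⟩ := Finset.mem_product.1 huw
  rw [mem_allEdges, Sym2.mk_isDiag_iff]
  intro huw'
  rw [← huw'] at hw
  exact (Finset.mem_compl.1 hw) (h hu)

theorem card_crossing {S Z : Finset (Fin n)} (h : S ⊆ Z) :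
    (crossing S Z).card = S.card * (n - Z.card) := by
  classical
  rw [crossing, Finset.card_image_of_injOn, Finset.card_product, Finset.card_compl,
    Fintype.card_fin]
  rintro ⟨u, w⟩ h1 ⟨u', w'⟩ h2 heq
  obtain ⟨hu, hw⟩ := Finset.mem_product.1 (Finset.mem_coe.1 h1)
  obtain ⟨hu', hw'⟩ := Finset.mem_product.1 (Finset.mem_coe.1 h2)
  simp only at hu hw hu' hw' heq
  rcases Sym2.eq_iff.1 heq with ⟨rfl, rfl⟩ | ⟨rfl, rfl⟩
  · rfl
  · exact absurd (h hu) (Finset.mem_compl.1 hw')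

open Classical in
/-- The pairs of vertices of `T`. -/
noncomputable def edgesInside (T : Finset (Fin n)) : Finset (Sym2 (Fin n)) :=
  (allEdges n).filter fun e => ∀ v ∈ e, v ∈ T

theorem two_mul_card_edgesInside_le (T : Finset (Fin n)) :
    2 * (edgesInside T).card ≤ T.card ^ 2 := by
  classical
  have hsub : T.offDiag.image (Function.uncurry Sym2.mk) = edgesInside T := by
    ext e
    induction e with
    | _ u v =>
      simp only [Finset.mem_image, Finset.mem_offDiag, edgesInside, Finset.mem_filter,
        mem_allEdges, Sym2.mk_isDiag_iff, Sym2.mem_iff, Prod.exists, forall_eq_or_imp, forall_eq]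
      constructor
      · rintro ⟨a, b, ⟨ha, hb, hab⟩, h⟩
        rcases Sym2.eq_iff.1 h with ⟨rfl, rfl⟩ | ⟨rfl, rfl⟩
        · exact ⟨hab, ha, hb⟩
        · exact ⟨fun h => hab h.symm, hb, ha⟩
      · rintro ⟨h, hu, hv⟩
        exact ⟨u, v, ⟨hu, hv, h⟩, rfl⟩
  rw [← hsub, Sym2.two_mul_card_image_offDiag, Finset.offDiag_card, sq]
  omega

open Classical in
/-- Few graphs with `m` edges have a core that misses more than `s₀` vertices: peeling gives a set
of `s₀` vertices that meets fewer edges than it should. -/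
theorem card_filter_lt_compl_coreSet_le {k : ℕ} (hk : 1 ≤ k) (m s₀ : ℕ) {θ : ℝ} (hθ0 : 0 < θ)
    (hθ : θ ≤ 1) :
    (((allEdges n).powersetCard m).filter fun X =>
      s₀ < (coreSet (graphOf X) k)ᶜ.ncard).card ≤
      (n.choose s₀ : ℝ) * ((allEdges n).card.choose m * ((1 - (1 - θ) *
        ((s₀ * (n - s₀ : ℕ) : ℕ) - ((k - 1) * s₀ : ℕ)) / (allEdges n).card) ^ m /
          θ ^ ((k - 1) * s₀))) := by
  have hsub : (((allEdges n).powersetCard m).filter fun X =>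
      s₀ < (coreSet (graphOf X) k)ᶜ.ncard) ⊆
      ((Finset.univ : Finset (Fin n)).powersetCard s₀).biUnion fun B =>
        ((allEdges n).powersetCard m).filter fun X =>
          (X ∩ crossing B B).card ≤ (k - 1) * s₀ := by
    intro X hX
    obtain ⟨hXm, hXs⟩ := Finset.mem_filter.1 hX
    have hXU := (Finset.mem_powersetCard.1 hXm).1
    obtain ⟨B, hBs, -, hBe⟩ := exists_set_few_edges (graphOf X) hk s₀ hXs.le
    refine Finset.mem_biUnion.2 ⟨B.toFinset, Finset.mem_powersetCard.2 ⟨Finset.subset_univ _, ?_⟩,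
      Finset.mem_filter.2 ⟨hXm, le_trans ?_ hBe⟩⟩
    · rw [← Set.ncard_eq_toFinset_card', hBs]
    · rw [← Set.ncard_coe_finset]
      refine Set.ncard_le_ncard ?_ (Set.toFinite _)
      intro e he
      obtain ⟨heX, hec⟩ := Finset.mem_inter.1 (Finset.mem_coe.1 he)
      refine ⟨by rw [edgeSet_graphOf hXU]; exact heX, ?_⟩
      obtain ⟨⟨u, w⟩, huw, rfl⟩ := Finset.mem_image.1 hec
      exact ⟨u, Set.mem_toFinset.1 (Finset.mem_product.1 huw).1, by simp⟩
  have hB : ∀ B ∈ (Finset.univ : Finset (Fin n)).powersetCard s₀,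
      ((((allEdges n).powersetCard m).filter fun X =>
          (X ∩ crossing B B).card ≤ (k - 1) * s₀).card : ℝ) ≤
      (allEdges n).card.choose m * ((1 - (1 - θ) *
        ((s₀ * (n - s₀ : ℕ) : ℕ) - ((k - 1) * s₀ : ℕ)) / (allEdges n).card) ^ m /
          θ ^ ((k - 1) * s₀)) := by
    intro B hB
    have hBc := (Finset.mem_powersetCard.1 hB).2
    have := pow_mul_card_filter_inter_le (crossing_subset (Finset.Subset.refl B)) hθ0.le hθ m
      ((k - 1) * s₀)
    rw [card_crossing (Finset.Subset.refl B), hBc] at this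
    rw [← mul_div_assoc, le_div_iff₀ (by positivity)]
    convert! this using 1
    rw [mul_comm]
  calc
    _ ≤ (∑ B ∈ (Finset.univ : Finset (Fin n)).powersetCard s₀,
        (((allEdges n).powersetCard m).filter fun X =>
          (X ∩ crossing B B).card ≤ (k - 1) * s₀).card : ℝ) := by
      exact_mod_cast (Finset.card_le_card hsub).trans Finset.card_biUnion_le
    _ ≤ _ := Finset.sum_le_sum hB
    _ = _ := by simp

open Classical in
/-- Few graphs with `m` edges fail to spread out: for some `S ⊆ Z`, no edge joins `S` to
the complement of `Z`. -/
theorem card_filter_not_spreadsOut_le (m s₀ a : ℕ) :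
    (((allEdges n).powersetCard m).filter fun X => ¬ SpreadsOut (graphOf X) s₀ a).card ≤
      ∑ s ∈ Finset.Ioc s₀ a, (n.choose (4 * s) : ℝ) * ((4 * s).choose s *
        ((allEdges n).card.choose m *
          (1 - (s * (n - 4 * s : ℕ) : ℕ) / (allEdges n).card) ^ m)) := by
  have hsub : (((allEdges n).powersetCard m).filter fun X => ¬ SpreadsOut (graphOf X) s₀ a) ⊆
      (Finset.Ioc s₀ a).biUnion fun s =>
        ((Finset.univ : Finset (Fin n)).powersetCard (4 * s)).biUnion fun Z =>
          (Z.powersetCard s).biUnion fun S =>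
            ((allEdges n).powersetCard m).filter fun X => (X ∩ crossing S Z).card ≤ 0 := by
    intro X hX
    obtain ⟨hXm, hXs⟩ := Finset.mem_filter.1 hX
    have hXU := (Finset.mem_powersetCard.1 hXm).1
    simp only [SpreadsOut, not_forall] at hXs
    obtain ⟨S, Z, h1, h2, h3, h4, h5⟩ := hXs
    simp only [Finset.mem_biUnion]
    refine ⟨S.card, Finset.mem_Ioc.2 ⟨h1, h2⟩, Z,
      Finset.mem_powersetCard.2 ⟨Finset.subset_univ _, h4⟩, S,
      Finset.mem_powersetCard.2 ⟨h3, rfl⟩, Finset.mem_filter.2 ⟨hXm, ?_⟩⟩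
    rw [Nat.le_zero, Finset.card_eq_zero, Finset.eq_empty_iff_forall_notMem]
    intro e he
    obtain ⟨heX, hec⟩ := Finset.mem_inter.1 he
    obtain ⟨⟨u, w⟩, huw, rfl⟩ := Finset.mem_image.1 hec
    obtain ⟨hu, hw⟩ := Finset.mem_product.1 huw
    exact h5 ⟨u, hu, w, Finset.mem_compl.1 hw, (graphOf_adj hXU).2 heX⟩
  calc
    _ ≤ (∑ s ∈ Finset.Ioc s₀ a, ∑ Z ∈ (Finset.univ : Finset (Fin n)).powersetCard (4 * s),
          ∑ S ∈ Z.powersetCard s,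
            (((allEdges n).powersetCard m).filter fun X =>
              (X ∩ crossing S Z).card ≤ 0).card : ℝ) := by
      exact_mod_cast (Finset.card_le_card hsub).trans <|
        Finset.card_biUnion_le.trans (Finset.sum_le_sum fun s _ =>
          Finset.card_biUnion_le.trans (Finset.sum_le_sum fun Z _ => Finset.card_biUnion_le))
    _ ≤ ∑ s ∈ Finset.Ioc s₀ a, ∑ Z ∈ (Finset.univ : Finset (Fin n)).powersetCard (4 * s),
          ∑ S ∈ Z.powersetCard s, ((allEdges n).card.choose m *
            (1 - (s * (n - 4 * s : ℕ) : ℕ) / (allEdges n).card) ^ m : ℝ) := by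
      refine Finset.sum_le_sum fun s _ => Finset.sum_le_sum fun Z hZ =>
        Finset.sum_le_sum fun S hS => ?_
      have hZc := (Finset.mem_powersetCard.1 hZ).2
      obtain ⟨hSZ, hSc⟩ := Finset.mem_powersetCard.1 hS
      have := pow_mul_card_filter_inter_le (crossing_subset hSZ) le_rfl zero_le_one m 0
      rw [card_crossing hSZ, hZc, hSc] at this
      simpa using this
    _ = _ := by
      refine Finset.sum_congr rfl fun s _ => ?_
      have : ∀ Z ∈ (Finset.univ : Finset (Fin n)).powersetCard (4 * s),
          ∑ S ∈ Z.powersetCard s, ((allEdges n).card.choose m *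
            (1 - (s * (n - 4 * s : ℕ) : ℕ) / (allEdges n).card) ^ m : ℝ) =
          (4 * s).choose s * ((allEdges n).card.choose m *
            (1 - (s * (n - 4 * s : ℕ) : ℕ) / (allEdges n).card) ^ m) := by
        intro Z hZ
        rw [Finset.sum_const, Finset.card_powersetCard, (Finset.mem_powersetCard.1 hZ).2,
          nsmul_eq_mul]
      rw [Finset.sum_congr rfl this]
      simp

end GraphCounts

/-! ### The union bound for local sparsity -/

section Sparse

variable {n : ℕ}

theorem ncard_edges_inside {Y : Finset (Sym2 (Fin n))} (hY : Y ⊆ allEdges n) (T : Finset (Fin n)) :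
    {e | e ∈ (graphOf Y).edgeSet ∧ ∀ v ∈ e, v ∈ T}.ncard = (Y ∩ edgesInside T).card := by
  classical
  rw [← Set.ncard_coe_finset]
  congr 1
  ext e
  rw [edgeSet_graphOf hY]
  simp only [Set.mem_ofPred_eq, Finset.mem_coe, edgesInside, Finset.mem_inter, Finset.mem_filter]
  exact ⟨fun h => ⟨h.1, hY h.1, h.2⟩, fun h => ⟨h.1, h.2.2⟩⟩

/-- Exponential moment of the number of elements of `P` in the union of the two random sets. -/
theorem sum_sum_pow_card_inter_le {α : Type*} [DecidableEq α] (U P : Finset α) {θ : ℝ} (hθ : 1 ≤ θ)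
    {m r : ℕ} (hmr : m + r < U.card) :
    ∑ X ∈ U.powersetCard m, ∑ F ∈ (U \ X).powersetCard r, θ ^ ((X ∪ F) ∩ P).card ≤
      U.card.choose m * (U.card - m).choose r *
        (1 + (θ - 1) * P.card / (U.card - m - r)) ^ (m + r) := by
  set q : ℝ := 1 + (θ - 1) * P.card / (U.card - m - r) with hq
  have hpos : (0 : ℝ) < (U.card : ℝ) - m - r := by
    have : ((m + r : ℕ) : ℝ) < U.card := by exact_mod_cast hmr
    push_cast at this
    linarith
  have hq0 : 0 ≤ (θ - 1) * P.card := mul_nonneg (by linarith) (by positivity)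
  have hq1 : 1 ≤ q := by
    have := div_nonneg hq0 hpos.le
    linarith
  have hinner : ∀ X ∈ U.powersetCard m, ∑ F ∈ (U \ X).powersetCard r, θ ^ ((X ∪ F) ∩ P).card ≤
      (U.card - m).choose r * q ^ r * θ ^ (X ∩ P).card := by
    intro X hX
    obtain ⟨hXU, hXm⟩ := Finset.mem_powersetCard.1 hX
    have hc : (U \ X).card = U.card - m := by rw [Finset.card_sdiff_of_subset hXU, hXm]
    have := sum_powersetCard_pow_card_inter_le (U \ X) P X hθ (t := r) (by omega)
    rwa [hc, Nat.cast_sub (by omega)] at this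
  have houter : ∑ X ∈ U.powersetCard m, θ ^ (X ∩ P).card ≤ U.card.choose m * q ^ m := by
    have := sum_powersetCard_pow_card_inter_le U P ∅ hθ (t := m) (by omega)
    simp only [Finset.empty_union, Finset.empty_inter, Finset.card_empty, pow_zero, mul_one] at this
    refine this.trans ?_
    have hpos' : (0 : ℝ) < (U.card : ℝ) - m := by
      have : (0 : ℝ) ≤ r := by positivity
      linarith
    have h0 := div_nonneg hq0 hpos'.le
    refine mul_le_mul_of_nonneg_left (pow_le_pow_left₀ (by linarith) ?_ m) (by positivity)
    refine add_le_add_right (div_le_div_of_nonneg_left hq0 hpos ?_) 1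
    have : (0 : ℝ) ≤ r := by positivity
    linarith
  calc _ ≤ ∑ X ∈ U.powersetCard m, (U.card - m).choose r * q ^ r * θ ^ (X ∩ P).card :=
        Finset.sum_le_sum hinner
    _ = (U.card - m).choose r * q ^ r * ∑ X ∈ U.powersetCard m, θ ^ (X ∩ P).card := by
        rw [Finset.mul_sum]
    _ ≤ (U.card - m).choose r * q ^ r * (U.card.choose m * q ^ m) := by
        have : 0 ≤ q := by linarith
        gcongr
    _ = _ := by rw [pow_add]; ring

open Classical in
/-- Few pairs have a union that is not locally sparse, by the exponential moment
`(φ s ^ 2) ^ |edges inside T|` for each set `T` of `3 * s` vertices. The parameter is a square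
because the threshold `15 * s / 2` need not be an integer. -/
theorem sum_sum_not_locallySparse_le {m r s₀ : ℕ} (hmr : m + r < (allEdges n).card) (φ : ℕ → ℝ)
    (hφ : ∀ s, 1 ≤ φ s) :
    ∑ X ∈ (allEdges n).powersetCard m, ∑ F ∈ (allEdges n \ X).powersetCard r,
        (if LocallySparse (graphOf (X ∪ F)) s₀ then 0 else 1 : ℝ) ≤
      (allEdges n).card.choose m * ((allEdges n).card - m).choose r *
        ∑ s ∈ Finset.Icc 1 s₀, (n.choose (3 * s) : ℝ) *
          ((1 + (φ s ^ 2 - 1) * (9 * s ^ 2 / 2) / ((allEdges n).card - m - r)) ^ (m + r) /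
            φ s ^ (15 * s)) := by
  have hpos : (0 : ℝ) < ((allEdges n).card : ℝ) - m - r := by
    have : ((m + r : ℕ) : ℝ) < (allEdges n).card := by exact_mod_cast hmr
    push_cast at this
    linarith
  have hφ0 : ∀ s, 0 < φ s := fun s => lt_of_lt_of_le one_pos (hφ s)
  have hpt : ∀ X ∈ (allEdges n).powersetCard m, ∀ F ∈ (allEdges n \ X).powersetCard r,
      (if LocallySparse (graphOf (X ∪ F)) s₀ then 0 else 1 : ℝ) ≤
        ∑ s ∈ Finset.Icc 1 s₀, ∑ T ∈ (Finset.univ : Finset (Fin n)).powersetCard (3 * s),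
          (φ s ^ 2) ^ ((X ∪ F) ∩ edgesInside T).card / φ s ^ (15 * s) := by
    intro X hX F hF
    have hXU := (Finset.mem_powersetCard.1 hX).1
    have hFU := (Finset.mem_powersetCard.1 hF).1.trans Finset.sdiff_subset
    have hterm : ∀ s, ∀ T : Finset (Fin n),
        0 ≤ (φ s ^ 2) ^ ((X ∪ F) ∩ edgesInside T).card / φ s ^ (15 * s) := fun s T => by
      have := hφ0 s
      positivity
    split_ifs with h
    · exact Finset.sum_nonneg fun s _ => Finset.sum_nonneg fun T _ => hterm s T
    · simp only [LocallySparse, not_forall, not_lt] at h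
      obtain ⟨s, h1, h2, T, hT, h3⟩ := h
      rw [ncard_edges_inside (Finset.union_subset hXU hFU)] at h3
      refine le_trans ?_ (Finset.single_le_sum (fun s _ => Finset.sum_nonneg fun T _ => hterm s T)
        (Finset.mem_Icc.2 ⟨h1, h2⟩))
      refine le_trans ?_ (Finset.single_le_sum (fun T _ => hterm s T)
        (Finset.mem_powersetCard.2 ⟨Finset.subset_univ T, hT⟩))
      have := hφ0 s
      rw [one_le_div (by positivity), ← pow_mul]
      exact pow_le_pow_right₀ (hφ s) h3
  have hT : ∀ s, ∀ T ∈ (Finset.univ : Finset (Fin n)).powersetCard (3 * s),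
      ∑ X ∈ (allEdges n).powersetCard m, ∑ F ∈ (allEdges n \ X).powersetCard r,
        (φ s ^ 2) ^ ((X ∪ F) ∩ edgesInside T).card / φ s ^ (15 * s) ≤
      (allEdges n).card.choose m * ((allEdges n).card - m).choose r *
        ((1 + (φ s ^ 2 - 1) * (9 * s ^ 2 / 2) / ((allEdges n).card - m - r)) ^ (m + r) /
            φ s ^ (15 * s)) := by
    intro s T hT
    have hTc := (Finset.mem_powersetCard.1 hT).2
    have hsq : 1 ≤ φ s ^ 2 := one_le_pow₀ (hφ s)
    have h1 := sum_sum_pow_card_inter_le (allEdges n) (edgesInside T) hsq hmr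
    have hE : ((edgesInside T).card : ℝ) ≤ 9 * s ^ 2 / 2 := by
      have := two_mul_card_edgesInside_le T
      rw [hTc] at this
      have h2 : (2 * (edgesInside T).card : ℝ) ≤ (3 * s) ^ 2 := by exact_mod_cast this
      linarith
    simp only [← Finset.sum_div]
    rw [← mul_div_assoc]
    have := hφ0 s
    have h0 : 0 ≤ (φ s ^ 2 - 1) * ((edgesInside T).card : ℝ) / ((allEdges n).card - m - r) :=
      div_nonneg (mul_nonneg (by linarith) (by positivity)) hpos.le
    have h2 : 0 ≤ φ s ^ 2 - 1 := by linarith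
    gcongr
    refine h1.trans ?_
    gcongr
  calc _ ≤ ∑ X ∈ (allEdges n).powersetCard m, ∑ F ∈ (allEdges n \ X).powersetCard r,
        ∑ s ∈ Finset.Icc 1 s₀, ∑ T ∈ (Finset.univ : Finset (Fin n)).powersetCard (3 * s),
          (φ s ^ 2) ^ ((X ∪ F) ∩ edgesInside T).card / φ s ^ (15 * s) :=
        Finset.sum_le_sum fun X hX => Finset.sum_le_sum fun F hF => hpt X hX F hF
    _ = ∑ s ∈ Finset.Icc 1 s₀, ∑ T ∈ (Finset.univ : Finset (Fin n)).powersetCard (3 * s),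
        ∑ X ∈ (allEdges n).powersetCard m, ∑ F ∈ (allEdges n \ X).powersetCard r,
          (φ s ^ 2) ^ ((X ∪ F) ∩ edgesInside T).card / φ s ^ (15 * s) := by
        have h1 : ∀ X, ∑ F ∈ (allEdges n \ X).powersetCard r, ∑ s ∈ Finset.Icc 1 s₀,
            ∑ T ∈ (Finset.univ : Finset (Fin n)).powersetCard (3 * s),
              (φ s ^ 2) ^ ((X ∪ F) ∩ edgesInside T).card / φ s ^ (15 * s) =
            ∑ s ∈ Finset.Icc 1 s₀, ∑ T ∈ (Finset.univ : Finset (Fin n)).powersetCard (3 * s),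
              ∑ F ∈ (allEdges n \ X).powersetCard r,
                (φ s ^ 2) ^ ((X ∪ F) ∩ edgesInside T).card / φ s ^ (15 * s) := by
          intro X
          rw [Finset.sum_comm]
          exact Finset.sum_congr rfl fun s _ => Finset.sum_comm
        simp only [h1]
        rw [Finset.sum_comm]
        exact Finset.sum_congr rfl fun s _ => Finset.sum_comm
    _ ≤ ∑ s ∈ Finset.Icc 1 s₀, ∑ T ∈ (Finset.univ : Finset (Fin n)).powersetCard (3 * s),
        ((allEdges n).card.choose m * ((allEdges n).card - m).choose r *
        ((1 + (φ s ^ 2 - 1) * (9 * s ^ 2 / 2) / ((allEdges n).card - m - r)) ^ (m + r) /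
            φ s ^ (15 * s)) : ℝ) :=
        Finset.sum_le_sum fun s _ => Finset.sum_le_sum fun T hT' => hT s T hT'
    _ = _ := by
        rw [Finset.mul_sum]
        refine Finset.sum_congr rfl fun s _ => ?_
        rw [Finset.sum_const, Finset.card_powersetCard, Finset.card_univ, Fintype.card_fin,
          nsmul_eq_mul]
        ring

end Sparse

/-! ### Hitting boosters -/

section Hitting

variable {n : ℕ}

/-- The joint event: the core of the first graph is Hamiltonian and the core of the second one is
not. -/
def LosesHamiltonicity (k : ℕ) (H G : SimpleGraph (Fin n)) : Prop :=
  IsHamiltonianSubgraph (kCore H k) ∧ ¬ IsHamiltonianSubgraph (kCore G k)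

/-- In terms of the circumference, a non-Hamiltonian core has no cycle through all its vertices. -/
theorem circumference_lt_of_not_isHamiltonianSubgraph {V : Type*} [Finite V] {G : SimpleGraph V}
    {k : ℕ} (h : ¬ IsHamiltonianSubgraph (kCore G k)) (hne : (coreSet G k).Nonempty) :
    circumference (edgesWithin G (coreSet G k)) < (coreSet G k).ncard := by
  by_contra! hle
  have hpos : 0 < circumference (edgesWithin G (coreSet G k)) :=
    lt_of_lt_of_le ((Set.ncard_pos (Set.toFinite _)).2 hne) hle
  obtain ⟨l, hl, hlen⟩ := exists_cycle_of_circumference_pos hpos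
  have h3 := hl.three_le
  have hcard : {v | v ∈ l}.ncard = l.length := by
    classical
    rw [← List.toFinset_card_of_nodup hl.nodup, ← Set.ncard_coe_finset]
    congr 1; ext; simp
  have hsub : {v | v ∈ l} ⊆ coreSet G k := fun v hv => by
    obtain ⟨w, hw⟩ := exists_adj_of_mem_chain hl.chain (by omega) hv
    exact hw.2.1
  have hle' := Set.ncard_le_ncard hsub (Set.toFinite _)
  rw [← spanningCoe_kCore] at hl
  exact h (isHamiltonianSubgraph_of_cycleList hl (le_antisymm (by rw [← hcard]; exact hle')
    (by rw [hlen]; exact hle)))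

open Classical in
/-- The pairs of `W` with both ends in `A`. -/
noncomputable def pairsWithin (W : Finset (Sym2 (Fin n))) (A : Set (Fin n)) :
    Finset (Sym2 (Fin n)) :=
  W.filter fun e => ∀ v ∈ e, v ∈ A

theorem card_le_card_pairsWithin_add (W : Finset (Sym2 (Fin n))) (A : Set (Fin n)) :
    W.card ≤ (pairsWithin W A).card + Aᶜ.ncard * n := by
  classical
  have hsub : W \ pairsWithin W A ⊆
      (Aᶜ.toFinset ×ˢ Finset.univ).image fun p : Fin n × Fin n => s(p.1, p.2) := by
    intro e he
    obtain ⟨heW, heA⟩ := Finset.mem_sdiff.1 he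
    simp only [pairsWithin, Finset.mem_filter, heW, true_and, not_forall] at heA
    obtain ⟨v, ⟨w, rfl⟩, hvA⟩ := heA
    exact Finset.mem_image.2 ⟨(v, w), Finset.mem_product.2 ⟨by simpa using hvA,
      Finset.mem_univ _⟩, rfl⟩
  have h1 := (Finset.card_le_card hsub).trans Finset.card_image_le
  rw [Finset.card_product, Finset.card_univ, Fintype.card_fin, ← Set.ncard_eq_toFinset_card'] at h1
  have h2 := Finset.card_sdiff_add_card_eq_card (s := pairsWithin W A) (t := W)
    (Finset.filter_subset _ _)
  omega

open Classical in
/-- Once the new edges with an end outside of the old core are fixed, the core has its final vertex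
set, and the remaining new edges lie inside the old core. Unless its core becomes Hamiltonian, each
of them is a booster with probability at least `b` over the number of pairs. -/
theorem card_filter_losesHamiltonicity_fiber_le {k s₀ a b j : ℕ} (hk : 15 ≤ k)
    {X T W : Finset (Sym2 (Fin n))} (hX : X ⊆ allEdges n) (hT : T ⊆ allEdges n)
    (hW : W = pairsWithin (allEdges n \ X) (coreSet (graphOf X) k))
    (hspread : SpreadsOut (graphOf X) s₀ a) (hcore : (coreSet (graphOf X) k)ᶜ.ncard ≤ s₀)
    (h4a : 4 * a ≤ n) (hsa : s₀ ≤ a) (hn : s₀ + 3 ≤ n) (hb : 2 * (b + s₀ * n) ≤ a ^ 2)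
    (hbW : b ≤ W.card) :
    (((W.powersetCard j).filter fun Y => LosesHamiltonicity k (graphOf X) (graphOf (X ∪ (T ∪ Y))) ∧
      LocallySparse (graphOf (X ∪ (T ∪ Y))) s₀).card : ℝ) ≤
      2 ^ s₀ * (W.card.choose j * (1 - (1 - 1 / 2) * b / W.card) ^ j) := by
  by_cases hham : IsHamiltonianSubgraph (kCore (graphOf X) k)
  swap
  · rw [Finset.filter_false_of_mem fun Y _ h => hham h.1.1]
    simp only [Finset.card_empty, Nat.cast_zero]
    have : (0 : ℝ) ≤ 1 - (1 - 1 / 2) * b / W.card := by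
      have h1 : (b : ℝ) ≤ W.card := by exact_mod_cast hbW
      have h2 : ((1 - 1 / 2) * b / W.card : ℝ) ≤ 1 :=
        div_le_one_of_le₀ (by linarith [(Nat.cast_nonneg b : (0 : ℝ) ≤ b)]) (by positivity)
      linarith
    positivity
  set A := coreSet (graphOf X) k with hA
  set K := coreSet (graphOf (X ∪ T)) k with hK
  have hAcard : n ≤ A.ncard + s₀ := by
    have := Set.ncard_add_ncard_compl A
    rw [Nat.card_eq_fintype_card, Fintype.card_fin] at this
    omega
  obtain ⟨l, hl, hlen, hlA⟩ := exists_cycleList_of_isHamiltonianSubgraph hham (by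
    change 3 ≤ A.ncard
    omega)
  rw [spanningCoe_kCore] at hl
  have hAK : A ⊆ K := coreSet_mono (graphOf_mono Finset.subset_union_left) k
  have hWU : W ⊆ allEdges n := by
    rw [hW]
    exact (Finset.filter_subset _ _).trans Finset.sdiff_subset
  have hWmem : ∀ {e}, e ∈ W ↔ e ∈ allEdges n ∧ e ∉ X ∧ ∀ v ∈ e, v ∈ A := by
    intro e
    rw [hW, pairsWithin, Finset.mem_filter, Finset.mem_sdiff, and_assoc]
  let Γ : Finset (Sym2 (Fin n)) → SimpleGraph (Fin n) := fun Y => graphOf (X ∪ (T ∪ Y))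
  have hΓmono : ∀ {Y Y'}, Y ⊆ Y' → Γ Y ≤ Γ Y' := fun h =>
    graphOf_mono (Finset.union_subset_union_right (Finset.union_subset_union_right h))
  have hXΓ : ∀ Y, graphOf X ≤ Γ Y := fun Y => graphOf_mono Finset.subset_union_left
  have hXTΓ : ∀ Y, graphOf (X ∪ T) ≤ Γ Y := fun Y =>
    graphOf_mono (Finset.union_subset_union_right Finset.subset_union_left)
  have hΓU : ∀ {Y}, Y ⊆ W → X ∪ (T ∪ Y) ⊆ allEdges n := fun hY =>
    Finset.union_subset hX (Finset.union_subset hT (hY.trans hWU))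
  have hKΓ : ∀ {Y}, Y ⊆ W → coreSet (Γ Y) k = K := by
    intro Y hY
    refine coreSet_eq_of_adj (hXTΓ Y) fun u v huv => ?_
    rw [graphOf_adj (hΓU hY)] at huv
    rw [graphOf_adj (Finset.union_subset hX hT)]
    rw [← Finset.union_assoc, Finset.mem_union] at huv
    refine huv.imp_right fun h => ?_
    have := (hWmem.1 (hY h)).2.2
    exact ⟨hAK (this u (by simp)), hAK (this v (by simp))⟩
  have hdeg : ∀ Y, ∀ v ∈ K, 15 ≤ ((Γ Y).neighborSet v ∩ K).ncard := fun Y v hv =>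
    hk.trans ((le_ncard_neighborSet_inter_coreSet _ k hv).trans
      (Set.ncard_le_ncard (fun w hw => ⟨hXTΓ Y hw.1, hw.2⟩) (Set.toFinite _)))
  let D : Finset (Sym2 (Fin n)) → SimpleGraph (Fin n) := fun Y => edgesWithin (Γ Y) K
  have hDmono : ∀ {Y Y'}, Y ⊆ Y' → D Y ≤ D Y' := fun h =>
    edgesWithin_mono (hΓmono h) Set.Subset.rfl
  -- no Hamilton cycle yet and local sparsity; both are inherited by subsets of `Y`
  let alive : Finset (Sym2 (Fin n)) → Prop := fun Y =>
    circumference (D Y) < K.ncard ∧ LocallySparse (Γ Y) s₀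
  have halive : ∀ {Y Y'}, Y ⊆ Y' → alive Y' → alive Y := fun h h' =>
    ⟨lt_of_le_of_lt (circumference_mono (hDmono h)) h'.1, h'.2.mono (hΓmono h)⟩
  -- each booster that is hit halves this weight, while no other edge increases it
  let w : Finset (Sym2 (Fin n)) → ℝ := fun Y =>
    if alive Y then (1 / 2) ^ circumference (D Y) else 0
  have hw : ∀ Y, 0 ≤ w Y := fun Y => by simp only [w]; split_ifs <;> positivity
  have hstep : ∀ Y e c, circumference (D Y) + c ≤ circumference (D (insert e Y)) →
      w (insert e Y) ≤ (1 / 2) ^ c * w Y := by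
    intro Y e c hc
    by_cases h : alive (insert e Y)
    · have h' := halive (Finset.subset_insert e Y) h
      simp only [w, if_pos h, if_pos h']
      rw [← pow_add, add_comm c]
      exact pow_le_pow_of_le_one (by norm_num) (by norm_num) hc
    · simp only [w, if_neg h]
      split_ifs <;> positivity
  have key := sum_powersetCard_le_of_decreasing W w hw (ρ := 1 / 2) (b := b) (by norm_num)
    (by norm_num) (by exact_mod_cast hbW) j ?_ ?_
  · have hw0 : w ∅ ≤ (1 / 2) ^ (n - s₀) := by
      have hc : A.ncard ≤ circumference (D ∅) := by
        have := (hl.mono (edgesWithin_mono (hXΓ ∅) hAK)).length_le_circumference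
        rw [hlen] at this
        exact this
      simp only [w]
      split_ifs
      · exact pow_le_pow_of_le_one (by norm_num) (by norm_num) (by omega)
      · positivity
    have hfin : (((W.powersetCard j).filter fun Y =>
        LosesHamiltonicity k (graphOf X) (Γ Y) ∧ LocallySparse (Γ Y) s₀).card : ℝ) *
        (1 / 2) ^ n ≤ ∑ Y ∈ W.powersetCard j, w Y := by
      rw [Finset.card_filter, Nat.cast_sum, Finset.sum_mul]
      refine Finset.sum_le_sum fun Y hY => ?_
      have hYW := (Finset.mem_powersetCard.1 hY).1
      split_ifs with h
      · have hlt := circumference_lt_of_not_isHamiltonianSubgraph h.1.2 (by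
          rw [hKΓ hYW, ← Set.ncard_pos (Set.toFinite _)]
          have := Set.ncard_le_ncard hAK (Set.toFinite _)
          omega)
        rw [hKΓ hYW] at hlt
        have hal : alive Y := ⟨hlt, h.2⟩
        simp only [w, if_pos hal, Nat.cast_one, one_mul]
        refine pow_le_pow_of_le_one (by norm_num) (by norm_num) ?_
        have := Set.ncard_le_card K
        rw [Nat.card_eq_fintype_card, Fintype.card_fin] at this
        change circumference (D Y) < K.ncard at hlt
        omega
      · simpa using hw Y
    have hbase : (0 : ℝ) ≤ 1 - (1 - 1 / 2) * b / W.card := by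
      have h1 : (b : ℝ) ≤ W.card := by exact_mod_cast hbW
      have h2 : ((1 - 1 / 2) * b / W.card : ℝ) ≤ 1 :=
        div_le_one_of_le₀ (by linarith [(Nat.cast_nonneg b : (0 : ℝ) ≤ b)]) (by positivity)
      linarith
    have h1 := hfin.trans (key.trans (mul_le_mul_of_nonneg_left hw0 (by positivity)))
    have h2 : ((1 / 2 : ℝ)) ^ (n - s₀) = 2 ^ s₀ * (1 / 2) ^ n := by
      have : n = (n - s₀) + s₀ := by omega
      conv_rhs => rw [this, pow_add]
      rw [mul_comm, mul_assoc, ← mul_pow]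
      norm_num
    rw [h2] at h1
    have h3 : (0 : ℝ) < (1 / 2) ^ n := by positivity
    refine le_of_mul_le_mul_right (h1.trans (le_of_eq ?_)) h3
    ring
  · intro Y _ e _
    simpa using hstep Y e 0 (circumference_mono (hDmono (Finset.subset_insert e Y)))
  · intro Y hY _ hY0
    have hal : alive Y := by
      by_contra h
      exact hY0 (by simp [w, h])
    have hboost := sq_le_two_mul_ncard_boosters_cycle hspread hal.2 (hXΓ Y)
      (by rw [Nat.card_eq_fintype_card, Fintype.card_fin]; exact h4a) hsa hAK hcore (hdeg Y) hl hlA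
      hal.1
    rw [Nat.card_eq_fintype_card, Fintype.card_fin] at hboost
    refine ⟨(boosters (D Y) A).toFinset, ?_, ?_, ?_⟩
    · intro e he
      obtain ⟨x, hx, y, hy, rfl, hne, hnadj, -⟩ := Set.mem_toFinset.1 he
      have hnot : s(x, y) ∉ X ∪ (T ∪ Y) := by
        rw [← graphOf_adj (hΓU hY)]
        exact fun h => hnadj ⟨h, hAK hx, hAK hy⟩
      simp only [Finset.mem_union, not_or] at hnot
      refine Finset.mem_sdiff.2 ⟨hWmem.2 ⟨?_, hnot.1, ?_⟩, hnot.2.2⟩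
      · rw [mem_allEdges, Sym2.mk_isDiag_iff]
        exact hne
      · intro v hv
        rcases Sym2.mem_iff.1 hv with rfl | rfl
        · exact hx
        · exact hy
    · rw [← Set.ncard_eq_toFinset_card']
      have : b ≤ (boosters (D Y) A).ncard := by
        have h := hb.trans hboost
        change 2 * (b + s₀ * n) ≤ 2 * ((boosters (D Y) A).ncard + s₀ * n) at h
        omega
      exact_mod_cast this
    · intro e he
      obtain ⟨x, hx, y, hy, rfl, hne, hnadj, hinc⟩ := Set.mem_toFinset.1 he
      have hxyW : insert s(x, y) Y ⊆ W := by
        refine Finset.insert_subset (hWmem.2 ⟨?_, ?_, ?_⟩) hY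
        · rw [mem_allEdges, Sym2.mk_isDiag_iff]
          exact hne
        · intro h
          refine hnadj ⟨?_, hAK hx, hAK hy⟩
          exact (graphOf_adj (hΓU hY)).2 (Finset.mem_union_left _ h)
        · intro v hv
          rcases Sym2.mem_iff.1 hv with rfl | rfl
          · exact hx
          · exact hy
      have hadj : (D (insert s(x, y) Y)).Adj x y := by
        refine ⟨(graphOf_adj (hΓU hxyW)).2 ?_, hAK hx, hAK hy⟩
        simp
      simpa using hstep Y s(x, y) 1 (hinc _ (hDmono (Finset.subset_insert _ Y)) hadj)

open Classical in
/-- For a graph with a large Hamiltonian core that spreads out, few sets of `r` new edges lead to a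
locally sparse graph with a non-Hamiltonian core. -/
theorem card_filter_losesHamiltonicity_le {k m r s₀ a b M : ℕ} (hk : 15 ≤ k)
    {X : Finset (Sym2 (Fin n))} (hX : X ∈ (allEdges n).powersetCard m)
    (hspread : SpreadsOut (graphOf X) s₀ a) (hcore : (coreSet (graphOf X) k)ᶜ.ncard ≤ s₀)
    (h4a : 4 * a ≤ n) (hsa : s₀ ≤ a) (hn : s₀ + 3 ≤ n) (hb : 2 * (b + s₀ * n) ≤ a ^ 2)
    (hM : M + m + s₀ * n ≤ (allEdges n).card) (hbM : b ≤ M) (hM0 : 0 < M) :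
    ((((allEdges n \ X).powersetCard r).filter fun F =>
      LosesHamiltonicity k (graphOf X) (graphOf (X ∪ F)) ∧
      LocallySparse (graphOf (X ∪ F)) s₀).card : ℝ) ≤
      2 ^ s₀ * (((allEdges n).card - m).choose r *
        (1 - b / 2 * (1 - r / M) / ((allEdges n).card - m)) ^ r) := by
  obtain ⟨hXU, hXm⟩ := Finset.mem_powersetCard.1 hX
  set U := allEdges n \ X with hU
  set W := pairsWithin U (coreSet (graphOf X) k) with hW
  have hWU : W ⊆ U := Finset.filter_subset _ _
  have hUc : U.card = (allEdges n).card - m := by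
    rw [hU, Finset.card_sdiff_of_subset hXU, hXm]
  have hMW : M ≤ W.card := by
    have h1 := card_le_card_pairsWithin_add U (coreSet (graphOf X) k)
    have h2 := Nat.mul_le_mul_right n hcore
    change U.card ≤ W.card + _ at h1
    omega
  have hdisj : Disjoint (U \ W) W := Finset.sdiff_disjoint
  have hunion : U \ W ∪ W = U := Finset.sdiff_union_of_subset hWU
  set ρ : ℝ := 1 - (1 - 1 / 2) * b / W.card with hρ
  have hWpos : (0 : ℝ) < W.card := by
    have : 0 < W.card := by omega
    exact_mod_cast this
  have hbW : (b : ℝ) ≤ W.card := by exact_mod_cast hbM.trans hMW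
  have hb0 : (0 : ℝ) ≤ b := by positivity
  have hρ1 : ρ ≤ 1 := by
    have : (0 : ℝ) ≤ (1 - 1 / 2) * b / W.card := by
      have : (0 : ℝ) ≤ (1 - 1 / 2) * b := by linarith
      positivity
    linarith
  have hρ0 : 0 ≤ ρ := by
    have : ((1 - 1 / 2) * b / W.card : ℝ) ≤ 1 := div_le_one_of_le₀ (by linarith) hWpos.le
    linarith
  -- condition on the new edges outside of `W`; the number of the others is the size of `F ∩ W`
  have h1 : ((((U.powersetCard r).filter fun F =>
      LosesHamiltonicity k (graphOf X) (graphOf (X ∪ F)) ∧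
      LocallySparse (graphOf (X ∪ F)) s₀).card : ℝ)) ≤
      2 ^ s₀ * ∑ F ∈ U.powersetCard r, ρ ^ (F ∩ W).card := by
    rw [Finset.card_filter, Nat.cast_sum]
    conv_lhs => rw [← hunion]
    conv_rhs => rw [← hunion]
    rw [sum_powersetCard_union hdisj, sum_powersetCard_union hdisj, Finset.mul_sum]
    refine Finset.sum_le_sum fun T hT => ?_
    have hTUW := Finset.mem_powerset.1 (Finset.mem_filter.1 hT).1
    have hTW : Disjoint T W := Finset.disjoint_of_subset_left hTUW hdisj
    have hfib := card_filter_losesHamiltonicity_fiber_le (j := r - T.card) hk hXU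
      (hTUW.trans (Finset.sdiff_subset.trans Finset.sdiff_subset)) hW hspread hcore h4a hsa hn hb
      (hbM.trans hMW)
    rw [Finset.card_filter, Nat.cast_sum] at hfib
    refine hfib.trans (le_of_eq ?_)
    congr 1
    have : ∀ Y ∈ W.powersetCard (r - T.card), ρ ^ ((T ∪ Y) ∩ W).card = ρ ^ (r - T.card) := by
      intro Y hY
      obtain ⟨hYW, hYc⟩ := Finset.mem_powersetCard.1 hY
      rw [Finset.union_inter_distrib_right, Finset.disjoint_iff_inter_eq_empty.1 hTW,
        Finset.empty_union, Finset.inter_eq_left.2 hYW, hYc]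
    rw [Finset.sum_congr rfl this, Finset.sum_const, Finset.card_powersetCard, nsmul_eq_mul]
  -- most of the new edges do lie in `W`
  have h2 := sum_powersetCard_le_of_decreasing U (fun F => ρ ^ (F ∩ W).card)
    (fun F => by positivity) hρ0 hρ1 (b := W.card - r) (by
      have : (W.card : ℝ) ≤ U.card := by exact_mod_cast Finset.card_le_card hWU
      have : (0 : ℝ) ≤ r := by positivity
      linarith) r
    (fun F _ x _ => pow_le_pow_of_le_one hρ0 hρ1
      (Finset.card_le_card (Finset.inter_subset_inter_right (Finset.subset_insert _ _))))
    (fun F hF hFr _ => by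
      refine ⟨W \ F, Finset.sdiff_subset_sdiff hWU le_rfl, ?_, ?_⟩
      · have h1 : W.card ≤ (W \ F).card + F.card := by
          have := Finset.le_card_sdiff F W
          omega
        have h2 : (W.card : ℝ) ≤ (W \ F).card + F.card := by exact_mod_cast h1
        have h3 : (F.card : ℝ) ≤ r := by exact_mod_cast hFr.le
        linarith
      · intro x hx
        obtain ⟨hxW, hxF⟩ := Finset.mem_sdiff.1 hx
        rw [Finset.insert_inter_of_mem hxW, Finset.card_insert_of_notMem fun h =>
          hxF (Finset.mem_inter.1 h).1, pow_succ, mul_comm])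
  simp only [Finset.empty_inter, Finset.card_empty, pow_zero, mul_one] at h2
  refine h1.trans (mul_le_mul_of_nonneg_left (h2.trans ?_) (by positivity))
  have hUr : (U.card : ℝ) = (allEdges n).card - m := by
    rw [hUc, Nat.cast_sub]
    omega
  rw [← hUc, ← hUr]
  have hUpos : (0 : ℝ) < U.card := by
    have := Finset.card_le_card hWU
    have : 0 < U.card := by omega
    exact_mod_cast this
  have hnn : 0 ≤ 1 - (1 - ρ) * (W.card - r) / U.card := by
    have h3 : (W.card : ℝ) ≤ U.card := by exact_mod_cast Finset.card_le_card hWU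
    have h4 : (1 - ρ) * (W.card - r) / U.card ≤ 1 := by
      rw [div_le_one hUpos]
      have h5 : (0 : ℝ) ≤ r := by positivity
      have h6 : (1 - ρ) * (W.card - r) ≤ (1 - ρ) * W.card :=
        mul_le_mul_of_nonneg_left (by linarith) (by linarith)
      have h7 : (1 - ρ) * W.card ≤ 1 * W.card :=
        mul_le_mul_of_nonneg_right (by linarith) hWpos.le
      linarith
    linarith
  have hcmp : b / 2 * (1 - r / M) ≤ (1 - ρ) * (W.card - r) := by
    have h3 : (1 - ρ) * (W.card - r) = b / 2 * (1 - r / W.card) := by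
      rw [hρ]
      field_simp
      ring
    rw [h3]
    have h4 : (r : ℝ) / W.card ≤ r / M := by
      have : (0 : ℝ) < M := by exact_mod_cast hM0
      have : (M : ℝ) ≤ W.card := by exact_mod_cast hMW
      gcongr
    exact mul_le_mul_of_nonneg_left (by linarith) (by linarith)
  gcongr

end Hitting

/-! ### Numerical estimates -/

section Numerics

theorem choose_le_exp {n s : ℕ} (hs : 1 ≤ s) (hn : 1 ≤ n) :
    (n.choose s : ℝ) ≤ Real.exp (s * (1 + Real.log (n / s))) := by
  have hs0 : (0 : ℝ) < s := by exact_mod_cast hs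
  have hn0 : (0 : ℝ) < n := by exact_mod_cast hn
  have h1 : (n.choose s : ℝ) ≤ n ^ s / s.factorial := Nat.choose_le_pow_div s n
  have h2 := Real.pow_div_factorial_le_exp _ hs0.le s
  have h3 : (n : ℝ) ^ s / s.factorial = (n / s) ^ s * (s ^ s / s.factorial) := by
    rw [div_pow]
    field_simp
  have h4 : Real.exp (s * (1 + Real.log (n / s))) = (n / s) ^ s * Real.exp s := by
    rw [mul_add, mul_one, Real.exp_add, mul_comm, Real.exp_nat_mul,
      Real.exp_log (by positivity)]
  rw [h4]
  refine h1.trans ?_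
  rw [h3]
  gcongr

theorem one_sub_pow_le_exp {x : ℝ} (hx : x ≤ 1) (m : ℕ) : (1 - x) ^ m ≤ Real.exp (-(m * x)) := by
  rw [← mul_neg, Real.exp_nat_mul]
  exact pow_le_pow_left₀ (by linarith) (Real.one_sub_le_exp_neg x) m

/-- Turns a comparison of integer powers into a numerical bound for a logarithm. -/
theorem log_le_of_pow {x y : ℝ} (hx : 0 < x) {p q : ℕ} (h : x ^ q ≤ y ^ p) :
    q * Real.log x ≤ p * Real.log y := by
  rw [← Real.log_pow, ← Real.log_pow]
  exact Real.log_le_log (by positivity) h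

theorem log_five_halves_le : Real.log (5 / 2) ≤ 9168 / 10000 := by
  have h := log_le_of_pow (x := 5 / 2) (y := 2) (p := 41) (q := 31) (by norm_num)
    (by norm_num)
  have := Real.log_two_lt_d9
  push_cast at h
  linarith

theorem log_three_quarters_le : Real.log (3 / 4) ≤ -(285 / 1000) := by
  have h := log_le_of_pow (x := 3 / 4) (y := 1 / 2) (p := 7) (q := 17) (by norm_num)
    (by norm_num)
  have h2 : Real.log (1 / 2) = -Real.log 2 := by rw [one_div, Real.log_inv]
  have := Real.log_two_gt_d9
  rw [h2] at h
  push_cast at h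
  linarith

/-- The tangent of the logarithm at `32`. -/
theorem log_le_tangent {c : ℝ} (hc : 0 < c) : Real.log c ≤ 5 * Real.log 2 - 1 + c / 32 := by
  have h1 : Real.log c = Real.log (c / 32) + 5 * Real.log 2 := by
    rw [← Nat.cast_ofNat (R := ℝ) (n := 5), ← Real.log_pow,
      ← Real.log_mul (by positivity) (by positivity)]
    congr 1
    norm_num
  have h2 := Real.log_le_sub_one_of_pos (x := c / 32) (by positivity)
  linarith

theorem cast_choose_two_pos {n : ℕ} (hn : 2 ≤ n) : (0 : ℝ) < (n.choose 2 : ℕ) := by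
  exact_mod_cast Nat.choose_pos hn

/-- A graph with `m = c * n / 2` edges has density at least `c / n`. -/
theorem div_le_div_choose_two {n m : ℕ} (hn : 2 ≤ n) {c : ℝ} (hc : c * n = 2 * m) :
    c / n ≤ m / (n.choose 2 : ℕ) := by
  have hn' : (2 : ℝ) ≤ n := by exact_mod_cast hn
  rw [div_le_div_iff₀ (by linarith) (cast_choose_two_pos hn), Nat.cast_choose_two]
  nlinarith

/-- The exponent, per vertex of a set of `s` vertices, in the union bound for the core. -/
theorem core_exponent_le {n s c κ : ℝ} (hs : 1 ≤ s) (hκ0 : 0 ≤ κ) (hκ : κ ≤ (3 * c - 6) / 7)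
    (hc0 : 104 / 3 ≤ c) (hcn : 300 * c ^ 2 ≤ n) (hs1 : 3 * c ^ 2 * s ≤ 4 * n)
    (hs2 : 4 * n < 3 * c ^ 2 * (s + 1)) :
    1 + Real.log (n / s) - 3 / 5 * (c - c * s / n - c * κ / n) + κ * Real.log (5 / 2) ≤
      -(1 / 20) := by
  have hcpos : 0 < c := by linarith
  have hn : 0 < n := by nlinarith
  have hlog : Real.log (n / s) ≤ Real.log (3 / 4) + 2 * Real.log c + 1 / 100 := by
    have hle : n / s ≤ 3 / 4 * c ^ 2 * (101 / 100) := by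
      rw [div_le_iff₀ (by linarith)]
      nlinarith
    have h4 := Real.log_le_log (by positivity) hle
    rw [Real.log_mul (by positivity) (by norm_num), Real.log_mul (by norm_num)
      (by positivity), Real.log_pow] at h4
    have h5 := Real.log_le_sub_one_of_pos (x := (101 / 100)) (by norm_num)
    push_cast at h4
    linarith
  have hc1 := log_le_tangent hcpos
  have hl2 := Real.log_two_lt_d9
  have h34 := log_three_quarters_le
  have h52 : κ * Real.log (5 / 2) ≤ (3 * c - 6) / 7 * (9168 / 10000) :=
    mul_le_mul hκ log_five_halves_le (Real.log_nonneg (by norm_num)) (by linarith)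
  have hcs : c * s / n ≤ 385 / 10000 := by
    rw [div_le_iff₀ hn]
    nlinarith
  have hck : c * κ / n ≤ 2 / 1000 := by
    rw [div_le_iff₀ hn]
    nlinarith
  linarith

/-- The union bound for the core. The parameter `2 / 5` is close to the optimal one, the ratio of
the allowed degree `k - 1` to the average degree, which is at most `3 / 7`. -/
theorem core_term_le {n m k s₀ : ℕ} {c : ℝ} (hn : 1000 ≤ n) (hk : 1 ≤ k) (hs : 1 ≤ s₀)
    (hc : c * n = 2 * m) (hc0 : 104 / 3 ≤ c) (hkc : (k : ℝ) - 1 ≤ (3 * c - 6) / 7)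
    (hcn : 300 * c ^ 2 ≤ n) (hs1 : 3 * c ^ 2 * s₀ ≤ 4 * n) (hs2 : 4 * n < 3 * c ^ 2 * (s₀ + 1)) :
    (n.choose s₀ : ℝ) * ((1 - (1 - 2 / 5) *
        ((s₀ * (n - s₀ : ℕ) : ℕ) - ((k - 1) * s₀ : ℕ)) / (n.choose 2 : ℕ)) ^ m /
          (2 / 5 : ℝ) ^ ((k - 1) * s₀)) ≤ Real.exp (-(s₀ / 20)) := by
  have hn' : (1000 : ℝ) ≤ n := by exact_mod_cast hn
  have hs' : (1 : ℝ) ≤ s₀ := by exact_mod_cast hs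
  have hcpos : 0 < c := by linarith
  have hs900 : 900 * (s₀ : ℝ) ≤ n := by nlinarith [sq_nonneg (c - 104 / 3)]
  have hsn : s₀ ≤ n := by
    have : (s₀ : ℝ) ≤ n := by linarith
    exact_mod_cast this
  have hN := cast_choose_two_pos (n := n) (by omega)
  have hNe : ((n.choose 2 : ℕ) : ℝ) = n * (n - 1) / 2 := Nat.cast_choose_two ℝ n
  have hK : ((k - 1 : ℕ) : ℝ) = k - 1 := by rw [Nat.cast_sub hk]; simp
  have hK0 : (0 : ℝ) ≤ (k : ℝ) - 1 := by rw [← hK]; positivity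
  have hE : (((s₀ * (n - s₀ : ℕ) : ℕ) : ℝ) - ((k - 1) * s₀ : ℕ)) = s₀ * (n - s₀ - (k - 1)) := by
    push_cast [Nat.cast_sub hsn]
    rw [hK]; ring
  rw [hE]
  have hkn : 1000 * ((k : ℝ) - 1) ≤ n := by nlinarith
  have hgap : 0 ≤ (n : ℝ) - s₀ - (k - 1) := by linarith
  -- the three factors as exponentials
  have h1 := choose_le_exp hs (show 1 ≤ n by omega)
  have h2 : (1 - (1 - 2 / 5) * (s₀ * (n - s₀ - (k - 1))) / (n.choose 2 : ℕ) : ℝ) ^ m ≤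
      Real.exp (-(3 / 5 * s₀ * (c - c * s₀ / n - c * (k - 1) / n))) := by
    refine (one_sub_pow_le_exp ?_ m).trans ?_
    · rw [div_le_one hN, hNe]
      nlinarith
    · rw [Real.exp_le_exp, neg_le_neg_iff]
      have h := mul_le_mul_of_nonneg_right (div_le_div_choose_two (by omega) hc)
        (show 0 ≤ 3 / 5 * s₀ * ((n : ℝ) - s₀ - (k - 1)) by positivity)
      calc _ = c / n * (3 / 5 * s₀ * ((n : ℝ) - s₀ - (k - 1))) := by field_simp
        _ ≤ _ := h
        _ = _ := by ring
  have h3 : ((2 / 5 : ℝ) ^ ((k - 1) * s₀))⁻¹ = Real.exp (s₀ * ((k - 1) * Real.log (5 / 2))) := by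
    rw [← inv_pow, ← Real.exp_log (show (0 : ℝ) < (2 / 5)⁻¹ by norm_num), ← Real.exp_nat_mul]
    congr 1
    push_cast
    rw [hK]
    norm_num
    ring
  have hnonneg : (0 : ℝ) ≤ 1 - (1 - 2 / 5) * (s₀ * (n - s₀ - (k - 1))) / (n.choose 2 : ℕ) := by
    rw [sub_nonneg, div_le_one hN, hNe]
    nlinarith
  rw [div_eq_mul_inv, h3]
  calc _ ≤ Real.exp (s₀ * (1 + Real.log (n / s₀))) *
        (Real.exp (-(3 / 5 * s₀ * (c - c * s₀ / n - c * (k - 1) / n))) *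
          Real.exp (s₀ * ((k - 1) * Real.log (5 / 2)))) := by gcongr
    _ = Real.exp (s₀ * (1 + Real.log (n / s₀) - 3 / 5 * (c - c * s₀ / n - c * (k - 1) / n) +
          (k - 1) * Real.log (5 / 2))) := by
        rw [← Real.exp_add, ← Real.exp_add]
        congr 1
        ring
    _ ≤ _ := by
        rw [Real.exp_le_exp]
        have hfin := core_exponent_le hs' hK0 hkc hc0 hcn hs1 hs2
        calc _ ≤ s₀ * (-(1 / 20) : ℝ) := mul_le_mul_of_nonneg_left hfin (by linarith)
          _ = _ := by ring

/-- One term of the union bound for spreading out. -/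
theorem spread_term_le {n m s : ℕ} {c : ℝ} (hn : 1000 ≤ n) (hs : 1 ≤ s) (hc : c * n = 2 * m)
    (hc0 : 104 / 3 ≤ c) (hs1 : 6 * s ≤ n) (hs2 : 4 * (n : ℝ) ≤ 3 * c ^ 2 * s) :
    (n.choose (4 * s) : ℝ) * ((4 * s).choose s *
        (1 - (s * (n - 4 * s : ℕ) : ℕ) / (n.choose 2 : ℕ)) ^ m) ≤ Real.exp (-s) := by
  have hn' : (1000 : ℝ) ≤ n := by exact_mod_cast hn
  have hs' : (1 : ℝ) ≤ s := by exact_mod_cast hs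
  have hs1' : 6 * (s : ℝ) ≤ n := by exact_mod_cast hs1
  have hcpos : 0 < c := by linarith
  have hN := cast_choose_two_pos (n := n) (by omega)
  have hNe : ((n.choose 2 : ℕ) : ℝ) = n * (n - 1) / 2 := Nat.cast_choose_two ℝ n
  have hE : ((s * (n - 4 * s : ℕ) : ℕ) : ℝ) = s * (n - 4 * s) := by
    push_cast [Nat.cast_sub (show 4 * s ≤ n by omega)]
    ring
  rw [hE]
  have h1 : (n.choose (4 * s) : ℝ) ≤
      Real.exp (s * (4 * (1 + Real.log (n / s) - 2 * Real.log 2))) := by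
    refine (choose_le_exp (by omega) (by omega)).trans (le_of_eq ?_)
    push_cast
    have : (n : ℝ) / (4 * s) = n / s / 2 ^ 2 := by field_simp; norm_num
    rw [this, Real.log_div (by positivity) (by positivity), Real.log_pow]
    congr 1
    push_cast
    ring
  have h2 : ((4 * s).choose s : ℝ) ≤ Real.exp (s * (4 * Real.log 2)) := by
    have h := Nat.choose_le_two_pow (4 * s) s
    have h' : ((4 * s).choose s : ℝ) ≤ 2 ^ (4 * s) := by exact_mod_cast h
    refine h'.trans (le_of_eq ?_)
    conv_lhs => rw [← Real.exp_log (show (0 : ℝ) < 2 by norm_num), ← Real.exp_nat_mul]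
    push_cast
    congr 1
    ring
  have h3 : (1 - s * (n - 4 * s) / (n.choose 2 : ℕ) : ℝ) ^ m ≤
      Real.exp (-(s * (c * (1 - 4 / (n / s))))) := by
    refine (one_sub_pow_le_exp ?_ m).trans ?_
    · rw [div_le_one hN, hNe]
      nlinarith
    · rw [Real.exp_le_exp, neg_le_neg_iff]
      have h := mul_le_mul_of_nonneg_right (div_le_div_choose_two (by omega) hc)
        (show 0 ≤ s * ((n : ℝ) - 4 * s) from mul_nonneg (by linarith) (by linarith))
      calc _ = c / n * (s * ((n : ℝ) - 4 * s)) := by field_simp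
        _ ≤ _ := h
        _ = _ := by ring
  set y : ℝ := n / s with hy
  have hy6 : 6 ≤ y := by rw [hy, le_div_iff₀ (by linarith)]; exact hs1'
  have hyc : y ≤ 3 / 4 * c ^ 2 := by
    rw [hy, div_le_iff₀ (by linarith)]
    linarith
  have hnonneg : (0 : ℝ) ≤ (1 - s * (n - 4 * s) / (n.choose 2 : ℕ) : ℝ) := by
    rw [sub_nonneg, div_le_one hN, hNe]
    nlinarith
  calc _ ≤ Real.exp (s * (4 * (1 + Real.log y - 2 * Real.log 2))) *
        (Real.exp (s * (4 * Real.log 2)) * Real.exp (-(s * (c * (1 - 4 / y))))) := by gcongr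
    _ = Real.exp (s * (4 + 4 * Real.log y - 4 * Real.log 2 - c * (1 - 4 / y))) := by
        rw [← Real.exp_add, ← Real.exp_add]
        congr 1
        ring
    _ ≤ _ := by
        rw [Real.exp_le_exp]
        have hl2 := Real.log_two_lt_d9
        have hl2' := Real.log_two_gt_d9
        -- for small `y` the bound uses `c ≥ 104 / 3`, for large `y` the bound `y ≤ 3 * c ^ 2 / 4`
        have hfin : 4 + 4 * Real.log y - 4 * Real.log 2 - c * (1 - 4 / y) ≤ -1 := by
          rcases le_or_gt y 8 with h8 | h8
          · have h4 : Real.log y ≤ 3 * Real.log 2 := by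
              rw [← Nat.cast_ofNat (R := ℝ) (n := 3), ← Real.log_pow]
              exact Real.log_le_log (by linarith) (by norm_num; exact h8)
            have h5 : 4 / y ≤ 2 / 3 := by
              rw [div_le_iff₀ (by linarith)]
              linarith
            nlinarith
          rcases le_or_gt y 40 with h40 | h40
          · have h4 := log_le_tangent (show 0 < y by linarith)
            have h5 : 4 / y ≤ 1 / 2 := by
              rw [div_le_iff₀ (by linarith)]
              linarith
            nlinarith
          · have h4 := Real.log_le_log (by linarith) hyc
            rw [Real.log_mul (by norm_num) (by positivity), Real.log_pow] at h4
            have h5 := log_le_tangent hcpos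
            have h6 := log_three_quarters_le
            have h7 : 4 / y ≤ 1 / 10 := by
              rw [div_le_iff₀ (by linarith)]
              linarith
            push_cast at h4
            nlinarith
        calc _ ≤ s * (-1 : ℝ) := mul_le_mul_of_nonneg_left hfin (by linarith)
          _ = _ := by ring

/-- One term of the union bound for local sparsity, for a nearly optimal choice of `φ`. -/
theorem sparse_term_le {n M s : ℕ} {R c φ : ℝ} (hn : 1 ≤ n) (hs : 1 ≤ s) (hM : 0 < M) (hR : 0 < R)
    (hc0 : 0 < c) (hpc : M / R * n ≤ 101 / 100 * c) (hφ : 1 ≤ φ)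
    (hφ2 : φ ^ 2 = 5 / (3 * s * (M / R))) :
    (n.choose (3 * s) : ℝ) * ((1 + (φ ^ 2 - 1) * (9 * s ^ 2 / 2) / R) ^ M / φ ^ (15 * s)) ≤
      Real.exp (s * (21 / 2 - 3 * Real.log 3 + 15 / 2 * (Real.log (606 / 1000) + Real.log c) -
        9 / 2 * Real.log (n / s))) := by
  have hn' : (0 : ℝ) < n := by exact_mod_cast hn
  have hs' : (0 : ℝ) < s := by exact_mod_cast hs
  have hM' : (0 : ℝ) < M := by exact_mod_cast hM
  have h1 := choose_le_exp (s := 3 * s) (n := n) (by omega) hn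
  have h2 : (1 + (φ ^ 2 - 1) * (9 * s ^ 2 / 2) / R) ^ M ≤ Real.exp (s * (15 / 2)) := by
    have h := one_sub_pow_le_exp (x := -((φ ^ 2 - 1) * (9 * s ^ 2 / 2) / R)) (by
      have : 0 ≤ φ ^ 2 - 1 := by nlinarith
      have : 0 ≤ (φ ^ 2 - 1) * (9 * s ^ 2 / 2) / R := by positivity
      linarith) M
    rw [sub_neg_eq_add] at h
    refine h.trans ?_
    rw [Real.exp_le_exp]
    have h3 : φ ^ 2 * (9 * s ^ 2 / 2) * (M / R) = s * (15 / 2) := by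
      rw [hφ2]
      field_simp
      norm_num
    have h4 : 0 ≤ 9 * (s : ℝ) ^ 2 / 2 * (M / R) := by positivity
    calc _ = φ ^ 2 * (9 * s ^ 2 / 2) * (M / R) - 9 * s ^ 2 / 2 * (M / R) := by ring
      _ ≤ _ := by linarith
  have h3 : (φ ^ (15 * s))⁻¹ ≤
      Real.exp (s * (15 / 2 * (Real.log (606 / 1000) + Real.log c - Real.log (n / s)))) := by
    have hlog : Real.log (φ ^ 2) = -Real.log (3 / 5 * s * (M / R)) := by
      rw [hφ2, ← Real.log_inv]
      congr 1
      field_simp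
    have hle : Real.log (3 / 5 * s * (M / R)) ≤
        Real.log (606 / 1000) + Real.log c - Real.log (n / s) := by
      rw [← Real.log_mul (by norm_num) hc0.ne', ← Real.log_div (by positivity) (by positivity)]
      refine Real.log_le_log (by positivity) ?_
      have h5 : (M : ℝ) / R ≤ 101 / 100 * c / n := by
        rw [le_div_iff₀ hn']
        exact hpc
      calc 3 / 5 * s * ((M : ℝ) / R) ≤ 3 / 5 * s * (101 / 100 * c / n) := by gcongr
        _ = _ := by field_simp; norm_num
    rw [Real.log_pow] at hlog
    push_cast at hlog
    have h4 : (φ ^ (15 * s))⁻¹ = Real.exp (-(15 * s * Real.log φ)) := by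
      rw [Real.exp_neg, ← Real.exp_log (show 0 < φ by linarith), ← Real.exp_nat_mul,
        Real.log_exp]
      push_cast
      rfl
    rw [h4, Real.exp_le_exp]
    nlinarith
  have h4 : Real.log (n / (3 * s : ℕ)) = Real.log (n / s) - Real.log 3 := by
    rw [← Real.log_div (by positivity) (by norm_num)]
    congr 1
    push_cast
    field_simp
  rw [h4] at h1
  have hb0 : 0 ≤ (1 + (φ ^ 2 - 1) * (9 * s ^ 2 / 2) / R) ^ M := by
    have : 0 ≤ φ ^ 2 - 1 := by nlinarith
    positivity
  have hφ0 : 0 < φ := by linarith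
  rw [div_eq_mul_inv]
  calc _ ≤ Real.exp ((3 * s : ℕ) * (1 + (Real.log (n / s) - Real.log 3))) *
        (Real.exp (s * (15 / 2)) *
          Real.exp (s * (15 / 2 * (Real.log (606 / 1000) + Real.log c - Real.log (n / s))))) := by
        gcongr
    _ = _ := by
        rw [← Real.exp_add, ← Real.exp_add]
        congr 1
        push_cast
        ring

/-- For sets up to the threshold `s = 4 * n / (3 * c ^ 2)`, each vertex contributes a negative
constant to the exponent. -/
theorem sparse_exponent_le_of_large {c y : ℝ} (hc0 : 104 / 3 ≤ c) (hy : 3 / 4 * c ^ 2 ≤ y) :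
    21 / 2 - 3 * Real.log 3 + 15 / 2 * (Real.log (606 / 1000) + Real.log c) -
      9 / 2 * Real.log y ≤ -(1 / 4) := by
  have hcpos : 0 < c := by linarith
  have h1 := Real.log_le_log (by positivity) hy
  rw [Real.log_mul (by norm_num) (by positivity), Real.log_pow, Real.log_div (by norm_num)
    (by norm_num), show (4 : ℝ) = 2 ^ 2 by norm_num, Real.log_pow] at h1
  have h2 : Real.log (606 / 1000) = Real.log (202 / 1000) + Real.log 3 := by
    rw [← Real.log_mul (by norm_num) (by norm_num)]
    norm_num
  have h3 : 5 * Real.log (202 / 1000) - Real.log c + 16 * Real.log 2 ≤ -(36 / 100) := by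
    have h4 : 5 * Real.log (202 / 1000) - Real.log c + 16 * Real.log 2 =
        Real.log ((202 / 1000) ^ 5 / c * 2 ^ 16) := by
      rw [Real.log_mul (by positivity) (by positivity),
        Real.log_div (x := (202 / 1000) ^ 5) (by positivity) hcpos.ne', Real.log_pow, Real.log_pow]
      push_cast
      ring
    have h5 := Real.log_le_sub_one_of_pos (x := (202 / 1000) ^ 5 / c * 2 ^ 16) (by positivity)
    have h6 : (202 / 1000) ^ 5 / c * 2 ^ 16 ≤ 64 / 100 := by
      rw [div_mul_eq_mul_div, div_le_iff₀ hcpos]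
      norm_num
      linarith
    linarith
  have hl2 := Real.log_two_gt_d9
  have hl2' := Real.log_two_lt_d9
  push_cast at h1
  rw [h2]
  linarith

/-- For sets of polylogarithmic size, the term `log (n / s)` dominates the exponent. -/
theorem sparse_exponent_le_of_small {n s c L : ℝ} (hL : 50 ≤ L) (hlogL : Real.log L ≤ L / 100)
    (hn : 0 < n) (hnL : Real.log n = L) (hs : 0 < s) (hsL : s ≤ L ^ 2) (hc0 : 0 < c)
    (hcL : c ≤ 2 * L) :
    21 / 2 - 3 * Real.log 3 + 15 / 2 * (Real.log (606 / 1000) + Real.log c) -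
      9 / 2 * Real.log (n / s) ≤ -(4 * L) := by
  have h1 : Real.log s ≤ 2 * Real.log L := by
    have := Real.log_le_log hs hsL
    rw [Real.log_pow] at this
    exact_mod_cast this
  have h2 : Real.log c ≤ Real.log 2 + Real.log L := by
    rw [← Real.log_mul (by norm_num) (by linarith)]
    exact Real.log_le_log hc0 hcL
  have h3 := Real.log_two_lt_d9
  have h4 : 0 ≤ Real.log 3 := Real.log_nonneg (by norm_num)
  have h5 : Real.log (606 / 1000) ≤ 0 := Real.log_nonpos (by norm_num) (by norm_num)
  rw [Real.log_div hn.ne' hs.ne', hnL]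
  linarith

/-- The total contribution of the locally dense sets. -/
theorem sum_sparse_term_le {n M s₀ : ℕ} {R c L : ℝ} (hn : 1 ≤ n) (hM : 0 < M) (hR : 0 < R)
    (hL : 50 ≤ L) (hlogL : Real.log L ≤ L / 100) (hnL : Real.log n = L)
    (hc0 : 104 / 3 ≤ c) (hcL : c ≤ 2 * L) (hpc : M / R * n ≤ 101 / 100 * c)
    (hs₀ : 3 * c ^ 2 * s₀ ≤ 4 * n) :
    ∃ φ : ℕ → ℝ, (∀ s, 1 ≤ φ s) ∧
      ∑ s ∈ Finset.Icc 1 s₀, (n.choose (3 * s) : ℝ) *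
        ((1 + (φ s ^ 2 - 1) * (9 * s ^ 2 / 2) / R) ^ M / φ s ^ (15 * s)) ≤
      L ^ 2 * Real.exp (-(4 * L)) + n * Real.exp (-(L ^ 2 / 4)) := by
  have hn' : (0 : ℝ) < n := by exact_mod_cast hn
  have hM' : (0 : ℝ) < M := by exact_mod_cast hM
  have hcpos : 0 < c := by linarith
  have hs₀n : (s₀ : ℝ) ≤ n := by
    have h0 : (0 : ℝ) ≤ s₀ := by positivity
    have h1 : 4 ≤ 3 * c ^ 2 := by nlinarith
    nlinarith
  -- `φ s ^ 2` is the ratio of `15 * s / 2` to the expected number of edges in a `3 * s`-set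
  refine ⟨fun s => max 1 (Real.sqrt (5 / (3 * s * (M / R)))), fun s => le_max_left _ _, ?_⟩
  have hterm : ∀ s ∈ Finset.Icc 1 s₀, (n.choose (3 * s) : ℝ) *
      ((1 + ((max 1 (Real.sqrt (5 / (3 * s * (M / R))))) ^ 2 - 1) * (9 * s ^ 2 / 2) / R) ^ M /
        (max 1 (Real.sqrt (5 / (3 * s * (M / R))))) ^ (15 * s)) ≤
      (if (s : ℝ) ≤ L ^ 2 then Real.exp (-(4 * L)) else 0) + Real.exp (-(L ^ 2 / 4)) := by
    intro s hs
    obtain ⟨hs1, hs2⟩ := Finset.mem_Icc.1 hs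
    have hs1' : (1 : ℝ) ≤ s := by exact_mod_cast hs1
    have hs2' : (s : ℝ) ≤ s₀ := by exact_mod_cast hs2
    have hsn : 3 * c ^ 2 * s ≤ 4 * n :=
      (mul_le_mul_of_nonneg_left hs2' (by positivity)).trans hs₀
    have hge : 1 ≤ 5 / (3 * s * (M / R)) := by
      rw [one_le_div (by positivity)]
      have h1 : (M : ℝ) / R ≤ 101 / 100 * c / n := by
        rw [le_div_iff₀ hn']
        exact hpc
      calc 3 * s * ((M : ℝ) / R) ≤ 3 * s * (101 / 100 * c / n) := by gcongr
        _ = 303 / 100 * (c * s) / n := by ring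
        _ ≤ 5 := by
          rw [div_le_iff₀ hn']
          have : c * s * 104 ≤ 3 * c ^ 2 * s := by
            nlinarith [mul_pos hcpos (show (0 : ℝ) < s by linarith)]
          linarith
    have hsqrt : 1 ≤ Real.sqrt (5 / (3 * s * (M / R))) := Real.one_le_sqrt.2 hge
    rw [max_eq_right hsqrt]
    refine (sparse_term_le hn hs1 hM hR hcpos hpc hsqrt (Real.sq_sqrt (by linarith))).trans ?_
    split_ifs with hsL
    · have h1 := sparse_exponent_le_of_small hL hlogL hn' hnL (by linarith) hsL hcpos hcL
      refine le_trans ?_ (le_add_of_nonneg_right (Real.exp_pos _).le)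
      rw [Real.exp_le_exp]
      nlinarith
    · have h1 := sparse_exponent_le_of_large hc0 (y := n / s) (by
        rw [le_div_iff₀ (by linarith)]
        linarith)
      rw [zero_add, Real.exp_le_exp]
      nlinarith
  refine (Finset.sum_le_sum hterm).trans ?_
  rw [Finset.sum_add_distrib]
  refine add_le_add ?_ ?_
  · rw [← Finset.sum_filter, Finset.sum_const, nsmul_eq_mul]
    refine mul_le_mul_of_nonneg_right ?_ (Real.exp_pos _).le
    have hsub : (Finset.Icc 1 s₀).filter (fun s : ℕ => (s : ℝ) ≤ L ^ 2) ⊆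
        Finset.Icc 1 ⌊L ^ 2⌋₊ := by
      intro s hs
      obtain ⟨h1, h2⟩ := Finset.mem_filter.1 hs
      exact Finset.mem_Icc.2 ⟨(Finset.mem_Icc.1 h1).1, Nat.le_floor h2⟩
    have h1 := Finset.card_le_card hsub
    rw [Nat.card_Icc, Nat.add_sub_cancel] at h1
    exact le_trans (by exact_mod_cast h1) (Nat.floor_le (by positivity))
  · rw [Finset.sum_const, nsmul_eq_mul, Nat.card_Icc, Nat.add_sub_cancel]
    exact mul_le_mul_of_nonneg_right hs₀n (Real.exp_pos _).le

/-- With `n / 8` new edges, at most `n / 900` boosters needed, and a density of boosters bounded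
below, the failure probability is exponentially small. -/
theorem booster_term_le {n r s₀ : ℕ} {b M R : ℝ} (hn : 0 < n) (hs : 900 * (s₀ : ℝ) ≤ n)
    (hb : (n : ℝ) ^ 2 ≤ 81 * b) (hr : (n : ℝ) ≤ 9 * r) (hrM : 10 * (r : ℝ) ≤ M)
    (hbM : b ≤ M) (hMR : M ≤ R) (hR : 2 * R ≤ (n : ℝ) ^ 2) :
    (2 : ℝ) ^ s₀ * (1 - b / 2 * (1 - r / M) / R) ^ r ≤ Real.exp (-(n / 4000)) := by
  have hn' : (0 : ℝ) < n := by exact_mod_cast hn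
  have hb0 : 0 < b := by nlinarith
  have hM0 : 0 < M := by linarith
  have hR0 : 0 < R := by linarith
  have hrM' : (r : ℝ) / M ≤ 1 / 10 := by
    rw [div_le_iff₀ hM0]
    linarith
  have hrM0 : 0 ≤ (r : ℝ) / M := by positivity
  have hx1 : b / 2 * (1 - r / M) / R ≤ 1 := by
    rw [div_le_one hR0]
    nlinarith
  have hx : 1 / 90 ≤ b / 2 * (1 - r / M) / R := by
    rw [le_div_iff₀ hR0]
    nlinarith
  have h1 := one_sub_pow_le_exp hx1 r
  have h2 : (2 : ℝ) ^ s₀ = Real.exp (s₀ * Real.log 2) := by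
    rw [Real.exp_nat_mul, Real.exp_log (by norm_num)]
  have hl2 := Real.log_two_lt_d9
  calc _ ≤ Real.exp (s₀ * Real.log 2) * Real.exp (-(r * (b / 2 * (1 - r / M) / R))) := by
        rw [h2]; gcongr
    _ = Real.exp (s₀ * Real.log 2 - r * (b / 2 * (1 - r / M) / R)) := by
        rw [← Real.exp_add]; rfl
    _ ≤ _ := by
        rw [Real.exp_le_exp]
        have h3 : (s₀ : ℝ) * Real.log 2 ≤ s₀ * (7 / 10) :=
          mul_le_mul_of_nonneg_left (by linarith) (by positivity)
        have h4 : (r : ℝ) * (1 / 90) ≤ r * (b / 2 * (1 - r / M) / R) :=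
          mul_le_mul_of_nonneg_left hx (by positivity)
        linarith

end Numerics

/-! ### The total failure probability -/

section Assembly

open Classical in
/-- The probability that Hamiltonicity of the core is lost, bounded by the four failure
probabilities: a small core, a graph that does not spread out, a union that is not locally sparse,
and too few boosters hit. -/
theorem sprinkle_real_losesHamiltonicity_le {n m r k s₀ a b M : ℕ} (hk : 15 ≤ k)
    (hmr : m + r < n.choose 2) (φ : ℕ → ℝ) (hφ : ∀ s, 1 ≤ φ s)
    (h4a : 4 * a ≤ n) (hsa : s₀ ≤ a) (hn : s₀ + 3 ≤ n) (hb : 2 * (b + s₀ * n) ≤ a ^ 2)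
    (hM : M + m + s₀ * n ≤ n.choose 2) (hbM : b ≤ M) (hM0 : 0 < M) (hrM : r ≤ M) :
    (sprinkle n m r).real {p | LosesHamiltonicity k p.1 p.2} ≤
      (n.choose s₀ : ℝ) * ((1 - (1 - 2 / 5) *
        ((s₀ * (n - s₀ : ℕ) : ℕ) - ((k - 1) * s₀ : ℕ)) / (n.choose 2 : ℕ)) ^ m /
          (2 / 5 : ℝ) ^ ((k - 1) * s₀)) +
      ∑ s ∈ Finset.Ioc s₀ a, (n.choose (4 * s) : ℝ) * ((4 * s).choose s *
        (1 - (s * (n - 4 * s : ℕ) : ℕ) / (n.choose 2 : ℕ)) ^ m) +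
      ∑ s ∈ Finset.Icc 1 s₀, (n.choose (3 * s) : ℝ) *
        ((1 + (φ s ^ 2 - 1) * (9 * s ^ 2 / 2) / ((n.choose 2 : ℕ) - m - r)) ^ (m + r) /
          φ s ^ (15 * s)) +
      2 ^ s₀ * (1 - b / 2 * (1 - r / M) / ((n.choose 2 : ℕ) - m)) ^ r := by
  rw [sprinkle_real_eq_pairAvg hmr.le, pairAvg]
  set U := allEdges n with hU
  have hUc : U.card = n.choose 2 := card_allEdges n
  have hC1 : (0 : ℝ) < U.card.choose m := by
    exact_mod_cast Nat.choose_pos (by omega)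
  have hC2 : (0 : ℝ) < (U.card - m).choose r := by
    exact_mod_cast Nat.choose_pos (by omega)
  rw [div_le_iff₀ (by positivity)]
  set B := 2 ^ s₀ * (1 - b / 2 * (1 - r / M) / ((n.choose 2 : ℕ) - m) : ℝ) ^ r with hB
  have hB0 : 0 ≤ B := by
    have hR : ((n.choose 2 - m : ℕ) : ℝ) = (n.choose 2 : ℕ) - m := Nat.cast_sub (by omega)
    have hMR : (M : ℝ) ≤ (n.choose 2 : ℕ) - m := by
      rw [← hR]
      exact_mod_cast (show M ≤ n.choose 2 - m by omega)
    have hM0' : (0 : ℝ) < M := by exact_mod_cast hM0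
    have hbM' : (b : ℝ) ≤ M := by exact_mod_cast hbM
    have hb0 : (0 : ℝ) ≤ b := by positivity
    have hrM' : 0 ≤ (r : ℝ) / M := by positivity
    have hrM1 : (r : ℝ) / M ≤ 1 := div_le_one_of_le₀ (by exact_mod_cast hrM) hM0'.le
    have : b / 2 * (1 - r / M) / ((n.choose 2 : ℕ) - m : ℝ) ≤ 1 := by
      rw [div_le_one (by linarith)]
      nlinarith
    have h1 : 0 ≤ 1 - b / 2 * (1 - r / M) / ((n.choose 2 : ℕ) - m : ℝ) := by linarith
    positivity
  let f₁ : Finset (Sym2 (Fin n)) → ℝ := fun X =>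
    if s₀ < (coreSet (graphOf X) k)ᶜ.ncard then 1 else 0
  let f₂ : Finset (Sym2 (Fin n)) → ℝ := fun X => if ¬ SpreadsOut (graphOf X) s₀ a then 1 else 0
  let f₃ : Finset (Sym2 (Fin n)) → Finset (Sym2 (Fin n)) → ℝ := fun X F =>
    if LocallySparse (graphOf (X ∪ F)) s₀ then 0 else 1
  have hpt : ∀ X ∈ U.powersetCard m, ∑ F ∈ (U \ X).powersetCard r,
      (if (graphOf X, graphOf (X ∪ F)) ∈ {p | LosesHamiltonicity k p.1 p.2} then 1 else 0 : ℝ) ≤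
      (U.card - m).choose r * (f₁ X + f₂ X + B) + ∑ F ∈ (U \ X).powersetCard r, f₃ X F := by
    intro X hX
    obtain ⟨hXU, hXm⟩ := Finset.mem_powersetCard.1 hX
    have hf1 : 0 ≤ f₁ X := by simp only [f₁]; split_ifs <;> norm_num
    have hf2 : 0 ≤ f₂ X := by simp only [f₂]; split_ifs <;> norm_num
    by_cases hgood : (coreSet (graphOf X) k)ᶜ.ncard ≤ s₀ ∧ SpreadsOut (graphOf X) s₀ a
    · have h4 := card_filter_losesHamiltonicity_le (r := r) hk hX hgood.2 hgood.1 h4a hsa hn hb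
        (by rw [card_allEdges]; exact hM) hbM hM0
      rw [← hU, hUc, mul_left_comm, ← hB, ← hUc] at h4
      have h5 : ∑ F ∈ (U \ X).powersetCard r,
          (if (graphOf X, graphOf (X ∪ F)) ∈ {p | LosesHamiltonicity k p.1 p.2} then 1 else 0 : ℝ) ≤
          ((((U \ X).powersetCard r).filter fun F =>
            LosesHamiltonicity k (graphOf X) (graphOf (X ∪ F)) ∧
            LocallySparse (graphOf (X ∪ F)) s₀).card : ℝ) +
          ∑ F ∈ (U \ X).powersetCard r, f₃ X F := by
        rw [Finset.card_filter, Nat.cast_sum, ← Finset.sum_add_distrib]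
        refine Finset.sum_le_sum fun F _ => ?_
        simp only [Set.mem_ofPred_eq, f₃]
        by_cases h1 : LosesHamiltonicity k (graphOf X) (graphOf (X ∪ F)) <;>
          by_cases h2 : LocallySparse (graphOf (X ∪ F)) s₀ <;> simp [h1, h2]
      refine h5.trans (add_le_add (h4.trans ?_) le_rfl)
      exact mul_le_mul_of_nonneg_left (by linarith) hC2.le
    · have h1 : 1 ≤ f₁ X + f₂ X := by
        rcases not_and_or.1 hgood with h | h
        · have : f₁ X = 1 := if_pos (not_le.1 h)
          linarith
        · have : f₂ X = 1 := if_pos h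
          linarith
      have h2 : ∑ F ∈ (U \ X).powersetCard r,
          (if (graphOf X, graphOf (X ∪ F)) ∈ {p | LosesHamiltonicity k p.1 p.2} then 1 else 0 : ℝ) ≤
          (U.card - m).choose r := by
        refine (Finset.sum_le_sum (g := fun _ => (1 : ℝ)) fun F _ => ?_).trans ?_
        · split_ifs <;> norm_num
        · rw [Finset.sum_const, Finset.card_powersetCard, Finset.card_sdiff_of_subset hXU, hXm]
          simp
      have h3 : 0 ≤ ∑ F ∈ (U \ X).powersetCard r, f₃ X F :=
        Finset.sum_nonneg fun F _ => by simp only [f₃]; split_ifs <;> norm_num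
      have h4 : ((U.card - m).choose r : ℝ) * 1 ≤ (U.card - m).choose r * (f₁ X + f₂ X + B) :=
        mul_le_mul_of_nonneg_left (by linarith) hC2.le
      linarith
  refine (Finset.sum_le_sum hpt).trans ?_
  have h1 := card_filter_lt_compl_coreSet_le (n := n) (k := k) (by omega) m s₀ (θ := 2 / 5)
    (by norm_num) (by norm_num)
  have h2 := card_filter_not_spreadsOut_le (n := n) m s₀ a
  have h3 := sum_sum_not_locallySparse_le (n := n) (s₀ := s₀) (by rwa [card_allEdges]) φ hφ
  rw [Finset.card_filter, Nat.cast_sum] at h1 h2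
  have h1' := (Finset.sum_congr rfl fun X _ => (by
    simp only [f₁]; split_ifs <;> simp :
      f₁ X = ((if s₀ < (coreSet (graphOf X) k)ᶜ.ncard then 1 else 0 : ℕ) : ℝ))).trans_le h1
  have h2' := (Finset.sum_congr rfl fun X _ => (by
    simp only [f₂]; split_ifs <;> simp :
      f₂ X = ((if ¬ SpreadsOut (graphOf X) s₀ a then 1 else 0 : ℕ) : ℝ))).trans_le h2
  rw [Finset.sum_add_distrib, ← Finset.mul_sum, Finset.sum_add_distrib, Finset.sum_add_distrib,
    Finset.sum_const, Finset.card_powersetCard, nsmul_eq_mul]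
  have h5 := mul_le_mul_of_nonneg_left (add_le_add (add_le_add h1' h2')
    (le_refl ((U.card.choose m : ℝ) * B))) hC2.le
  refine (add_le_add h5 h3).trans (le_of_eq ?_)
  rw [← hU, hUc]
  have h6 : ∑ s ∈ Finset.Ioc s₀ a, (n.choose (4 * s) : ℝ) * ((4 * s).choose s *
      ((n.choose 2).choose m * (1 - (s * (n - 4 * s : ℕ) : ℕ) / (n.choose 2 : ℕ)) ^ m)) =
      (n.choose 2).choose m * ∑ s ∈ Finset.Ioc s₀ a, (n.choose (4 * s) : ℝ) * ((4 * s).choose s *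
        (1 - (s * (n - 4 * s : ℕ) : ℕ) / (n.choose 2 : ℕ)) ^ m) := by
    rw [Finset.mul_sum]
    exact Finset.sum_congr rfl fun s _ => by ring
  rw [h6]
  ring

set_option maxHeartbeats 1600000 in
/-- For large `n` and the admissible `m`, all four failure probabilities are small. The sum is
`o(n⁻³)` as `L = log n`; its first term comes from dense sets of at most `L ^ 2` vertices. -/
theorem sprinkle_real_losesHamiltonicity_le_exp {n m k : ℕ} {L : ℝ} (hk : 15 ≤ k)
    (hnL : Real.log n = L) (hL : 50 ≤ L) (hlogL : Real.log L ≤ L / 100)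
    (hLn : 1000 * L ^ 4 ≤ n) (hm1 : (1 / 6 : ℝ) * (7 * k - 1) * n ≤ m) (hm2 : (m : ℝ) ≤ n * L) :
    (sprinkle n m (n / 8)).real {p | LosesHamiltonicity k p.1 p.2} ≤
      L ^ 2 * Real.exp (-(4 * L)) + 4 * (n * Real.exp (-(L ^ 2 / 4))) := by
  have hL4 : 50 ^ 4 ≤ L ^ 4 := pow_le_pow_left₀ (by norm_num) hL 4
  have hL2 : 50 ^ 2 ≤ L ^ 2 := pow_le_pow_left₀ (by norm_num) hL 2
  have hLL : L * 125000 ≤ L ^ 4 := by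
    have : 50 ^ 3 ≤ L ^ 3 := pow_le_pow_left₀ (by norm_num) hL 3
    nlinarith only [this, hL]
  have hL24 : L ^ 2 * 2500 ≤ L ^ 4 := by nlinarith only [hL2]
  have hn : (1000000 : ℝ) ≤ n := by linarith
  have hnN : 1000000 ≤ n := by exact_mod_cast hn
  have hn0 : (0 : ℝ) < n := by linarith
  have hNe : ((n.choose 2 : ℕ) : ℝ) = n * (n - 1) / 2 := Nat.cast_choose_two ℝ n
  have hNe' : ((n.choose 2 : ℕ) : ℝ) = (n : ℝ) ^ 2 / 2 - n / 2 := by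
    rw [hNe]
    ring
  have hq1 : 1000000 * (n : ℝ) ≤ n ^ 2 := by
    rw [sq]
    exact mul_le_mul_of_nonneg_right hn hn0.le
  -- the average degree
  obtain ⟨c, hc⟩ : ∃ c : ℝ, c * n = 2 * m := ⟨2 * m / n, by field_simp⟩
  have hk' : (15 : ℝ) ≤ k := by exact_mod_cast hk
  have hck : (7 * (k : ℝ) - 1) / 3 ≤ c := by
    refine le_of_mul_le_mul_right ?_ hn0
    rw [hc]
    linarith
  have hc0 : 104 / 3 ≤ c := by linarith
  have hcL : c ≤ 2 * L := by
    refine le_of_mul_le_mul_right ?_ hn0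
    rw [hc]
    linarith
  have hkc : (k : ℝ) - 1 ≤ (3 * c - 6) / 7 := by linarith
  have hc2 : c ^ 2 ≤ 4 * L ^ 2 := by nlinarith only [hcL, hc0]
  have hcn : 300 * c ^ 2 ≤ n := by linarith
  have hmn : (m : ℝ) * 1000000 ≤ n ^ 2 := by
    have h1 : 1000000 * L * n ≤ n * n := mul_le_mul_of_nonneg_right (by linarith) hn0.le
    nlinarith only [h1, hm2]
  -- the threshold between small and large sets: sets below it are sparse because
  -- `n / s ≥ 3 * c ^ 2 / 4`, and sets above it spread out because `n / s ≤ 3 * c ^ 2 / 4`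
  set s₀ := ⌊4 * (n : ℝ) / (3 * c ^ 2)⌋₊ with hs₀
  have hc2pos : 0 < 3 * c ^ 2 := by positivity
  have hs1 : 3 * c ^ 2 * s₀ ≤ 4 * n := by
    have := Nat.floor_le (show 0 ≤ 4 * (n : ℝ) / (3 * c ^ 2) by positivity)
    rw [le_div_iff₀ hc2pos] at this
    linarith
  have hs2 : 4 * (n : ℝ) < 3 * c ^ 2 * (s₀ + 1) := by
    have := Nat.lt_floor_add_one (4 * (n : ℝ) / (3 * c ^ 2))
    rw [div_lt_iff₀ hc2pos] at this
    linarith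
  have hs900 : 900 * (s₀ : ℝ) ≤ n := by
    have : (0 : ℝ) ≤ s₀ := by positivity
    nlinarith only [this, hs1,
      mul_le_mul_of_nonneg_right (pow_le_pow_left₀ (by norm_num) hc0 2) this]
  have hq2 : 900 * ((s₀ : ℝ) * n) ≤ n ^ 2 := by
    rw [sq, ← mul_assoc]
    exact mul_le_mul_of_nonneg_right hs900 hn0.le
  have hs900' : 900 * s₀ ≤ n := by exact_mod_cast hs900
  have hs₀L : 60 * L ^ 2 ≤ s₀ := by
    have h1 : 3 * c ^ 2 * ((s₀ : ℝ) + 1) ≤ 12 * L ^ 2 * (s₀ + 1) := by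
      have : (0 : ℝ) ≤ s₀ := by positivity
      nlinarith only [hc2, this, mul_le_mul_of_nonneg_right hc2 this]
    have h2 : 4 * (1000 * L ^ 4) < 12 * L ^ 2 * (s₀ + 1) := by linarith
    have h3 : 4000 * L ^ 2 < 12 * ((s₀ : ℝ) + 1) := by
      refine lt_of_mul_lt_mul_left (a := L ^ 2) ?_ (by positivity)
      linarith
    linarith
  have hs₀1 : 1 ≤ s₀ := by
    have : (1 : ℝ) ≤ s₀ := by linarith
    exact_mod_cast this
  -- the number of boosters and of available pairs
  have hr8 : (n : ℝ) - 7 ≤ 8 * (n / 8 : ℕ) := by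
    have : n ≤ 8 * (n / 8) + 7 := by omega
    have : (n : ℝ) ≤ 8 * (n / 8 : ℕ) + 7 := by exact_mod_cast this
    linarith
  have hr8' : 8 * ((n / 8 : ℕ) : ℝ) ≤ n := by
    have : 8 * (n / 8) ≤ n := by omega
    exact_mod_cast this
  have ha6 : (n : ℝ) - 5 ≤ 6 * (n / 6 : ℕ) := by
    have : n ≤ 6 * (n / 6) + 5 := by omega
    have : (n : ℝ) ≤ 6 * (n / 6 : ℕ) + 5 := by exact_mod_cast this
    linarith
  have hb80 : 80 * ((n ^ 2 / 80 : ℕ) : ℝ) ≤ n ^ 2 := by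
    have : 80 * (n ^ 2 / 80) ≤ n ^ 2 := by omega
    exact_mod_cast this
  have hb80' : (n : ℝ) ^ 2 ≤ 81 * (n ^ 2 / 80 : ℕ) := by
    have : n ^ 2 ≤ 80 * (n ^ 2 / 80) + 79 := by omega
    have h1 : (n : ℝ) ^ 2 ≤ 80 * (n ^ 2 / 80 : ℕ) + 79 := by exact_mod_cast this
    linarith
  have hroom : m + s₀ * n ≤ n.choose 2 := by
    have : (m : ℝ) + s₀ * n ≤ (n.choose 2 : ℕ) := by
      rw [hNe']
      linarith
    exact_mod_cast this
  set M := n.choose 2 - m - s₀ * n with hM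
  have hMr : (M : ℝ) = (n : ℝ) ^ 2 / 2 - n / 2 - m - s₀ * n := by
    rw [hM, Nat.cast_sub (by omega), Nat.cast_sub (by omega), hNe']
    push_cast
    ring
  have hMbig : (n : ℝ) ^ 2 / 4 ≤ M := by
    rw [hMr]
    linarith
  have hbM : ((n ^ 2 / 80 : ℕ) : ℝ) ≤ M := by linarith
  have hrM : 10 * ((n / 8 : ℕ) : ℝ) ≤ M := by linarith
  have hM0 : (0 : ℝ) < M := by linarith
  have hmr : m + n / 8 < n.choose 2 := by
    have : (m : ℝ) + (n / 8 : ℕ) < (n.choose 2 : ℕ) := by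
      rw [hNe']
      linarith
    exact_mod_cast this
  have hbound : 2 * (n ^ 2 / 80 + s₀ * n) ≤ (n / 6) ^ 2 := by
    have : 2 * (((n ^ 2 / 80 : ℕ) : ℝ) + s₀ * n) ≤ ((n / 6 : ℕ) : ℝ) ^ 2 := by
      have h1 : ((n : ℝ) - 5) ^ 2 ≤ (6 * (n / 6 : ℕ)) ^ 2 :=
        pow_le_pow_left₀ (by linarith) ha6 2
      rw [sub_sq, mul_pow] at h1
      linarith
    exact_mod_cast this
  have hR : (0 : ℝ) < (n.choose 2 : ℕ) - m - (n / 8 : ℕ) := by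
    have : ((m + n / 8 : ℕ) : ℝ) < (n.choose 2 : ℕ) := by exact_mod_cast hmr
    push_cast at this
    linarith
  have hpc : ((m + n / 8 : ℕ) : ℝ) / ((n.choose 2 : ℕ) - m - (n / 8 : ℕ)) * n ≤ 101 / 100 * c := by
    rw [div_mul_eq_mul_div, div_le_iff₀ hR, hNe']
    push_cast
    have hm' : (m : ℝ) = c * n / 2 := by linarith
    have h1 : (n : ℝ) ^ 2 * (998 / 2000) ≤
        (n : ℝ) ^ 2 / 2 - n / 2 - m - (n / 8 : ℕ) := by linarith
    have h2 : 101 / 100 * c * ((n : ℝ) ^ 2 * (998 / 2000)) ≤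
        101 / 100 * c * ((n : ℝ) ^ 2 / 2 - n / 2 - m - (n / 8 : ℕ)) :=
      mul_le_mul_of_nonneg_left h1 (by linarith)
    refine le_trans ?_ h2
    rw [hm']
    have h3 : (c * n / 2 + ((n / 8 : ℕ) : ℝ)) * n ≤ (c * n / 2 + n / 8) * n := by
      refine mul_le_mul_of_nonneg_right ?_ hn0.le
      linarith
    have h4 : 104 / 3 * (n : ℝ) ^ 2 ≤ c * n ^ 2 := mul_le_mul_of_nonneg_right hc0 (by positivity)
    nlinarith only [h3, h4]
  obtain ⟨φ, hφ, hsparse⟩ := sum_sparse_term_le (n := n) (M := m + n / 8) (s₀ := s₀) (by omega)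
    (by omega) hR hL hlogL hnL hc0 hcL hpc hs1
  refine (sprinkle_real_losesHamiltonicity_le (a := n / 6) (b := n ^ 2 / 80) (M := M) hk hmr φ hφ
    (by omega) (by omega) (by omega) hbound (by omega) (by exact_mod_cast hbM)
    (by exact_mod_cast hM0) (by
      have : ((n / 8 : ℕ) : ℝ) ≤ M := by
        linarith [(Nat.cast_nonneg (n / 8) : (0 : ℝ) ≤ (n / 8 : ℕ))]
      exact_mod_cast this)).trans ?_
  have hexp_le : Real.exp (-(L ^ 2 / 4)) ≤ n * Real.exp (-(L ^ 2 / 4)) :=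
    le_mul_of_one_le_left (Real.exp_pos _).le (by linarith)
  have h1 := core_term_le (n := n) (m := m) (k := k) (by omega) (by omega) hs₀1 hc hc0 hkc hcn
    hs1 hs2
  have h1' : Real.exp (-((s₀ : ℝ) / 20)) ≤ Real.exp (-(L ^ 2 / 4)) := by
    rw [Real.exp_le_exp]
    linarith
  have h2 : ∑ s ∈ Finset.Ioc s₀ (n / 6), (n.choose (4 * s) : ℝ) * ((4 * s).choose s *
        (1 - (s * (n - 4 * s : ℕ) : ℕ) / (n.choose 2 : ℕ)) ^ m) ≤
      n * Real.exp (-(L ^ 2 / 4)) := by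
    have hterm : ∀ s ∈ Finset.Ioc s₀ (n / 6), (n.choose (4 * s) : ℝ) * ((4 * s).choose s *
        (1 - (s * (n - 4 * s : ℕ) : ℕ) / (n.choose 2 : ℕ)) ^ m) ≤ Real.exp (-(L ^ 2 / 4)) := by
      intro s hs
      obtain ⟨hs3, hs4⟩ := Finset.mem_Ioc.1 hs
      have hs5 : (s₀ : ℝ) + 1 ≤ s := by exact_mod_cast hs3
      refine (spread_term_le (by omega) (by omega) hc hc0 (by omega) ?_).trans ?_
      · nlinarith only [hs2, hs5, mul_le_mul_of_nonneg_left hs5 hc2pos.le]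
      · rw [Real.exp_le_exp]
        linarith
    refine (Finset.sum_le_sum hterm).trans ?_
    rw [Finset.sum_const, nsmul_eq_mul]
    refine mul_le_mul_of_nonneg_right ?_ (Real.exp_pos _).le
    rw [Nat.card_Ioc]
    exact_mod_cast (show n / 6 - s₀ ≤ n by omega)
  have h4 := booster_term_le (n := n) (r := n / 8) (s₀ := s₀) (b := (n ^ 2 / 80 : ℕ)) (M := M)
    (R := (n.choose 2 : ℕ) - m) (by omega) hs900 hb80' (by linarith) hrM hbM (by
      rw [hMr, hNe']
      have : (0 : ℝ) ≤ s₀ * n := by positivity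
      linarith) (by
      rw [hNe']
      have : (0 : ℝ) ≤ m := by positivity
      linarith)
  have h4' : Real.exp (-((n : ℝ) / 4000)) ≤ Real.exp (-(L ^ 2 / 4)) := by
    rw [Real.exp_le_exp]
    linarith
  linarith

/-- The conditions on `n` under which the estimates hold. -/
theorem eventually_large (ε : ℝ) (hε : 0 < ε) : ∀ᶠ n : ℕ in Filter.atTop,
    50 ≤ Real.log n ∧ Real.log (Real.log n) ≤ Real.log n / 100 ∧
      1000 * Real.log n ^ 4 ≤ n ∧ (Real.log n ^ 2 + 4) ≤ ε * n := by
  have hlog : Filter.Tendsto (fun n : ℕ => Real.log n) Filter.atTop Filter.atTop :=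
    Real.tendsto_log_atTop.comp tendsto_natCast_atTop_atTop
  have hpow : ∀ (j : ℕ) (δ : ℝ), 0 < δ → ∀ᶠ x : ℝ in Filter.atTop, Real.log x ^ j ≤ δ * x := by
    intro j δ hδ
    have h := (isLittleO_log_rpow_rpow_atTop (j : ℝ) (show (0 : ℝ) < 1 by norm_num)).bound hδ
    filter_upwards [h, Filter.eventually_ge_atTop 1] with x hx hx1
    rw [Real.rpow_natCast, Real.rpow_one, Real.norm_eq_abs, Real.norm_eq_abs,
      abs_of_nonneg (show (0 : ℝ) ≤ x by linarith)] at hx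
    exact (le_abs_self _).trans hx
  have h1 : ∀ᶠ x : ℝ in Filter.atTop, Real.log x ≤ 1 / 100 * x := by
    simpa using hpow 1 (1 / 100) (by norm_num)
  filter_upwards [hlog.eventually_ge_atTop 50, hlog.eventually h1,
    tendsto_natCast_atTop_atTop.eventually (hpow 4 (1 / 1000) (by norm_num)),
    tendsto_natCast_atTop_atTop.eventually (hpow 2 (ε / 2) (by linarith)),
    tendsto_natCast_atTop_atTop.eventually_ge_atTop (8 / ε)] with n h50 hll h4 h2 hn
  refine ⟨h50, by linarith, by linarith, ?_⟩
  rw [div_le_iff₀ hε] at hn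
  linarith

end Assembly

end KCore

theorem mainTheorem4 (k : ℕ) (hk : 15 ≤ k) :
    ∀ ε : ℝ, 0 < ε → ∃ N : ℕ, ∀ n : ℕ, N ≤ n → ∀ m : ℕ,
      (1 / 6 : ℝ) * (7 * (k : ℝ) - 1) * (n : ℝ) ≤ (m : ℝ) →
      (m : ℝ) ≤ (n : ℝ) * Real.log (n : ℝ) →
      (KCore.sprinkle n m (n / 8)).real
          {p : SimpleGraph (Fin n) × SimpleGraph (Fin n) |
            KCore.IsHamiltonianSubgraph (KCore.kCore p.1 k) ∧
            (KCore.kCore p.2 k).Connected ∧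
            ¬ KCore.IsHamiltonianSubgraph (KCore.kCore p.2 k)} ≤
        ε / (n : ℝ) ^ 3 := by
  intro ε hε
  obtain ⟨N, hN⟩ := Filter.eventually_atTop.1 (KCore.eventually_large ε hε)
  refine ⟨N, fun n hn m hm1 hm2 => ?_⟩
  obtain ⟨h50, hll, h4, h2⟩ := hN n hn
  set L := Real.log n with hL
  have hn0 : (0 : ℝ) < n := by
    have : 0 < L ^ 4 := by positivity
    linarith
  have hroom : m + n / 8 ≤ n.choose 2 := by
    have hL4 : L * 125000 ≤ L ^ 4 := by
      have : 50 ^ 3 ≤ L ^ 3 := pow_le_pow_left₀ (by norm_num) h50 3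
      nlinarith
    have hr : 8 * ((n / 8 : ℕ) : ℝ) ≤ n := by
      have : 8 * (n / 8) ≤ n := by omega
      exact_mod_cast this
    have : (m : ℝ) + (n / 8 : ℕ) ≤ (n.choose 2 : ℕ) := by
      rw [Nat.cast_choose_two]
      nlinarith
    exact_mod_cast this
  have := KCore.isProbabilityMeasure_sprinkle hroom
  have hmono := measureReal_mono (μ := KCore.sprinkle n m (n / 8))
    (s₁ := {p : SimpleGraph (Fin n) × SimpleGraph (Fin n) |
            KCore.IsHamiltonianSubgraph (KCore.kCore p.1 k) ∧
            (KCore.kCore p.2 k).Connected ∧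
            ¬ KCore.IsHamiltonianSubgraph (KCore.kCore p.2 k)})
    (s₂ := {p | KCore.LosesHamiltonicity k p.1 p.2}) (fun p hp => ⟨hp.1, hp.2.2⟩)
  refine hmono.trans ((KCore.sprinkle_real_losesHamiltonicity_le_exp hk hL.symm h50 hll h4 hm1
    hm2).trans ?_)
  have hexp : Real.exp (-(4 * L)) = 1 / (n : ℝ) ^ 4 := by
    rw [Real.exp_neg, one_div, ← Nat.cast_ofNat (R := ℝ) (n := 4), Real.exp_nat_mul,
      Real.exp_log hn0]
  have hexp' : n * Real.exp (-(L ^ 2 / 4)) ≤ 1 / (n : ℝ) ^ 4 := by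
    rw [← hexp]
    conv_lhs => rw [← Real.exp_log hn0, ← hL, ← Real.exp_add]
    rw [Real.exp_le_exp]
    nlinarith
  calc _ ≤ L ^ 2 * (1 / (n : ℝ) ^ 4) + 4 * (1 / (n : ℝ) ^ 4) := by
        rw [hexp]
        linarith
    _ = (L ^ 2 + 4) / n ^ 4 := by ring
    _ ≤ ε * n / n ^ 4 := by gcongr
    _ = ε / n ^ 3 := by field_simp
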